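/- Let $T>0$, $\alpha,\beta\in[0,1]$, $\kappa>0$, and let $g:[0,1]\to[0,1]$ be measurable. Solutions are weak solutions $\rho:[0,T]\times[0,1]\to[0,1]$ in $L^2(0,T;\mathcal H^1)$, where $\mathcal H^1$ is the Sobolev space on $[0,1]$; boundary values $\rho_s(0),\rho_s(1)$ are those of the continuous representative of $\rho_s$ (which exists for a.e. $s$). Write $$B_t(\rho,G)=\int_0^1\rho_tG_t\,dq-\int_0^1 g\,G_0\,dq-\int_0^t\!\int_0^1\rho_s\big(\tfrac12\Delta+\partial_s\big)G_s\,dq\,ds .$$ **1. Dirichlet data.** Consider $\partial_t\rho=\frac12\Delta\rho$ on $(0,1)$ with $\rho_t(0)=\alpha$, $\rho_t(1)=\beta$ and initial condition $g$, in either of the following two weak senses: (a) $B_t(\rho,G)+\int_0^t\{\frac\beta2\partial_qG_s(1)-\frac\alpha2\partial_qG_s(0)\}ds=0$ for all $t\in[0,T]$ and all $G\in C^{1,2}([0,T]\times[0,1])$ with $G_s(0)=G_s(1)=0$; or (b) $B_t(\rho,G)=0$ for all $t\in[0,T]$ and all $G\in C^{1,2}$ such that each $G_s$ has compact support in $(0,1)$,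 together with $\rho_t(0)=\alpha$, $\rho_t(1)=\beta$ for $t\in(0,T]$ (and with the continuous representative of $\rho_t$ taking these boundary values for a.e. $t$). In each sense there is a solution; the same function $\rho$ solves both, and any solution in either sense agrees with it at every time $t\in[0,T]$ for a.e. $q$. It is given, for $t\in(0,T]$ and $q\in[0,1]$, by $$\rho_t(q)=\bar\rho_{Dir}(q)+\sum_{n=1}^\infty c_n\,e^{-\frac{(n\pi)^2}{2}t}\,2\sin(n\pi q),\qquad \bar\rho_{Dir}(q)=(\beta-\alpha)q+\alpha,$$ with $c_n=\int_0^1\big(g(q)-\bar\rho_{Dir}(q)\big)\sin(n\pi q)\,dq$. At $t=0$, $\rho_0=g$ and the series converges to $g-\bar\rho_{Dir}$ in $L^2([0,1])$. **2. Robin data.** For every $n\ge1$ there is exactly one $\lambda_n>0$ with $(n-1)\pi\le\sqrt{\lambda_n}\le n\pi$ that solves $$\tan\sqrt{\lambda}=\frac{2\kappa\sqrt{\lambda}}{\lambda-\kappa^2},\qquad\text{read as}\qquad(\lambda-\kappa^2)\sin\sqrt{\lambda}=2\kappa\sqrt{\lambda}\cos\sqrt{\lambda}$$ (the first form holds for $\lambda=\lambda_n$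 whenever $\lambda_n\ne\kappa^2$), and $\lambda_n\sim n^2\pi^2$ as $n\to\infty$. Let $$X_n(q)=A_n\sin(\sqrt{\lambda_n}\,q)+A_n\frac{\sqrt{\lambda_n}}{\kappa}\cos(\sqrt{\lambda_n}\,q),$$ where $A_n$ is a constant for which $X_n$ has unit $L^2([0,1])$-norm; such constants exist. Then $X_n''=-\lambda_nX_n$, $X_n'(0)=\kappa X_n(0)$ and $X_n'(1)=-\kappa X_n(1)$. The equation $\partial_t\rho=\frac12\Delta\rho$ on $(0,1)$ with $\partial_q\rho_t(0)=\kappa(\rho_t(0)-\alpha)$, $\partial_q\rho_t(1)=\kappa(\beta-\rho_t(1))$ and initial condition $g$, in the weak sense $$B_t(\rho,G)+\tfrac12\int_0^t\{\rho_s(1)\partial_qG_s(1)-\rho_s(0)\partial_qG_s(0)\}ds-\tfrac\kappa2\int_0^t\{G_s(0)(\alpha-\rho_s(0))+G_s(1)(\beta-\rho_s(1))\}ds=0$$ for all $t\in[0,T]$ and all $G\in C^{1,2}([0,T]\times[0,1])$, has a solution $\rho$, and any solution agrees with it at every $t\in[0,T]$ for a.e. $q$. It is given, for $t\in(0,T]$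 and $q\in[0,1]$, by $$\rho_t(q)=\bar\rho_{Rob}(q)+\sum_{n=1}^\infty C_n\,e^{-\frac{\lambda_n}{2}t}X_n(q),\qquad \bar\rho_{Rob}(q)=\frac{\kappa(\beta-\alpha)}{2+\kappa}q+\alpha+\frac{\beta-\alpha}{2+\kappa},$$ with $C_n=\int_0^1\big(g(q)-\bar\rho_{Rob}(q)\big)X_n(q)\,dq$. At $t=0$, $\rho_0=g$ and the series converges to $g-\bar\rho_{Rob}$ in $L^2([0,1])$. -/

import Mathlib

open MeasureTheory Set Filter Topology
open scoped ContDiff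

namespace HeatSeries

/-- `r` is a weak derivative of `f` on the open interval `(0,1)`. -/
def HasWeakDeriv (f r : ℝ → ℝ) : Prop :=
  ∀ φ : ℝ → ℝ, ContDiff ℝ ∞ φ → HasCompactSupport φ → tsupport φ ⊆ Ioo (0 : ℝ) 1 →
    ∫ q in (0 : ℝ)..1, f q * deriv φ q = -∫ q in (0 : ℝ)..1, r q * φ q

/-- Lebesgue measure on `[0,T] × [0,1]`. -/
noncomputable def spaceTime (T : ℝ) : Measure (ℝ × ℝ) :=
  (volume.restrict (Icc (0 : ℝ) T)).prod (volume.restrict (Icc (0 : ℝ) 1))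

/-- `ρ` belongs to `L²(0,T;H¹)` and `u` is its spatially continuous version: for almost every
time `s`, `u s` is the continuous representative on `[0,1]` of the Sobolev function `ρ s`; both `u`
and its weak space derivative are square integrable on `[0,T] × [0,1]`.
The boundary values `ρ_s(0)`, `ρ_s(1)` of the Sobolev function `ρ_s` are `u s 0`, `u s 1`. -/
structure IsL2H1 (T : ℝ) (ρ u : ℝ → ℝ → ℝ) : Prop where
  ae_eq : ∀ᵐ s ∂volume.restrict (Icc (0 : ℝ) T), ρ s =ᵐ[volume.restrict (Icc (0 : ℝ) 1)] u s
  cont : ∀ᵐ s ∂volume.restrict (Icc (0 : ℝ) T), ContinuousOn (u s) (Icc (0 : ℝ) 1)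
  memLp : MemLp (fun p : ℝ × ℝ => u p.1 p.2) 2 (spaceTime T)
  weakDeriv : ∃ r : ℝ → ℝ → ℝ, MemLp (fun p : ℝ × ℝ => r p.1 p.2) 2 (spaceTime T) ∧
    ∀ᵐ s ∂volume.restrict (Icc (0 : ℝ) T), HasWeakDeriv (u s) (r s)

/-- `G ∈ C^{1,2}([0,T] × [0,1])`, with `Gs = ∂_s G`, `Gq = ∂_q G`, `Gqq = ∂_q² G`
(one-sided derivatives on the boundary). -/
structure IsC12 (T : ℝ) (G Gs Gq Gqq : ℝ → ℝ → ℝ) : Prop where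
  deriv_s : ∀ s ∈ Icc (0 : ℝ) T, ∀ q ∈ Icc (0 : ℝ) 1,
    HasDerivWithinAt (fun s' => G s' q) (Gs s q) (Icc (0 : ℝ) T) s
  deriv_q : ∀ s ∈ Icc (0 : ℝ) T, ∀ q ∈ Icc (0 : ℝ) 1,
    HasDerivWithinAt (G s) (Gq s q) (Icc (0 : ℝ) 1) q
  deriv_qq : ∀ s ∈ Icc (0 : ℝ) T, ∀ q ∈ Icc (0 : ℝ) 1,
    HasDerivWithinAt (Gq s) (Gqq s q) (Icc (0 : ℝ) 1) q
  cont : ContinuousOn (fun p : ℝ × ℝ => G p.1 p.2) (Icc (0 : ℝ) T ×ˢ Icc (0 : ℝ) 1)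
  cont_s : ContinuousOn (fun p : ℝ × ℝ => Gs p.1 p.2) (Icc (0 : ℝ) T ×ˢ Icc (0 : ℝ) 1)
  cont_q : ContinuousOn (fun p : ℝ × ℝ => Gq p.1 p.2) (Icc (0 : ℝ) T ×ˢ Icc (0 : ℝ) 1)
  cont_qq : ContinuousOn (fun p : ℝ × ℝ => Gqq p.1 p.2) (Icc (0 : ℝ) T ×ˢ Icc (0 : ℝ) 1)

/-- `ρ` maps `[0,T] × [0,1]` to `[0,1]` and all its time slices are (Lebesgue) measurable. -/
structure IsProfile (T : ℝ) (ρ : ℝ → ℝ → ℝ) : Prop where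
  mem : ∀ t ∈ Icc (0 : ℝ) T, ∀ q ∈ Icc (0 : ℝ) 1, ρ t q ∈ Icc (0 : ℝ) 1
  meas : ∀ t ∈ Icc (0 : ℝ) T, AEMeasurable (ρ t) (volume.restrict (Icc (0 : ℝ) 1))

/-- The part of the weak formulations without boundary terms:
`∫ ρ_t G_t - ∫ g G_0 - ∫_0^t ∫ ρ_s (½ Δ + ∂_s) G_s`. -/
noncomputable def bulkTerm (g : ℝ → ℝ) (ρ G Gs Gqq : ℝ → ℝ → ℝ) (t : ℝ) : ℝ :=
  (∫ q in (0 : ℝ)..1, ρ t q * G t q) - (∫ q in (0 : ℝ)..1, g q * G 0 q)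
    - ∫ s in (0 : ℝ)..t, ∫ q in (0 : ℝ)..1, ρ s q * (1 / 2 * Gqq s q + Gs s q)

/-- Weak solution of `∂_t ρ = ½ Δ ρ`, `ρ_t(0) = α`, `ρ_t(1) = β`, started from `g`, tested against
`C^{1,2}` functions that vanish at `q = 0` and `q = 1`. -/
def IsWeakDirichlet (T α β : ℝ) (g : ℝ → ℝ) (ρ : ℝ → ℝ → ℝ) : Prop :=
  IsProfile T ρ ∧ (∃ u, IsL2H1 T ρ u) ∧
    ∀ t ∈ Icc (0 : ℝ) T, ∀ G Gs Gq Gqq : ℝ → ℝ → ℝ, IsC12 T G Gs Gq Gqq →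
      (∀ s ∈ Icc (0 : ℝ) T, G s 0 = 0 ∧ G s 1 = 0) →
      bulkTerm g ρ G Gs Gqq t + ∫ s in (0 : ℝ)..t, (β / 2 * Gq s 1 - α / 2 * Gq s 0) = 0

/-- Weak solution of `∂_t ρ = ½ Δ ρ`, `ρ_t(0) = α`, `ρ_t(1) = β`, started from `g`, tested against
`C^{1,2}` functions all of whose time slices are compactly supported in `(0,1)`; here the boundary
values are imposed separately, both on `ρ` and on the continuous version of `ρ`. -/
def IsWeakDirichletCompact (T α β : ℝ) (g : ℝ → ℝ) (ρ : ℝ → ℝ → ℝ) : Prop :=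
  IsProfile T ρ ∧
    (∃ u, IsL2H1 T ρ u ∧ ∀ᵐ s ∂volume.restrict (Icc (0 : ℝ) T), u s 0 = α ∧ u s 1 = β) ∧
    (∀ t ∈ Ioc (0 : ℝ) T, ρ t 0 = α ∧ ρ t 1 = β) ∧
    ∀ t ∈ Icc (0 : ℝ) T, ∀ G Gs Gq Gqq : ℝ → ℝ → ℝ, IsC12 T G Gs Gq Gqq →
      (∀ s ∈ Icc (0 : ℝ) T, ∃ K : Set ℝ, IsCompact K ∧ K ⊆ Ioo 0 1 ∧
        ∀ q ∈ Icc (0 : ℝ) 1, q ∉ K → G s q = 0) →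
      bulkTerm g ρ G Gs Gqq t = 0

/-- Weak solution of `∂_t ρ = ½ Δ ρ`, `∂_q ρ_t(0) = κ (ρ_t(0) - α)`, `∂_q ρ_t(1) = κ (β - ρ_t(1))`,
started from `g`, tested against all `C^{1,2}` functions. -/
def IsWeakRobin (T κ α β : ℝ) (g : ℝ → ℝ) (ρ : ℝ → ℝ → ℝ) : Prop :=
  IsProfile T ρ ∧ ∃ u, IsL2H1 T ρ u ∧
    ∀ t ∈ Icc (0 : ℝ) T, ∀ G Gs Gq Gqq : ℝ → ℝ → ℝ, IsC12 T G Gs Gq Gqq →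
      bulkTerm g ρ G Gs Gqq t
        + 1 / 2 * (∫ s in (0 : ℝ)..t, (u s 1 * Gq s 1 - u s 0 * Gq s 0))
        - κ / 2 * (∫ s in (0 : ℝ)..t, (G s 0 * (α - u s 0) + G s 1 * (β - u s 1))) = 0

/-- Stationary profile for Dirichlet data. -/
def statDir (α β q : ℝ) : ℝ := (β - α) * q + α

/-- Stationary profile for Robin data. -/
noncomputable def statRob (κ α β q : ℝ) : ℝ :=
  κ * (β - α) / (2 + κ) * q + α + (β - α) / (2 + κ)

/-- `X(q) = A sin(√μ q) + A (√μ / κ) cos(√μ q)`. -/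
noncomputable def robinMode (κ μ A q : ℝ) : ℝ :=
  A * Real.sin (√μ * q) + A * (√μ / κ) * Real.cos (√μ * q)

/-- The equation `tan √μ = 2 κ √μ / (μ - κ²)` for `μ > 0`, with denominators cleared. -/
def SolvesTrans (κ μ : ℝ) : Prop :=
  0 < μ ∧ (μ - κ ^ 2) * Real.sin √μ = 2 * κ * √μ * Real.cos √μ

/-- `ρ` has the expansion
`ρ_t(q) = ρbar(q) + ∑_n c n * exp (-(μ n / 2) t) * e n q`:
with pointwise convergence at all positive times, and in `L²([0,1])` at time `0`,
where `ρ_0 = g`. -/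
def HasExpansion (T : ℝ) (g ρbar : ℝ → ℝ) (c μ : ℕ → ℝ) (e : ℕ → ℝ → ℝ)
    (ρ : ℝ → ℝ → ℝ) : Prop :=
  (∀ t ∈ Ioc (0 : ℝ) T, ∀ q ∈ Icc (0 : ℝ) 1,
    HasSum (fun n => c n * Real.exp (-(μ n / 2) * t) * e n q) (ρ t q - ρbar q)) ∧
  (∀ q ∈ Icc (0 : ℝ) 1, ρ 0 q = g q) ∧
  Tendsto (fun N : ℕ => ∫ q in (0 : ℝ)..1,
    (ρ 0 q - ρbar q - ∑ n ∈ Finset.range N, c n * e n q) ^ 2) atTop (𝓝 0)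

/-- `ρ'` and `ρ` agree almost everywhere in space, at every time in `[0,T]`. -/
def AgreeAE (T : ℝ) (ρ' ρ : ℝ → ℝ → ℝ) : Prop :=
  ∀ t ∈ Icc (0 : ℝ) T, ρ' t =ᵐ[volume.restrict (Icc (0 : ℝ) 1)] ρ t

end HeatSeries

/-! Both problems are instances of one abstract problem. The boundary conditions are `RobinBC σ κ`,
with `σ = 0` for Dirichlet and `σ = 1` for Robin data, and `ModeSystem` collects what is needed of
the eigenfunctions. The general theory uses nothing else about sines and cosines.

Completeness of the modes. The operator `1 - k⁻² d²/dq²` with these boundary conditions has an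
explicit continuous, symmetric, nonnegative Green kernel. The integral operator `resolv` is compact
by Arzelà-Ascoli, self-adjoint and injective on L². An eigenfunction with nonzero eigenvalue solves
a constant-coefficient ODE with the boundary conditions, so it is a multiple of a mode
(`eigen_resolv`). The spectral theorem then makes the modes a Hilbert basis.

Existence. After subtraction of the affine stationary profile, the solution is the sum of `c n * exp
(-(lam n / 2) t) * e n`. Each term satisfies a weak identity by integration by parts
(`IsC12.weak_mode`). The sum is legitimate although the coefficients are only square summable at
time 0, because integration in time gains the summable factor `(lam n)⁻¹`; the energy inequality
gives the L²(H¹) bound. That the values stay in `[0,1]` is a comparison principle: `resolv` with `k²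
= 2N/t` is one implicit Euler step of length `t/N`, it is monotone and does not increase affine
supersolutions, and `(1 + lam t / (2N))^(-N)` tends to `exp (-lam t / 2)` (`modeSeries_decay_le`).

Uniqueness. The function `exp (lam n s / 2) * e n q` solves the backward heat equation, so testing
with it removes the interior term and determines the n-th coefficient of any solution; completeness
does the rest. In the Robin case the unknown traces cancel because the mode satisfies the boundary
condition. For compactly supported tests the modes are cut off near both ends; the second
derivatives of the cutoffs concentrate in boundary layers that pick out the prescribed boundary
values (`tendsto_integral_layer`).

Robin eigenvalues. The transcendental equation at `λ = s²` says that the sine of `s + 2 arctan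
(s/κ)` vanishes. This phase is strictly increasing and lies strictly between `s` and `s + π`, so it
takes the value `(n+1)π` exactly once, at a point of `[nπ, (n+1)π]`, and no other root lies there.
-/

namespace HeatSeries

/-! ### The Green function of `1 - k⁻² d²/dq²` with Robin-type boundary conditions -/

/-- The boundary conditions `σ h'(0) = κ h(0)`, `σ h'(1) = -κ h(1)`. -/
def RobinBC (σ κ : ℝ) (h dh : ℝ → ℝ) : Prop :=
  σ * dh 0 = κ * h 0 ∧ σ * dh 1 = -(κ * h 1)

/-- The solution of `u'' = k² u` with `u(0) = σ`, `u'(0) = κ`. -/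
noncomputable def hypSol (σ κ k x : ℝ) : ℝ :=
  σ * Real.cosh (k * x) + κ / k * Real.sinh (k * x)

/-- The derivative of `hypSol`. -/
noncomputable def hypSolDeriv (σ κ k x : ℝ) : ℝ :=
  σ * k * Real.sinh (k * x) + κ * Real.cosh (k * x)

/-- The Wronskian of `hypSol` and its reflection. -/
noncomputable def wronsk (σ κ k : ℝ) : ℝ :=
  κ * hypSol σ κ k 1 + σ * hypSolDeriv σ κ k 1

/-- The Green function. -/
noncomputable def greenKer (σ κ k x y : ℝ) : ℝ :=
  k ^ 2 / wronsk σ κ k * (hypSol σ κ k (min x y) * hypSol σ κ k (1 - max x y))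

/-- The integral operator with kernel `greenKer`. -/
noncomputable def resolv (σ κ k : ℝ) (f : ℝ → ℝ) (x : ℝ) : ℝ :=
  ∫ y in (0 : ℝ)..1, greenKer σ κ k x y * f y

section Green

variable {σ κ k : ℝ}

theorem hasDerivAt_hypSol (hk : k ≠ 0) (x : ℝ) :
    HasDerivAt (hypSol σ κ k) (hypSolDeriv σ κ k x) x := by
  have h1 : HasDerivAt (fun x : ℝ => k * x) k x := by
    simpa using (hasDerivAt_id x).const_mul k
  have := ((h1.cosh).const_mul σ).add ((h1.sinh).const_mul (κ / k))
  refine this.congr_deriv ?_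
  unfold hypSolDeriv
  field_simp

theorem hasDerivAt_hypSolDeriv (hk : k ≠ 0) (x : ℝ) :
    HasDerivAt (hypSolDeriv σ κ k) (k ^ 2 * hypSol σ κ k x) x := by
  have h1 : HasDerivAt (fun x : ℝ => k * x) k x := by
    simpa using (hasDerivAt_id x).const_mul k
  have := ((h1.sinh).const_mul (σ * k)).add ((h1.cosh).const_mul κ)
  refine this.congr_deriv ?_
  unfold hypSol
  field_simp

theorem continuous_hypSol : Continuous (hypSol σ κ k) := by
  unfold hypSol; fun_prop

theorem hypSol_nonneg (hσ : 0 ≤ σ) (hκ : 0 < κ) (hk : 0 < k) {x : ℝ} (hx : 0 ≤ x) :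
    0 ≤ hypSol σ κ k x := by
  unfold hypSol
  have h1 := (Real.cosh_pos (k * x)).le
  have h2 : 0 ≤ Real.sinh (k * x) := Real.sinh_nonneg_iff.2 (by positivity)
  positivity

theorem wronsk_pos (hσ : 0 ≤ σ) (hκ : 0 < κ) (hk : 0 < k) : 0 < wronsk σ κ k := by
  unfold wronsk hypSol hypSolDeriv
  have h1 := Real.cosh_pos (k * 1)
  have h2 : 0 < Real.sinh (k * 1) := Real.sinh_pos_iff.2 (by positivity)
  have : κ / k * Real.sinh (k * 1) > 0 := by positivity
  have h3 : 0 ≤ σ * Real.cosh (k * 1) := by positivity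
  have h4 : 0 ≤ σ * (σ * k * Real.sinh (k * 1) + κ * Real.cosh (k * 1)) := by positivity
  nlinarith

/-- `u(x)` and `u(1 - x)` solve the same equation `u'' = k² u`, so their Wronskian has derivative
zero; its value is read off at `x = 0`. -/
theorem wronsk_eq (hk : k ≠ 0) (x : ℝ) :
    hypSolDeriv σ κ k x * hypSol σ κ k (1 - x) + hypSol σ κ k x * hypSolDeriv σ κ k (1 - x)
      = wronsk σ κ k := by
  have hd : ∀ y, HasDerivAt (fun x => hypSolDeriv σ κ k x * hypSol σ κ k (1 - x)
      + hypSol σ κ k x * hypSolDeriv σ κ k (1 - x)) 0 y := by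
    intro y
    have h1 : HasDerivAt (fun x : ℝ => 1 - x) (-1) y := by
      simpa using (hasDerivAt_id y).const_sub 1
    have a := (hasDerivAt_hypSol (σ := σ) (κ := κ) hk (1 - y)).comp y h1
    have b := (hasDerivAt_hypSolDeriv (σ := σ) (κ := κ) hk (1 - y)).comp y h1
    have := ((hasDerivAt_hypSolDeriv (σ := σ) (κ := κ) hk y).mul a).add
      ((hasDerivAt_hypSol (σ := σ) (κ := κ) hk y).mul b)
    refine this.congr_deriv ?_
    simp only [Function.comp]
    ring
  have := is_const_of_deriv_eq_zero (fun y => (hd y).differentiableAt) (fun y => (hd y).deriv) x 0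
  rw [this]
  simp [wronsk, hypSol, hypSolDeriv]

theorem continuous_greenKer : Continuous fun p : ℝ × ℝ => greenKer σ κ k p.1 p.2 := by
  unfold greenKer
  have := continuous_hypSol (σ := σ) (κ := κ) (k := k)
  fun_prop

theorem greenKer_symm (x y : ℝ) : greenKer σ κ k x y = greenKer σ κ k y x := by
  unfold greenKer
  rw [min_comm, max_comm]

theorem greenKer_nonneg (hσ : 0 ≤ σ) (hκ : 0 < κ) (hk : 0 < k) {x y : ℝ}
    (hx : x ∈ Icc (0 : ℝ) 1) (hy : y ∈ Icc (0 : ℝ) 1) : 0 ≤ greenKer σ κ k x y := by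
  unfold greenKer
  have h1 := wronsk_pos hσ hκ hk
  have h2 : 0 ≤ hypSol σ κ k (min x y) := hypSol_nonneg hσ hκ hk (le_min hx.1 hy.1)
  have h3 : 0 ≤ hypSol σ κ k (1 - max x y) :=
    hypSol_nonneg hσ hκ hk (by have := max_le hx.2 hy.2; linarith)
  positivity

/-- On either side of the diagonal the kernel is a product of a function of `x` and one of `y`. This
exhibits `resolv` through primitives, which can be shown continuous and differentiated. -/
theorem resolv_eq_split {f : ℝ → ℝ} (hf : IntervalIntegrable f volume 0 1) {x : ℝ}
    (hx : x ∈ Icc (0 : ℝ) 1) :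
    resolv σ κ k f x = k ^ 2 / wronsk σ κ k *
      (hypSol σ κ k (1 - x) * (∫ y in (0 : ℝ)..x, hypSol σ κ k y * f y)
        + hypSol σ κ k x * (∫ y in x..1, hypSol σ κ k (1 - y) * f y)) := by
  have hint : IntervalIntegrable (fun y => greenKer σ κ k x y * f y) volume 0 1 :=
    hf.continuousOn_mul
      ((continuous_greenKer.comp (Continuous.prodMk_right x)).continuousOn)
  have hx0 : (0 : ℝ) ∈ uIcc (0 : ℝ) 1 := left_mem_uIcc
  have hx1 : (1 : ℝ) ∈ uIcc (0 : ℝ) 1 := right_mem_uIcc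
  have hxm : x ∈ uIcc (0 : ℝ) 1 := by rwa [uIcc_of_le zero_le_one]
  have e := intervalIntegral.integral_add_adjacent_intervals
    (hint.mono_set (uIcc_subset_uIcc hx0 hxm)) (hint.mono_set (uIcc_subset_uIcc hxm hx1))
  unfold resolv
  rw [← e, mul_add, ← intervalIntegral.integral_const_mul, ← intervalIntegral.integral_const_mul,
    ← intervalIntegral.integral_const_mul, ← intervalIntegral.integral_const_mul]
  congr 1
  · refine intervalIntegral.integral_congr fun y hy => ?_
    rw [uIcc_of_le hx.1] at hy
    simp only [greenKer, min_eq_right hy.2, max_eq_left hy.2]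
    ring
  · refine intervalIntegral.integral_congr fun y hy => ?_
    rw [uIcc_of_le hx.2] at hy
    simp only [greenKer, min_eq_left hy.1, max_eq_right hy.1]
    ring

/-- The operator `resolv` inverts `h ↦ h - k⁻² h''`, up to boundary terms. -/
theorem resolv_sub_deriv (hσ : 0 ≤ σ) (hκ : 0 < κ) (hk : 0 < k) {h dh ddh : ℝ → ℝ}
    (h1 : ∀ q, HasDerivAt h (dh q) q) (h2 : ∀ q, HasDerivAt dh (ddh q) q)
    (h3 : Continuous ddh) {x : ℝ} (hx : x ∈ Icc (0 : ℝ) 1) :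
    resolv σ κ k (fun q => h q - ddh q / k ^ 2) x = h x - 1 / wronsk σ κ k *
      (hypSol σ κ k (1 - x) * (κ * h 0 - σ * dh 0) + hypSol σ κ k x * (κ * h 1 + σ * dh 1)) := by
  have hk0 := hk.ne'
  have ch : Continuous h := continuous_iff_continuousAt.2 fun q => (h1 q).continuousAt
  have cf : Continuous (fun q => h q - ddh q / k ^ 2) := by fun_prop
  have cu := continuous_hypSol (σ := σ) (κ := κ) (k := k)
  rw [resolv_eq_split (cf.intervalIntegrable _ _) hx]
  -- Lagrange's identity: `(u' h - u h')' = k² u h - u h''`, so the integrand is an exact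
  -- derivative. The integral `B` is the same with `u(1 - y)`.
  have A : (∫ y in (0 : ℝ)..x, hypSol σ κ k y * (h y - ddh y / k ^ 2)) =
      1 / k ^ 2 * (hypSolDeriv σ κ k x * h x - hypSol σ κ k x * dh x)
        - 1 / k ^ 2 * (hypSolDeriv σ κ k 0 * h 0 - hypSol σ κ k 0 * dh 0) := by
    refine intervalIntegral.integral_eq_sub_of_hasDerivAt (f := fun y =>
      1 / k ^ 2 * (hypSolDeriv σ κ k y * h y - hypSol σ κ k y * dh y)) (fun y _ => ?_)
      ((cu.mul cf).intervalIntegrable _ _)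
    refine ((((hasDerivAt_hypSolDeriv (σ := σ) (κ := κ) hk0 y).mul (h1 y)).sub
      ((hasDerivAt_hypSol (σ := σ) (κ := κ) hk0 y).mul (h2 y))).const_mul (1 / k ^ 2)).congr_deriv ?_
    field_simp
    ring
  have B : (∫ y in x..1, hypSol σ κ k (1 - y) * (h y - ddh y / k ^ 2)) =
      1 / k ^ 2 * (-hypSolDeriv σ κ k (1 - 1) * h 1 - hypSol σ κ k (1 - 1) * dh 1)
      - 1 / k ^ 2 * (-hypSolDeriv σ κ k (1 - x) * h x - hypSol σ κ k (1 - x) * dh x) := by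
    refine intervalIntegral.integral_eq_sub_of_hasDerivAt (f := fun y =>
      1 / k ^ 2 * (-hypSolDeriv σ κ k (1 - y) * h y - hypSol σ κ k (1 - y) * dh y)) (fun y _ => ?_)
      (((cu.comp (continuous_const.sub continuous_id)).mul cf).intervalIntegrable _ _)
    have h1' : HasDerivAt (fun x : ℝ => 1 - x) (-1) y := by
      simpa using (hasDerivAt_id y).const_sub 1
    have a := (hasDerivAt_hypSol (σ := σ) (κ := κ) hk0 (1 - y)).comp y h1'
    have b := (hasDerivAt_hypSolDeriv (σ := σ) (κ := κ) hk0 (1 - y)).comp y h1'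
    refine (((b.neg.mul (h1 y)).sub (a.mul (h2 y))).const_mul (1 / k ^ 2)).congr_deriv ?_
    simp only [Function.comp, Pi.neg_apply]
    field_simp
    ring
  have W := wronsk_eq (σ := σ) (κ := κ) hk0 x
  have u0 : hypSol σ κ k 0 = σ := by simp [hypSol]
  have du0 : hypSolDeriv σ κ k 0 = κ := by simp [hypSolDeriv]
  have Wp := (wronsk_pos hσ hκ hk).ne'
  rw [A, B, sub_self, u0, du0]
  field_simp
  rw [← W]
  ring

theorem resolv_sub_deriv_of_bc (hσ : 0 ≤ σ) (hκ : 0 < κ) (hk : 0 < k) {h dh ddh : ℝ → ℝ}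
    (h1 : ∀ q, HasDerivAt h (dh q) q) (h2 : ∀ q, HasDerivAt dh (ddh q) q)
    (h3 : Continuous ddh) (bc : RobinBC σ κ h dh) {x : ℝ} (hx : x ∈ Icc (0 : ℝ) 1) :
    resolv σ κ k (fun q => h q - ddh q / k ^ 2) x = h x := by
  rw [resolv_sub_deriv hσ hκ hk h1 h2 h3 hx, bc.1, bc.2]
  ring

/-- Nonnegative affine supersolutions are decreased by `resolv`. -/
theorem resolv_affine_le (hσ : 0 ≤ σ) (hκ : 0 < κ) (hk : 0 < k) {p r : ℝ}
    (h0 : σ * p ≤ κ * r) (h1 : 0 ≤ κ * (p + r) + σ * p) {x : ℝ} (hx : x ∈ Icc (0 : ℝ) 1) :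
    resolv σ κ k (fun q => p * q + r) x ≤ p * x + r := by
  have hd : ∀ q, HasDerivAt (fun q : ℝ => p * q + r) p q := fun q => by
    simpa using ((hasDerivAt_id q).const_mul p).add_const r
  -- An affine function has no second derivative, so only the boundary terms change it; `h0` and
  -- `h1` give their sign.
  have := resolv_sub_deriv hσ hκ hk hd (fun q => hasDerivAt_const q p) continuous_const hx
  simp only [zero_div, sub_zero] at this
  rw [this]
  have W := wronsk_pos hσ hκ hk
  have a := hypSol_nonneg hσ hκ hk hx.1
  have b : 0 ≤ hypSol σ κ k (1 - x) := hypSol_nonneg hσ hκ hk (by linarith [hx.2])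
  have c : 0 ≤ κ * (p * 0 + r) - σ * p := by linarith
  have d : 0 ≤ κ * (p * 1 + r) + σ * p := by linarith
  have : 0 ≤ 1 / wronsk σ κ k * (hypSol σ κ k (1 - x) * (κ * (p * 0 + r) - σ * p)
    + hypSol σ κ k x * (κ * (p * 1 + r) + σ * p)) := by positivity
  linarith

theorem resolv_mono (hσ : 0 ≤ σ) (hκ : 0 < κ) (hk : 0 < k) {f g : ℝ → ℝ}
    (hf : IntervalIntegrable f volume 0 1) (hg : IntervalIntegrable g volume 0 1)
    (hfg : ∀ q ∈ Icc (0 : ℝ) 1, f q ≤ g q) {x : ℝ} (hx : x ∈ Icc (0 : ℝ) 1) :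
    resolv σ κ k f x ≤ resolv σ κ k g x := by
  have hc : ContinuousOn (fun y => greenKer σ κ k x y) (uIcc 0 1) :=
    (continuous_greenKer.comp (Continuous.prodMk_right x)).continuousOn
  refine intervalIntegral.integral_mono_on zero_le_one (hf.continuousOn_mul hc)
    (hg.continuousOn_mul hc) fun y hy => ?_
  exact mul_le_mul_of_nonneg_left (hfg y hy) (greenKer_nonneg hσ hκ hk hx hy)

theorem continuousOn_resolv {f : ℝ → ℝ} (hf : IntervalIntegrable f volume 0 1) :
    ContinuousOn (resolv σ κ k f) (Icc 0 1) := by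
  have cu := continuous_hypSol (σ := σ) (κ := κ) (k := k)
  have cv : Continuous (fun x => hypSol σ κ k (1 - x)) := by fun_prop
  have i1 : IntegrableOn (fun y => hypSol σ κ k y * f y) (uIcc 0 1) :=
    intervalIntegrable_iff_integrableOn_Icc_of_le zero_le_one |>.1 (hf.continuousOn_mul
      cu.continuousOn) |> fun h => by rwa [uIcc_of_le zero_le_one]
  have i2 : IntegrableOn (fun y => hypSol σ κ k (1 - y) * f y) (uIcc 0 1) :=
    intervalIntegrable_iff_integrableOn_Icc_of_le zero_le_one |>.1 (hf.continuousOn_mul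
      cv.continuousOn) |> fun h => by rwa [uIcc_of_le zero_le_one]
  have c1 := intervalIntegral.continuousOn_primitive_interval i1
  have c2 := intervalIntegral.continuousOn_primitive_interval_left i2
  rw [uIcc_of_le zero_le_one] at c1 c2
  refine ContinuousOn.congr ?_ fun x hx => resolv_eq_split hf hx
  exact continuousOn_const.mul ((cv.continuousOn.mul c1).add (cu.continuousOn.mul c2))

theorem resolv_congr_ae {f g : ℝ → ℝ} (h : f =ᵐ[volume.restrict (Icc (0 : ℝ) 1)] g) :
    resolv σ κ k f = resolv σ κ k g := by
  funext x
  unfold resolv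
  rw [intervalIntegral.integral_of_le zero_le_one, intervalIntegral.integral_of_le zero_le_one,
    ← integral_Icc_eq_integral_Ioc, ← integral_Icc_eq_integral_Ioc]
  refine integral_congr_ae ?_
  filter_upwards [h] with y hy
  rw [hy]

/-- Fubini and the symmetry of the kernel, whose boundedness on the square makes the double integral
absolutely convergent. -/
theorem integral_resolv_mul_comm {f g : ℝ → ℝ} (hf : IntervalIntegrable f volume 0 1)
    (hg : IntervalIntegrable g volume 0 1) :
    ∫ x in (0 : ℝ)..1, resolv σ κ k f x * g x = ∫ x in (0 : ℝ)..1, f x * resolv σ κ k g x := by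
  have hf' := (intervalIntegrable_iff_integrableOn_Ioc_of_le zero_le_one).1 hf
  have hg' := (intervalIntegrable_iff_integrableOn_Ioc_of_le zero_le_one).1 hg
  unfold resolv
  simp only [intervalIntegral.integral_of_le zero_le_one, ← integral_const_mul,
    ← integral_mul_const]
  rw [integral_integral_swap]
  · refine integral_congr_ae (Eventually.of_forall fun x => ?_)
    refine integral_congr_ae (Eventually.of_forall fun y => ?_)
    simp only
    rw [greenKer_symm]
    ring
  · have hfg := (hg'.mul_prod hf')
    obtain ⟨C, hC⟩ := ((isCompact_Icc (a := (0 : ℝ)) (b := 1)).prod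
      (isCompact_Icc (a := (0 : ℝ)) (b := 1))).exists_bound_of_continuousOn
      (continuous_greenKer (σ := σ) (κ := κ) (k := k)).continuousOn
    have := hfg.bdd_mul (c := C) (f := fun p : ℝ × ℝ => greenKer σ κ k p.1 p.2)
      continuous_greenKer.aestronglyMeasurable ?_
    · refine this.congr (Eventually.of_forall fun p => ?_)
      simp only [Function.uncurry]
      ring
    · rw [Measure.prod_restrict]
      filter_upwards [ae_restrict_mem (measurableSet_Ioc.prod measurableSet_Ioc)] with p hp
      exact hC p ⟨Ioc_subset_Icc_self hp.1, Ioc_subset_Icc_self hp.2⟩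

end Green


/-! ### Orthonormal systems of modes -/

/-- Lebesgue measure on `[0,1]`. -/
noncomputable abbrev unitMeas : Measure ℝ := volume.restrict (Icc (0 : ℝ) 1)

/-- `e n` are normalised eigenfunctions, with eigenvalues `lam n`, of `-d²/dq²` with the boundary
conditions `RobinBC σ κ`; every eigenfunction with a positive eigenvalue is among them. -/
structure ModeSystem (σ κ : ℝ) (lam : ℕ → ℝ) (e de : ℕ → ℝ → ℝ) : Prop where
  hσ : 0 ≤ σ
  hκ : 0 < κ
  deriv : ∀ n q, HasDerivAt (e n) (de n q) q
  deriv2 : ∀ n q, HasDerivAt (de n) (-(lam n) * e n q) q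
  bc : ∀ n, RobinBC σ κ (e n) (de n)
  norm : ∀ n, ∫ q in (0 : ℝ)..1, e n q ^ 2 = 1
  bound : ∃ M, 0 ≤ M ∧ ∀ n q, |e n q| ≤ M
  deriv_bound : ∃ M, 0 ≤ M ∧ ∀ n q, |de n q| ≤ M * (1 + lam n)
  lam_pos : ∀ n, 0 < lam n
  lam_lower : ∀ n : ℕ, (n : ℝ) ^ 2 ≤ lam n
  lam_inj : Function.Injective lam
  exhaust : ∀ s a b : ℝ, 0 < s → σ * (s * b) = κ * a →
    σ * (s * (b * Real.cos s - a * Real.sin s)) = -(κ * (a * Real.cos s + b * Real.sin s)) →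
    ∃ n c, ∀ q, a * Real.cos (s * q) + b * Real.sin (s * q) = c * e n q

theorem integral_unitMeas (f : ℝ → ℝ) :
    ∫ q, f q ∂unitMeas = ∫ q in (0 : ℝ)..1, f q := by
  rw [intervalIntegral.integral_of_le zero_le_one, integral_Icc_eq_integral_Ioc]

theorem integrable_unitMeas_iff {f : ℝ → ℝ} :
    Integrable f unitMeas ↔ IntervalIntegrable f volume 0 1 :=
  (intervalIntegrable_iff_integrableOn_Icc_of_le zero_le_one).symm

theorem _root_.ContinuousOn.memLp_unitMeas {f : ℝ → ℝ} (hf : ContinuousOn f (Icc 0 1)) :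
    MemLp f 2 unitMeas := by
  obtain ⟨C, hC⟩ := isCompact_Icc.exists_bound_of_continuousOn hf
  refine MemLp.of_bound (hf.aestronglyMeasurable measurableSet_Icc) C ?_
  filter_upwards [ae_restrict_mem measurableSet_Icc] with q hq using hC q hq

theorem _root_.MeasureTheory.MemLp.intervalIntegrable_unit {f : ℝ → ℝ} (hf : MemLp f 2 unitMeas) :
    IntervalIntegrable f volume 0 1 :=
  integrable_unitMeas_iff.1 (hf.integrable (by norm_num))

theorem norm_Lp_unitMeas_le {F : Lp ℝ 2 unitMeas} {C : ℝ} (hC : 0 ≤ C)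
    (h : ∀ᵐ q ∂unitMeas, ‖F q‖ ≤ C) : ‖F‖ ≤ C := by
  have h1 : measureUnivNNReal unitMeas = 1 := by simp [measureUnivNNReal, unitMeas]
  simpa [h1] using Lp.norm_le_of_ae_bound hC h

theorem inner_toLp_unitMeas {f g : ℝ → ℝ} (hf : MemLp f 2 unitMeas) (hg : MemLp g 2 unitMeas) :
    inner ℝ (hf.toLp f) (hg.toLp g) = ∫ q in (0 : ℝ)..1, f q * g q := by
  rw [L2.inner_def, ← integral_unitMeas]
  refine integral_congr_ae ?_
  filter_upwards [hf.coeFn_toLp, hg.coeFn_toLp] with q h1 h2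
  rw [h1, h2]
  simp [mul_comm]

/-! ### Eigenfunctions as solutions of a constant-coefficient ODE -/

section ODE

variable {σ κ C : ℝ} {y dy ddy : ℝ → ℝ}

/-- The boundary conditions are dissipative: these are the signs of the boundary terms when `y y''`
is integrated by parts. For `σ = 0` both products vanish; otherwise they are `± κ/σ` times a square.
-/
theorem RobinBC.sign (hσ : 0 ≤ σ) (hκ : 0 < κ) (bc : RobinBC σ κ y dy) :
    0 ≤ y 0 * dy 0 ∧ y 1 * dy 1 ≤ 0 := by
  obtain ⟨b0, b1⟩ := bc
  rcases hσ.eq_or_lt with h | h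
  · rw [← h, zero_mul, eq_comm, mul_eq_zero] at b0
    rw [← h, zero_mul, eq_comm, neg_eq_zero, mul_eq_zero] at b1
    rw [b0.resolve_left hκ.ne', b1.resolve_left hκ.ne', zero_mul, zero_mul]
    exact ⟨le_rfl, le_rfl⟩
  · constructor
    · have : 0 ≤ σ * (y 0 * dy 0) := by
        have : σ * (y 0 * dy 0) = κ * (y 0 * y 0) := by linear_combination y 0 * b0
        rw [this]; exact mul_nonneg hκ.le (mul_self_nonneg _)
      exact nonneg_of_mul_nonneg_right this h
    · have : 0 ≤ σ * -(y 1 * dy 1) := by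
        have : σ * -(y 1 * dy 1) = κ * (y 1 * y 1) := by linear_combination -y 1 * b1
        rw [this]; exact mul_nonneg hκ.le (mul_self_nonneg _)
      linarith [nonneg_of_mul_nonneg_right this h]

/-- Since `(y y')' = y'² + C y² ≥ 0`, the product `y y'` is monotone. It is nonnegative at 0 and
nonpositive at 1, hence zero, so `y²` is constant, and the boundary condition forces `y 0 = 0`. -/
theorem eq_zero_of_nonneg_eigen (hσ : 0 ≤ σ) (hκ : 0 < κ)
    (h1 : ∀ q, HasDerivAt y (dy q) q) (h2 : ∀ q, HasDerivAt dy (ddy q) q)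
    (bc : RobinBC σ κ y dy) (hC : 0 ≤ C) (h3 : ∀ q ∈ Icc (0 : ℝ) 1, ddy q = C * y q) :
    ∀ q ∈ Icc (0 : ℝ) 1, y q = 0 := by
  have hp : ∀ q, HasDerivAt (fun q => y q * dy q) (dy q * dy q + y q * ddy q) q := fun q =>
    (h1 q).mul (h2 q)
  have hmono : MonotoneOn (fun q => y q * dy q) (Icc 0 1) := by
    refine monotoneOn_of_deriv_nonneg (convex_Icc 0 1)
      (fun q _ => (hp q).continuousAt.continuousWithinAt)
      (fun q _ => (hp q).differentiableAt.differentiableWithinAt) fun q hq => ?_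
    rw [(hp q).deriv, h3 q (interior_subset hq)]
    nlinarith [mul_self_nonneg (dy q), mul_nonneg hC (mul_self_nonneg (y q))]
  obtain ⟨s0, s1⟩ := bc.sign hσ hκ
  have hz : ∀ q ∈ Icc (0 : ℝ) 1, y q * dy q = 0 := fun q hq =>
    le_antisymm ((hmono hq (right_mem_Icc.2 zero_le_one) hq.2).trans s1)
      (s0.trans (hmono (left_mem_Icc.2 zero_le_one) hq hq.1))
  have hy0 : y 0 = 0 := by
    have : κ * (y 0 * y 0) = 0 := by
      have := hz 0 (left_mem_Icc.2 zero_le_one)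
      linear_combination σ * this - y 0 * bc.1
    simpa [hκ.ne'] using this
  intro q hq
  have := constant_of_has_deriv_right_zero (f := fun q => y q * y q) (a := 0) (b := 1)
    (fun q _ => ((h1 q).mul (h1 q)).continuousAt.continuousWithinAt) (fun q hq => by
      have := ((h1 q).mul (h1 q)).hasDerivWithinAt (s := Ici q)
      have z := hz q (Ico_subset_Icc_self hq)
      rwa [mul_comm (dy q), z, add_zero] at this) q hq
  simpa [hy0] using this

/-- The difference `w` from the trigonometric solution with the same initial data has conserved
energy `s² w² + w'²`, which is zero at 0. -/
theorem eq_trig_of_neg_eigen {s : ℝ} (hs : 0 < s)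
    (h1 : ∀ q, HasDerivAt y (dy q) q) (h2 : ∀ q, HasDerivAt dy (ddy q) q)
    (h3 : ∀ q ∈ Icc (0 : ℝ) 1, ddy q = -s ^ 2 * y q) :
    ∀ q ∈ Icc (0 : ℝ) 1, y q = y 0 * Real.cos (s * q) + dy 0 / s * Real.sin (s * q) ∧
      dy q = s * (dy 0 / s * Real.cos (s * q) - y 0 * Real.sin (s * q)) := by
  have hl : ∀ q, HasDerivAt (fun x : ℝ => s * x) s q := fun q => by
    simpa using (hasDerivAt_id q).const_mul s
  set w : ℝ → ℝ := fun q => y q - (y 0 * Real.cos (s * q) + dy 0 / s * Real.sin (s * q)) with hw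
  set dw : ℝ → ℝ := fun q => dy q - s * (dy 0 / s * Real.cos (s * q) - y 0 * Real.sin (s * q))
    with hdw
  have d1 : ∀ q, HasDerivAt w (dw q) q := fun q => by
    refine ((h1 q).sub (((hl q).cos.const_mul (y 0)).add
      ((hl q).sin.const_mul (dy 0 / s)))).congr_deriv ?_
    simp only [hdw]; ring
  have d2 : ∀ q, HasDerivAt dw (ddy q - s * (s * (-(dy 0 / s) * Real.sin (s * q)
      - y 0 * Real.cos (s * q)))) q := fun q => by
    refine ((h2 q).sub ((((hl q).cos.const_mul (dy 0 / s)).sub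
      ((hl q).sin.const_mul (y 0))).const_mul s)).congr_deriv ?_
    ring
  have dE : ∀ q, HasDerivAt (fun q => s ^ 2 * (w q * w q) + dw q * dw q) _ q := fun q =>
    (((d1 q).mul (d1 q)).const_mul (s ^ 2)).add ((d2 q).mul (d2 q))
  intro q hq
  have := constant_of_has_deriv_right_zero (a := 0) (b := 1)
    (fun q _ => (dE q).continuousAt.continuousWithinAt) (fun q hq => by
      refine (dE q).hasDerivWithinAt.congr_deriv ?_
      rw [h3 q (Ico_subset_Icc_self hq)]
      simp only [hw]
      ring) q hq
  have hw0 : w 0 = 0 := by simp [hw]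
  have hdw0 : dw 0 = 0 := by simp only [hdw]; simp; field_simp; ring
  simp only [hw0, hdw0] at this
  have e1 : w q * w q = 0 := by
    have a := mul_nonneg (sq_nonneg s) (mul_self_nonneg (w q))
    have b := mul_self_nonneg (dw q)
    have : s ^ 2 * (w q * w q) = 0 := by linarith
    simpa [hs.ne'] using this
  have e2 : dw q * dw q = 0 := by simpa [e1] using this
  exact ⟨sub_eq_zero.1 (mul_self_eq_zero.1 e1), sub_eq_zero.1 (mul_self_eq_zero.1 e2)⟩

end ODE

/-! ### Modes as orthonormal eigenvectors of the Green operator -/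

namespace ModeSystem

variable {σ κ k : ℝ} {lam : ℕ → ℝ} {e de : ℕ → ℝ → ℝ}

theorem continuous (S : ModeSystem σ κ lam e de) (n : ℕ) : Continuous (e n) :=
  continuous_iff_continuousAt.2 fun q => (S.deriv n q).continuousAt

theorem continuous_deriv (S : ModeSystem σ κ lam e de) (n : ℕ) : Continuous (de n) :=
  continuous_iff_continuousAt.2 fun q => (S.deriv2 n q).continuousAt

theorem memLp (S : ModeSystem σ κ lam e de) (n : ℕ) : MemLp (e n) 2 unitMeas :=
  (S.continuous n).continuousOn.memLp_unitMeas

/-- A mode satisfies `e - k⁻² e'' = (1 + lam / k²) e` and the boundary conditions, and `resolv`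
inverts the left side. -/
theorem resolv_mode (S : ModeSystem σ κ lam e de) (hk : 0 < k) (n : ℕ) {x : ℝ}
    (hx : x ∈ Icc (0 : ℝ) 1) : resolv σ κ k (e n) x = (1 + lam n / k ^ 2)⁻¹ * e n x := by
  have := resolv_sub_deriv_of_bc S.hσ S.hκ hk (S.deriv n) (S.deriv2 n)
    ((continuous_const.mul (S.continuous n))) (S.bc n) hx
  rw [← this]
  unfold resolv
  rw [← intervalIntegral.integral_const_mul]
  refine intervalIntegral.integral_congr fun y _ => ?_
  have := S.lam_pos n
  have : 1 + lam n / k ^ 2 ≠ 0 := by positivity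
  simp only
  field_simp
  ring

theorem integral_resolv_mul (S : ModeSystem σ κ lam e de) (hk : 0 < k) {f : ℝ → ℝ}
    (hf : IntervalIntegrable f volume 0 1) (n : ℕ) :
    ∫ q in (0 : ℝ)..1, resolv σ κ k f q * e n q
      = (1 + lam n / k ^ 2)⁻¹ * ∫ q in (0 : ℝ)..1, f q * e n q := by
  rw [integral_resolv_mul_comm hf ((S.continuous n).intervalIntegrable _ _),
    ← intervalIntegral.integral_const_mul]
  refine intervalIntegral.integral_congr fun y hy => ?_
  rw [uIcc_of_le zero_le_one] at hy
  simp only [S.resolv_mode hk n hy]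
  ring

/-- Eigenvectors of a symmetric operator for distinct eigenvalues; distinctness comes from
`lam_inj`. -/
theorem orthogonal (S : ModeSystem σ κ lam e de) {n m : ℕ} (h : n ≠ m) :
    ∫ q in (0 : ℝ)..1, e n q * e m q = 0 := by
  have h1 := S.integral_resolv_mul one_pos ((S.continuous n).intervalIntegrable 0 1) m
  have h2 : ∫ q in (0 : ℝ)..1, resolv σ κ 1 (e n) q * e m q
      = (1 + lam n / 1 ^ 2)⁻¹ * ∫ q in (0 : ℝ)..1, e n q * e m q := by
    rw [← intervalIntegral.integral_const_mul]
    refine intervalIntegral.integral_congr fun y hy => ?_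
    rw [uIcc_of_le zero_le_one] at hy
    simp only [S.resolv_mode one_pos n hy]
    ring
  rw [h2, ← sub_eq_zero, ← sub_mul, mul_eq_zero] at h1
  refine h1.resolve_left fun h3 => h (S.lam_inj ?_)
  have := inv_injective (sub_eq_zero.1 h3)
  simpa using this

/-- The modes as vectors of `L²([0,1])`. -/
noncomputable def vec (S : ModeSystem σ κ lam e de) (n : ℕ) : Lp ℝ 2 unitMeas :=
  (S.memLp n).toLp (e n)

theorem orthonormal (S : ModeSystem σ κ lam e de) : Orthonormal ℝ S.vec := by
  rw [orthonormal_iff_ite]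
  intro n m
  unfold vec
  rw [inner_toLp_unitMeas]
  split_ifs with h
  · subst h
    simpa [sq] using S.norm n
  · exact S.orthogonal h

/-- Eigenfunctions of `resolv` are multiples of modes. -/
theorem eigen_resolv (S : ModeSystem σ κ lam e de) (hk : 0 < k) {f : ℝ → ℝ}
    (hf : IntervalIntegrable f volume 0 1) {m : ℝ} (hm : m ≠ 0)
    (h : ∀ᵐ q ∂unitMeas, resolv σ κ k f q = m * f q) :
    ∃ n c, f =ᵐ[unitMeas] fun q => c * e n q := by
  have hk0 := hk.ne'
  -- `f` is known only almost everywhere. It is replaced by its continuous version, extended by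
  -- constants beyond `[0,1]` so that the primitives below are differentiable at every real point.
  set h1 : ℝ → ℝ := IccExtend (zero_le_one' ℝ) fun x => m⁻¹ * resolv σ κ k f x with hh1
  have h1c : Continuous h1 := by
    refine Continuous.Icc_extend' ?_
    exact continuous_const.mul ((continuousOn_resolv hf).domRestrict)
  have h1e : ∀ x ∈ Icc (0 : ℝ) 1, h1 x = m⁻¹ * resolv σ κ k f x := fun x hx => by
    rw [hh1, IccExtend_of_mem _ _ hx]
  have hfh : f =ᵐ[unitMeas] h1 := by
    filter_upwards [h, ae_restrict_mem measurableSet_Icc] with x h2 hx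
    rw [h1e x hx, h2]
    field_simp
  have hres : resolv σ κ k f = resolv σ κ k h1 := resolv_congr_ae hfh
  set u := hypSol σ κ k
  set du := hypSolDeriv σ κ k
  have hu : ∀ x, HasDerivAt u (du x) x := hasDerivAt_hypSol hk0
  have hdu : ∀ x, HasDerivAt du (k ^ 2 * u x) x := hasDerivAt_hypSolDeriv hk0
  have cu : Continuous u := continuous_hypSol
  have hr : ∀ x, HasDerivAt (fun x : ℝ => 1 - x) (-1) x := fun x => by
    simpa using (hasDerivAt_id x).const_sub 1
  have hv : ∀ x, HasDerivAt (fun x => u (1 - x)) (-du (1 - x)) x := fun x =>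
    ((hu (1 - x)).comp x (hr x)).congr_deriv (by ring)
  have hdv : ∀ x, HasDerivAt (fun x => -du (1 - x)) (k ^ 2 * u (1 - x)) x := fun x =>
    ((hdu (1 - x)).comp x (hr x)).neg.congr_deriv (by ring)
  set I : ℝ → ℝ := fun x => ∫ y in (0 : ℝ)..x, u y * h1 y
  set J : ℝ → ℝ := fun x => ∫ y in x..1, u (1 - y) * h1 y
  have c1 : Continuous (fun y => u y * h1 y) := cu.mul h1c
  have c2 : Continuous (fun y => u (1 - y) * h1 y) :=
    (cu.comp (continuous_const.sub continuous_id)).mul h1c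
  have hI : ∀ x, HasDerivAt I (u x * h1 x) x := fun x =>
    intervalIntegral.integral_hasDerivAt_right (c1.intervalIntegrable _ _)
      (c1.stronglyMeasurableAtFilter _ _) c1.continuousAt
  have hJ : ∀ x, HasDerivAt J (-(u (1 - x) * h1 x)) x := fun x =>
    intervalIntegral.integral_hasDerivAt_left (c2.intervalIntegrable _ _)
      (c2.stronglyMeasurableAtFilter _ _) c2.continuousAt
  set W := wronsk σ κ k
  have hW : W ≠ 0 := (wronsk_pos S.hσ S.hκ hk).ne'
  -- A twice differentiable function on the whole line that agrees with `h1` on `[0,1]`; the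
  -- homogeneous ODE therefore holds only there.
  set y : ℝ → ℝ := fun x => m⁻¹ * (k ^ 2 / W) * (u (1 - x) * I x + u x * J x) with hy
  set dy : ℝ → ℝ := fun x => m⁻¹ * (k ^ 2 / W) * (-du (1 - x) * I x + du x * J x) with hdy
  have hyh : ∀ x ∈ Icc (0 : ℝ) 1, y x = h1 x := fun x hx => by
    rw [h1e x hx, hres, resolv_eq_split (h1c.intervalIntegrable _ _) hx, hy]
    ring
  have d1 : ∀ x, HasDerivAt y (dy x) x := fun x => by
    refine ((((hv x).mul (hI x)).add ((hu x).mul (hJ x))).const_mul _).congr_deriv ?_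
    simp only [hdy]
    ring
  have d2 : ∀ x, HasDerivAt dy (k ^ 2 * y x - k ^ 2 / m * h1 x) x := fun x => by
    refine ((((hdv x).mul (hI x)).add ((hdu x).mul (hJ x))).const_mul _).congr_deriv ?_
    have : W = du x * u (1 - x) + u x * du (1 - x) := (wronsk_eq hk0 x).symm
    have h5 : k ^ 2 / m * h1 x
        = m⁻¹ * (k ^ 2 / W) * ((du x * u (1 - x) + u x * du (1 - x)) * h1 x) := by
      rw [← this]; field_simp
    rw [h5]
    simp only [hy]
    ring
  have u0 : u 0 = σ := by simp [u, hypSol]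
  have du0 : du 0 = κ := by simp [du, hypSolDeriv]
  have bc : RobinBC σ κ y dy := by
    constructor
    · simp only [hy, hdy, I, intervalIntegral.integral_same, u0, du0]
      ring
    · simp only [hy, hdy, J, intervalIntegral.integral_same, sub_self, u0, du0]
      ring
  have ode : ∀ x ∈ Icc (0 : ℝ) 1, k ^ 2 * y x - k ^ 2 / m * h1 x = (k ^ 2 - k ^ 2 / m) * y x :=
    fun x hx => by rw [← hyh x hx]; ring
  have hfy : ∀ g : ℝ → ℝ, (∀ x ∈ Icc (0 : ℝ) 1, y x = g x) → f =ᵐ[unitMeas] g := fun g hg => by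
    filter_upwards [hfh, ae_restrict_mem measurableSet_Icc] with x h2 hx
    rw [h2, ← hyh x hx, hg x hx]
  -- The first case is `m < 0` or `1 ≤ m`: only the zero function remains. In the second, `0 < m <
  -- 1` and the solution oscillates with frequency `s`.
  rcases le_or_gt 0 (k ^ 2 - k ^ 2 / m) with hC | hC
  · refine ⟨0, 0, hfy _ fun x hx => ?_⟩
    rw [zero_mul]
    exact eq_zero_of_nonneg_eigen S.hσ S.hκ d1 d2 bc hC ode x hx
  · set s := √(k ^ 2 / m - k ^ 2)
    have hs : 0 < s := Real.sqrt_pos.2 (by linarith)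
    have hs2 : s ^ 2 = k ^ 2 / m - k ^ 2 := Real.sq_sqrt (by linarith)
    have tr := eq_trig_of_neg_eigen hs d1 d2 fun x hx => by rw [ode x hx, hs2]; ring
    have t1 := tr 1 (right_mem_Icc.2 zero_le_one)
    simp only [mul_one] at t1
    obtain ⟨n, c, hc⟩ := S.exhaust s (y 0) (dy 0 / s) hs
      (by rw [mul_div_cancel₀ _ hs.ne']; exact bc.1) (by rw [← t1.1, ← t1.2]; exact bc.2)
    exact ⟨n, c, hfy _ fun x hx => by rw [(tr x hx).1, hc]⟩

end ModeSystem


/-! ### `resolv` as a compact self-adjoint operator, and completeness of the modes -/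

section Compact

variable {σ κ k : ℝ}

theorem memLp_greenKer (σ κ k x : ℝ) : MemLp (greenKer σ κ k x) 2 unitMeas :=
  ContinuousOn.memLp_unitMeas
    (continuous_greenKer.comp (Continuous.prodMk_right x)).continuousOn

theorem memLp_resolv (F : Lp ℝ 2 unitMeas) : MemLp (resolv σ κ k F) 2 unitMeas :=
  (continuousOn_resolv (Lp.memLp F).intervalIntegrable_unit).memLp_unitMeas

/-- Lets Cauchy-Schwarz turn L² bounds on slices of the kernel into pointwise bounds and moduli of
continuity for `resolv F`. -/
theorem resolv_eq_inner (F : Lp ℝ 2 unitMeas) (x : ℝ) :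
    resolv σ κ k F x = inner ℝ ((memLp_greenKer σ κ k x).toLp _) F := by
  conv_rhs => rw [← Lp.toLp_coeFn F (Lp.memLp F)]
  rw [inner_toLp_unitMeas]
  rfl

theorem exists_greenKer_bound (σ κ k : ℝ) : ∃ C, 0 ≤ C ∧ ∀ x ∈ Icc (0 : ℝ) 1,
    ‖(memLp_greenKer σ κ k x).toLp _‖ ≤ C := by
  obtain ⟨C, hC⟩ := ((isCompact_Icc (a := (0 : ℝ)) (b := 1)).prod
    (isCompact_Icc (a := (0 : ℝ)) (b := 1))).exists_bound_of_continuousOn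
    (continuous_greenKer (σ := σ) (κ := κ) (k := k)).continuousOn
  have h0 : (0 : ℝ) ∈ Icc (0 : ℝ) 1 := left_mem_Icc.2 zero_le_one
  refine ⟨C, (norm_nonneg _).trans (hC (0, 0) ⟨h0, h0⟩), fun x hx => ?_⟩
  refine norm_Lp_unitMeas_le ((norm_nonneg _).trans (hC (0, 0) ⟨h0, h0⟩)) ?_
  filter_upwards [(memLp_greenKer σ κ k x).coeFn_toLp, ae_restrict_mem measurableSet_Icc]
    with y hy hy1
  rw [hy]
  exact hC (x, y) ⟨hx, hy1⟩

theorem greenKer_uniform (σ κ k : ℝ) {ε : ℝ} (hε : 0 < ε) : ∃ δ > 0, ∀ x ∈ Icc (0 : ℝ) 1,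
    ∀ x' ∈ Icc (0 : ℝ) 1, dist x x' < δ →
    ‖(memLp_greenKer σ κ k x).toLp _ - (memLp_greenKer σ κ k x').toLp _‖ ≤ ε := by
  have hu := ((isCompact_Icc (a := (0 : ℝ)) (b := 1)).prod
    (isCompact_Icc (a := (0 : ℝ)) (b := 1))).uniformContinuousOn_of_continuous
    (continuous_greenKer (σ := σ) (κ := κ) (k := k)).continuousOn
  obtain ⟨δ, hδ, h⟩ := Metric.uniformContinuousOn_iff.1 hu ε hε
  refine ⟨δ, hδ, fun x hx x' hx' hd => ?_⟩
  rw [← MemLp.toLp_sub]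
  refine norm_Lp_unitMeas_le hε.le ?_
  filter_upwards [((memLp_greenKer σ κ k x).sub (memLp_greenKer σ κ k x')).coeFn_toLp,
    ae_restrict_mem measurableSet_Icc] with y hy hy1
  rw [hy, Pi.sub_apply, ← dist_eq_norm]
  exact (h (x, y) ⟨hx, hy1⟩ (x', y) ⟨hx', hy1⟩ (by simpa [Prod.dist_eq] using hd)).le

/-- `resolv` as a bounded operator on `L²([0,1])`. -/
noncomputable def resolvL (σ κ k : ℝ) : Lp ℝ 2 unitMeas →L[ℝ] Lp ℝ 2 unitMeas :=
  LinearMap.mkContinuousOfExistsBound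
    { toFun := fun F => (memLp_resolv (σ := σ) (κ := κ) (k := k) F).toLp _
      map_add' := fun F G => by
        rw [← MemLp.toLp_add]
        refine MemLp.toLp_congr _ _ (Eventually.of_forall fun x => ?_)
        rw [Pi.add_apply, resolv_eq_inner, resolv_eq_inner, resolv_eq_inner, inner_add_right]
      map_smul' := fun c F => by
        rw [RingHom.id_apply, ← MemLp.toLp_const_smul]
        refine MemLp.toLp_congr _ _ (Eventually.of_forall fun x => ?_)
        rw [Pi.smul_apply, resolv_eq_inner, resolv_eq_inner, inner_smul_right, smul_eq_mul] }
    (by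
      obtain ⟨C, hC0, hC⟩ := exists_greenKer_bound σ κ k
      refine ⟨C, fun F => norm_Lp_unitMeas_le (by positivity) ?_⟩
      filter_upwards [(memLp_resolv (σ := σ) (κ := κ) (k := k) F).coeFn_toLp,
        ae_restrict_mem measurableSet_Icc] with x hx hx1
      refine le_of_eq_of_le (congrArg _ hx) ?_
      rw [resolv_eq_inner]
      exact (norm_inner_le_norm _ _).trans (by gcongr; exact hC x hx1))

theorem resolvL_apply (F : Lp ℝ 2 unitMeas) :
    resolvL σ κ k F = (memLp_resolv (σ := σ) (κ := κ) (k := k) F).toLp _ := rfl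

theorem resolvL_symm : (resolvL σ κ k : Lp ℝ 2 unitMeas →ₗ[ℝ] Lp ℝ 2 unitMeas).IsSymmetric := by
  intro F G
  change inner ℝ (resolvL σ κ k F) G = inner ℝ F (resolvL σ κ k G)
  rw [resolvL_apply, resolvL_apply]
  conv_lhs => rw [← Lp.toLp_coeFn G (Lp.memLp G)]
  conv_rhs => rw [← Lp.toLp_coeFn F (Lp.memLp F)]
  rw [inner_toLp_unitMeas, inner_toLp_unitMeas]
  exact integral_resolv_mul_comm (Lp.memLp F).intervalIntegrable_unit
    (Lp.memLp G).intervalIntegrable_unit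

/-- The image of the unit ball is bounded and equicontinuous, hence relatively compact for the
uniform norm by Arzelà-Ascoli, and the inclusion of continuous functions into L² is continuous. -/
theorem resolvL_compact : IsCompactOperator (resolvL σ κ k) := by
  obtain ⟨C, hC0, hC⟩ := exists_greenKer_bound σ κ k
  have hres : ∀ F : Lp ℝ 2 unitMeas, Continuous fun x : Icc (0 : ℝ) 1 => resolv σ κ k F x :=
    fun F => (continuousOn_resolv (Lp.memLp F).intervalIntegrable_unit).domRestrict
  set ψ : Lp ℝ 2 unitMeas → BoundedContinuousFunction (Icc (0 : ℝ) 1) ℝ := fun F =>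
    BoundedContinuousFunction.mkOfCompact ⟨_, hres F⟩ with hψ
  set A := ψ '' Metric.closedBall 0 1
  have hAc : IsCompact (closure A) := by
    refine BoundedContinuousFunction.arzela_ascoli (Metric.closedBall (0 : ℝ) C)
      (isCompact_closedBall _ _) A ?_ ?_
    · rintro _ x ⟨F, hF, rfl⟩
      rw [mem_closedBall_zero_iff] at hF ⊢
      change ‖resolv σ κ k F x‖ ≤ C
      rw [resolv_eq_inner]
      refine (norm_inner_le_norm _ _).trans ?_
      calc _ ≤ C * 1 := by gcongr; exact hC x x.2
        _ = C := mul_one C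
    · refine UniformEquicontinuous.equicontinuous (Metric.uniformEquicontinuous_iff.2 ?_)
      intro ε hε
      obtain ⟨δ, hδ, h⟩ := greenKer_uniform σ κ k (half_pos hε)
      refine ⟨δ, hδ, ?_⟩
      rintro x x' hd ⟨_, F, hF, rfl⟩
      rw [mem_closedBall_zero_iff] at hF
      change dist (resolv σ κ k F x) (resolv σ κ k F x') < ε
      rw [resolv_eq_inner, resolv_eq_inner, dist_eq_norm, ← inner_sub_left]
      refine (norm_inner_le_norm _ _).trans_lt ?_
      calc _ ≤ ε / 2 * 1 := by gcongr; exact h x x.2 x' x'.2 hd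
        _ < ε := by linarith
  -- The L² space lives over the real line, so functions on the subtype `[0,1]` are pulled back
  -- along the clamping map.
  set p : C(ℝ, Icc (0 : ℝ) 1) := ⟨projIcc 0 1 zero_le_one, continuous_projIcc⟩
  set Φ : BoundedContinuousFunction (Icc (0 : ℝ) 1) ℝ → Lp ℝ 2 unitMeas := fun g =>
    BoundedContinuousFunction.toLp 2 unitMeas ℝ (g.compContinuous p)
  have hΦ : Continuous Φ := (BoundedContinuousFunction.toLp 2 unitMeas ℝ).continuous.comp
    (BoundedContinuousFunction.continuous_compContinuous p)
  refine (isCompactOperator_iff_image_closedBall_subset_compact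
    (resolvL σ κ k : Lp ℝ 2 unitMeas →ₗ[ℝ] Lp ℝ 2 unitMeas) one_pos).2
    ⟨Φ '' closure A, hAc.image hΦ, ?_⟩
  rintro _ ⟨F, hF, rfl⟩
  refine ⟨ψ F, subset_closure ⟨F, hF, rfl⟩, ?_⟩
  change Φ (ψ F) = resolvL σ κ k F
  rw [resolvL_apply]
  refine Lp.ext ?_
  filter_upwards [(memLp_resolv (σ := σ) (κ := κ) (k := k) F).coeFn_toLp,
    BoundedContinuousFunction.coeFn_toLp 2 unitMeas ℝ ((ψ F).compContinuous p),
    ae_restrict_mem measurableSet_Icc] with x h1 h2 hx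
  rw [h1, h2]
  change resolv σ κ k F (projIcc 0 1 zero_le_one x) = _
  rw [projIcc_of_mem _ hx]

/-- Every test function `g` supported in `(0,1)` satisfies the boundary conditions, so `g = resolv
ψ` on `[0,1]` with `ψ = g - g''/k²`. By symmetry `∫ f g = ∫ (resolv f) ψ = 0`, and the fundamental
lemma of the calculus of variations applies. -/
theorem resolv_injective (hσ : 0 ≤ σ) (hκ : 0 < κ) (hk : 0 < k) {f : ℝ → ℝ}
    (hf : IntervalIntegrable f volume 0 1) (h : ∀ᵐ q ∂unitMeas, resolv σ κ k f q = 0) :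
    ∀ᵐ q ∂unitMeas, f q = 0 := by
  have hfi : IntegrableOn f (Ioo 0 1) :=
    ((intervalIntegrable_iff_integrableOn_Icc_of_le zero_le_one).1 hf).mono_set Ioo_subset_Icc_self
  have key := isOpen_Ioo.ae_eq_zero_of_integral_contDiff_smul_eq_zero (μ := volume)
    hfi.locallyIntegrableOn fun g hg hgc hgs => ?_
  · rw [unitMeas, ← restrict_Ioo_eq_restrict_Icc, ae_restrict_iff' measurableSet_Ioo]
    exact key
  · have hz : ∀ x, x ∉ Ioo (0 : ℝ) 1 → g x = 0 ∧ deriv g x = 0 := fun x hx => by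
      have hx' : x ∉ tsupport g := fun h => hx (hgs h)
      exact ⟨image_eq_zero_of_notMem_tsupport hx',
        image_eq_zero_of_notMem_tsupport fun h => hx' (tsupport_deriv_subset h)⟩
    have h0 := hz 0 (by simp)
    have h1 := hz 1 (by simp)
    have dg : ContDiff ℝ ∞ (deriv g) := ((contDiff_infty_iff_deriv (𝕜 := ℝ)).1 hg).2
    have ddg : ContDiff ℝ ∞ (deriv (deriv g)) := ((contDiff_infty_iff_deriv (𝕜 := ℝ)).1 dg).2
    have hne : (∞ : WithTop ℕ∞) ≠ 0 := by simp
    set ψ : ℝ → ℝ := fun q => g q - deriv (deriv g) q / k ^ 2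
    have hψ : IntervalIntegrable ψ volume 0 1 := by
      have := hg.continuous
      have := ddg.continuous
      exact Continuous.intervalIntegrable (by fun_prop) _ _
    have e : ∫ x, g x • f x = ∫ x in (0 : ℝ)..1, f x * resolv σ κ k ψ x := by
      rw [intervalIntegral.integral_of_le zero_le_one, ← setIntegral_eq_integral_of_forall_compl_eq_zero
        (s := Ioc (0 : ℝ) 1) fun x hx => ?_]
      · refine setIntegral_congr_fun measurableSet_Ioc fun x hx => ?_
        simp only [smul_eq_mul, ψ]
        rw [resolv_sub_deriv_of_bc hσ hκ hk (fun q => (hg.differentiable hne q).hasDerivAt)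
          (fun q => (dg.differentiable hne q).hasDerivAt) ddg.continuous
          ⟨by rw [h0.1, h0.2, mul_zero, mul_zero], by rw [h1.1, h1.2, mul_zero, mul_zero, neg_zero]⟩
          (Ioc_subset_Icc_self hx), mul_comm]
      · rw [(hz x fun h => hx (Ioo_subset_Ioc_self h)).1, zero_smul]
    rw [e, ← integral_resolv_mul_comm hf hψ, ← integral_unitMeas]
    refine integral_eq_zero_of_ae ?_
    filter_upwards [h] with x hx
    rw [hx, zero_mul, Pi.zero_apply]

end Compact

namespace ModeSystem

variable {σ κ : ℝ} {lam : ℕ → ℝ} {e de : ℕ → ℝ → ℝ}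

/-- The eigenspaces of a compact self-adjoint operator have trivial common orthogonal complement.
The eigenvalue 0 has trivial eigenspace by injectivity, and every other eigenvector is a multiple of
a mode. -/
theorem span_orthogonal_eq_bot (S : ModeSystem σ κ lam e de) :
    (Submodule.span ℝ (range S.vec))ᗮ = ⊥ := by
  rw [eq_bot_iff, ← ContinuousLinearMap.orthogonalComplement_iSup_eigenspaces_eq_bot
    (resolvL_compact (σ := σ) (κ := κ) (k := 1)) resolvL_symm, ← Submodule.iInf_orthogonal]
  intro v hv
  rw [Submodule.mem_iInf]
  intro m
  rw [Submodule.mem_orthogonal]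
  intro F hF
  rw [Module.End.mem_eigenspace_iff] at hF
  replace hF : resolvL σ κ 1 F = m • F := hF
  have hF' : ∀ᵐ q ∂unitMeas, resolv σ κ 1 F q = m * F q := by
    rw [resolvL_apply] at hF
    filter_upwards [(memLp_resolv (σ := σ) (κ := κ) (k := 1) F).coeFn_toLp,
      Lp.coeFn_smul m F] with q h1 h2
    rw [← h1, hF, h2, Pi.smul_apply, smul_eq_mul]
  have hFi := (Lp.memLp F).intervalIntegrable_unit
  rcases eq_or_ne m 0 with rfl | hm
  · have : F = 0 := by
      refine Lp.ext ?_
      filter_upwards [resolv_injective S.hσ S.hκ one_pos hFi (by simpa using hF'),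
        Lp.coeFn_zero ℝ 2 unitMeas] with q h1 h2
      rw [h1, h2, Pi.zero_apply]
    rw [this, inner_zero_left]
  · obtain ⟨n, c, hc⟩ := S.eigen_resolv one_pos hFi hm hF'
    have : F = c • S.vec n := by
      refine Lp.ext ?_
      filter_upwards [hc, Lp.coeFn_smul c (S.vec n), (S.memLp n).coeFn_toLp] with q h1 h2 h3
      rw [h1, h2, Pi.smul_apply, vec, h3, smul_eq_mul]
    rw [this, inner_smul_left, (Submodule.mem_orthogonal _ v).1 hv _
      (Submodule.subset_span ⟨n, rfl⟩), mul_zero]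

/-- The modes as a Hilbert basis of `L²([0,1])`. -/
noncomputable def basis (S : ModeSystem σ κ lam e de) : HilbertBasis ℕ ℝ (Lp ℝ 2 unitMeas) :=
  HilbertBasis.mkOfOrthogonalEqBot S.orthonormal S.span_orthogonal_eq_bot

theorem basis_apply (S : ModeSystem σ κ lam e de) (n : ℕ) : S.basis n = S.vec n := by
  rw [basis, HilbertBasis.coe_mkOfOrthogonalEqBot]

/-- The form in which completeness enters the uniqueness proofs. -/
theorem ae_eq_of_coeff_eq (S : ModeSystem σ κ lam e de) {f g : ℝ → ℝ} (hf : MemLp f 2 unitMeas)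
    (hg : MemLp g 2 unitMeas)
    (h : ∀ n, ∫ q in (0 : ℝ)..1, f q * e n q = ∫ q in (0 : ℝ)..1, g q * e n q) :
    f =ᵐ[unitMeas] g := by
  refine (MemLp.toLp_eq_toLp_iff hf hg).1 (S.basis.repr.injective (lp.ext (funext fun n => ?_)))
  rw [S.basis.repr_apply_apply, S.basis.repr_apply_apply, S.basis_apply, vec,
    inner_toLp_unitMeas, inner_toLp_unitMeas]
  simpa only [mul_comm] using h n

theorem hasSum_coeff_mul_coeff (S : ModeSystem σ κ lam e de) {f g : ℝ → ℝ}
    (hf : MemLp f 2 unitMeas) (hg : MemLp g 2 unitMeas) :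
    HasSum (fun n => (∫ q in (0 : ℝ)..1, f q * e n q) * ∫ q in (0 : ℝ)..1, e n q * g q)
      (∫ q in (0 : ℝ)..1, f q * g q) := by
  have := S.basis.hasSum_inner_mul_inner (hf.toLp f) (hg.toLp g)
  simpa only [S.basis_apply, vec, inner_toLp_unitMeas] using this

theorem summable_coeff_sq (S : ModeSystem σ κ lam e de) {f : ℝ → ℝ} (hf : MemLp f 2 unitMeas) :
    Summable fun n => (∫ q in (0 : ℝ)..1, f q * e n q) ^ 2 := by
  refine (S.hasSum_coeff_mul_coeff hf hf).summable.congr fun n => ?_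
  rw [sq]
  simp only [mul_comm]

theorem tendsto_partialSum (S : ModeSystem σ κ lam e de) {f : ℝ → ℝ} (hf : MemLp f 2 unitMeas) :
    Tendsto (fun N : ℕ => ∫ q in (0 : ℝ)..1,
      (f q - ∑ n ∈ Finset.range N, (∫ q in (0 : ℝ)..1, f q * e n q) * e n q) ^ 2)
      atTop (𝓝 0) := by
  set c : ℕ → ℝ := fun n => ∫ q in (0 : ℝ)..1, f q * e n q
  have h1 := (S.basis.hasSum_repr (hf.toLp f)).tendsto_sum_nat
  have h2 : Tendsto (fun N : ℕ => ‖hf.toLp f - ∑ n ∈ Finset.range N, c n • S.vec n‖ ^ 2)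
      atTop (𝓝 0) := by
    have h3 := ((tendsto_const_nhds (x := hf.toLp f)).sub h1).norm.pow 2
    rw [sub_self, norm_zero, zero_pow two_ne_zero] at h3
    refine h3.congr fun N => ?_
    congr 3
    refine Finset.sum_congr rfl fun n _ => ?_
    rw [S.basis.repr_apply_apply, S.basis_apply, vec, inner_toLp_unitMeas]
    simp only [c, mul_comm]
  refine h2.congr fun N => ?_
  have hs : MemLp (fun q => ∑ n ∈ Finset.range N, c n * e n q) 2 unitMeas :=
    memLp_finsetSum _ fun n _ => (S.memLp n).const_mul (c n)
  have : hf.toLp f - ∑ n ∈ Finset.range N, c n • S.vec n = (hf.sub hs).toLp _ := by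
    rw [MemLp.toLp_sub hf hs]
    congr 1
    refine Lp.ext ?_
    filter_upwards [hs.coeFn_toLp, Lp.coeFn_finsetSum (Finset.range N) (fun n => c n • S.vec n),
      ae_all_iff.2 fun n => Lp.coeFn_smul (c n) (S.vec n),
      ae_all_iff.2 fun n => (S.memLp n).coeFn_toLp] with q h1 h2 h3 h4
    rw [h1, h2, Finset.sum_apply]
    refine Finset.sum_congr rfl fun n _ => ?_
    rw [h3, Pi.smul_apply, vec, h4, smul_eq_mul]
  rw [this, ← real_inner_self_eq_norm_sq, inner_toLp_unitMeas]
  simp only [Pi.sub_apply, sq, c]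

end ModeSystem


/-! ### Series of modes -/

/-- The series with coefficients `a` in the functions `e`. -/
noncomputable def modeSeries (e : ℕ → ℝ → ℝ) (a : ℕ → ℝ) (q : ℝ) : ℝ := ∑' n, a n * e n q

/-- The coefficients at time `t` of a solution of the heat equation. -/
noncomputable def decay (lam c : ℕ → ℝ) (t : ℝ) (n : ℕ) : ℝ := c n * Real.exp (-(lam n / 2) * t)

namespace ModeSystem

variable {σ κ : ℝ} {lam : ℕ → ℝ} {e de : ℕ → ℝ → ℝ} {a : ℕ → ℝ}

theorem summable_modeSeries (S : ModeSystem σ κ lam e de) (ha : Summable fun n => |a n|) (q : ℝ) :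
    Summable fun n => a n * e n q := by
  obtain ⟨M, hM0, hM⟩ := S.bound
  refine Summable.of_norm_bounded (ha.mul_right M) fun n => ?_
  rw [norm_mul]
  exact mul_le_mul_of_nonneg_left (hM n q) (abs_nonneg _)

theorem continuous_modeSeries (S : ModeSystem σ κ lam e de) (ha : Summable fun n => |a n|) :
    Continuous (modeSeries e a) := by
  obtain ⟨M, hM0, hM⟩ := S.bound
  refine continuous_tsum (fun n => continuous_const.mul (S.continuous n)) (ha.mul_right M)
    fun n q => ?_
  rw [norm_mul]
  exact mul_le_mul_of_nonneg_left (hM n q) (abs_nonneg _)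

theorem hasSum_integral_modeSeries (S : ModeSystem σ κ lam e de) (ha : Summable fun n => |a n|)
    {φ : ℝ → ℝ} (hφ : IntervalIntegrable φ volume 0 1) :
    HasSum (fun n => a n * ∫ q in (0 : ℝ)..1, e n q * φ q)
      (∫ q in (0 : ℝ)..1, modeSeries e a q * φ q) := by
  obtain ⟨M, hM0, hM⟩ := S.bound
  have hφ' : Integrable φ unitMeas := integrable_unitMeas_iff.2 hφ
  have hint : ∀ n, Integrable (fun q => a n * e n q * φ q) unitMeas := fun n =>
    integrable_unitMeas_iff.2 (hφ.continuousOn_mul (continuous_const.mul (S.continuous n)).continuousOn)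
  have h := hasSum_integral_of_summable_integral_norm (μ := unitMeas)
    (F := fun n q => a n * e n q * φ q) hint ?_
  · simp only [integral_unitMeas, tsum_mul_right] at h
    refine h.congr_fun fun n => ?_
    rw [← intervalIntegral.integral_const_mul]
    simp only [mul_assoc]
  · refine Summable.of_nonneg_of_le (fun n => integral_nonneg fun q => norm_nonneg _) (fun n => ?_)
      (ha.mul_right (M * ∫ q, ‖φ q‖ ∂unitMeas))
    rw [← integral_const_mul, ← integral_const_mul]
    refine integral_mono (hint n).norm ((hφ'.norm.const_mul _).const_mul _) fun q => ?_
    simp only [norm_mul, mul_assoc]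
    refine mul_le_mul_of_nonneg_left ?_ (abs_nonneg _)
    exact mul_le_mul_of_nonneg_right (hM n q) (norm_nonneg _)

theorem integral_modeSeries_mul_mode (S : ModeSystem σ κ lam e de) (ha : Summable fun n => |a n|)
    (m : ℕ) : ∫ q in (0 : ℝ)..1, modeSeries e a q * e m q = a m := by
  have h := S.hasSum_integral_modeSeries ha ((S.continuous m).intervalIntegrable 0 1)
  refine h.unique ?_
  convert hasSum_ite_eq m (a m) using 2 with n
  split_ifs with hn
  · subst hn
    have := S.norm n
    simp only [sq] at this
    rw [this, mul_one]
  · rw [S.orthogonal hn, mul_zero]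

/-- A continuous function with summable coefficients is the sum of its series. -/
theorem eq_modeSeries (S : ModeSystem σ κ lam e de) {f : ℝ → ℝ} (hf : ContinuousOn f (Icc 0 1))
    (hs : Summable fun n => |a n|) (ha : ∀ n, ∫ q in (0 : ℝ)..1, f q * e n q = a n) {x : ℝ}
    (hx : x ∈ Icc (0 : ℝ) 1) : f x = modeSeries e a x := by
  have hc := (S.continuous_modeSeries hs).continuousOn (s := Icc (0 : ℝ) 1)
  have := S.ae_eq_of_coeff_eq hf.memLp_unitMeas hc.memLp_unitMeas fun n => by
    rw [ha, S.integral_modeSeries_mul_mode hs]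
  exact Measure.eqOn_Icc_of_ae_eq volume zero_ne_one this hf hc hx

/-! ### Termwise differentiation and the energy inequality -/

section Smooth

theorem summable_of_weighted (S : ModeSystem σ κ lam e de)
    (ha : Summable fun n => |a n| * (1 + lam n)) :
    Summable (fun n => |a n|) ∧ Summable fun n => |-(lam n) * a n| := by
  constructor
  · refine Summable.of_nonneg_of_le (fun n => abs_nonneg _) (fun n => ?_) ha
    nlinarith [S.lam_pos n, abs_nonneg (a n)]
  · refine Summable.of_nonneg_of_le (fun n => abs_nonneg _) (fun n => ?_) ha
    rw [abs_mul, abs_neg, abs_of_pos (S.lam_pos n)]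
    nlinarith [S.lam_pos n, abs_nonneg (a n)]

theorem hasDerivAt_modeSeries (S : ModeSystem σ κ lam e de)
    (ha : Summable fun n => |a n| * (1 + lam n)) (q : ℝ) :
    HasDerivAt (modeSeries e a) (modeSeries de a q) q := by
  obtain ⟨M, hM0, hM⟩ := S.deriv_bound
  refine hasDerivAt_tsum (ha.mul_right M) (fun n q => (S.deriv n q).const_mul (a n))
    (fun n q => ?_) (S.summable_modeSeries (S.summable_of_weighted ha).1 0) q
  rw [norm_mul, mul_assoc, mul_comm (1 + lam n)]
  exact mul_le_mul_of_nonneg_left (hM n q) (abs_nonneg _)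

theorem summable_modeSeries_deriv (S : ModeSystem σ κ lam e de)
    (ha : Summable fun n => |a n| * (1 + lam n)) (q : ℝ) :
    Summable fun n => a n * de n q := by
  obtain ⟨M, hM0, hM⟩ := S.deriv_bound
  refine Summable.of_norm_bounded (ha.mul_right M) fun n => ?_
  rw [norm_mul, mul_assoc, mul_comm (1 + lam n)]
  exact mul_le_mul_of_nonneg_left (hM n q) (abs_nonneg _)

theorem hasDerivAt_modeSeries_deriv (S : ModeSystem σ κ lam e de)
    (ha : Summable fun n => |a n| * (1 + lam n)) (q : ℝ) :
    HasDerivAt (modeSeries de a) (modeSeries e (fun n => -(lam n) * a n) q) q := by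
  obtain ⟨M, hM0, hM⟩ := S.bound
  have := hasDerivAt_tsum ((S.summable_of_weighted ha).2.mul_right M)
    (fun n q => (S.deriv2 n q).const_mul (a n))
    (fun n q => ?_) (S.summable_modeSeries_deriv ha 0) q
  · refine this.congr_deriv (tsum_congr fun n => by ring)
  · rw [← mul_assoc, mul_comm (a n), norm_mul]
    exact mul_le_mul_of_nonneg_left (hM n q) (abs_nonneg _)

/-- No summability is needed: over the reals a constant factor commutes with `tsum` unconditionally,
a divergent sum having value 0. -/
theorem bc_modeSeries (S : ModeSystem σ κ lam e de) :
    RobinBC σ κ (modeSeries e a) (modeSeries de a) := by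
  unfold RobinBC modeSeries
  rw [← tsum_mul_left, ← tsum_mul_left, ← tsum_mul_left, ← tsum_mul_left, ← tsum_neg]
  constructor
  · exact tsum_congr fun n => by linear_combination a n * (S.bc n).1
  · exact tsum_congr fun n => by linear_combination a n * (S.bc n).2

/-- The energy of a series of modes. -/
theorem integral_deriv_sq_le (S : ModeSystem σ κ lam e de)
    (ha : Summable fun n => |a n| * (1 + lam n)) :
    Summable (fun n => lam n * a n ^ 2) ∧
      ∫ q in (0 : ℝ)..1, modeSeries de a q ^ 2 ≤ ∑' n, lam n * a n ^ 2 := by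
  obtain ⟨s1, s2⟩ := S.summable_of_weighted ha
  have cy := S.continuous_modeSeries s1
  have cddy := S.continuous_modeSeries s2
  have cdy : Continuous (modeSeries de a) :=
    continuous_iff_continuousAt.2 fun q => (S.hasDerivAt_modeSeries_deriv ha q).continuousAt
  have h1 := (S.hasSum_integral_modeSeries s2 (cy.intervalIntegrable 0 1)).neg
  -- So the sum of `lam n * a n ^ 2` is `-∫ y'' y`, where `y` is the series. Integration by parts
  -- bounds `∫ y'²` by it, since the boundary term `y y'` between 0 and 1 is nonpositive.
  have h2 : ∀ n, -(-(lam n) * a n * ∫ q in (0 : ℝ)..1, e n q * modeSeries e a q)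
      = lam n * a n ^ 2 := fun n => by
    have := S.integral_modeSeries_mul_mode s1 n
    simp only [mul_comm] at this
    rw [this]; ring
  simp only [h2] at h1
  refine ⟨h1.summable, ?_⟩
  rw [h1.tsum_eq]
  have h3 := intervalIntegral.integral_eq_sub_of_hasDerivAt (a := (0 : ℝ)) (b := 1)
    (fun q _ => (S.hasDerivAt_modeSeries ha q).mul (S.hasDerivAt_modeSeries_deriv ha q))
    (((cdy.mul cdy).add (cy.mul cddy)).intervalIntegrable _ _)
  rw [intervalIntegral.integral_add (f := fun q => modeSeries de a q * modeSeries de a q)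
    (g := fun q => modeSeries e a q * modeSeries e (fun n => -lam n * a n) q) ((cdy.mul cdy).intervalIntegrable _ _)
    ((cy.mul cddy).intervalIntegrable _ _)] at h3
  obtain ⟨b0, b1⟩ := (S.bc_modeSeries (a := a)).sign S.hσ S.hκ
  simp only [sq]
  simp only [Pi.mul_apply] at h3
  simp only [fun q => mul_comm (modeSeries e (fun n => -lam n * a n) q) (modeSeries e a q)]
  linarith

end Smooth

/-- Comparison with `1/n²`, after a shift by one because the lower bound is empty at `n = 0`. -/
theorem summable_inv_lam (S : ModeSystem σ κ lam e de) : Summable fun n => (lam n)⁻¹ := by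
  rw [← summable_nat_add_iff 1]
  refine Summable.of_nonneg_of_le (fun n => (inv_pos.2 (S.lam_pos _)).le) (fun n => ?_)
    ((summable_nat_add_iff 1).2 (Real.summable_nat_pow_inv.2 one_lt_two))
  have := S.lam_lower (n + 1)
  have h0 : (0 : ℝ) < ((n + 1 : ℕ) : ℝ) ^ 2 := by positivity
  exact inv_anti₀ h0 this

/-- From `x^(p+1)/(p+1)! ≤ exp x` at `x = lam n * t / 2`; the exponent `p + 1` leaves one spare
factor `(lam n)⁻¹`, which is summable. -/
theorem exp_neg_le (S : ModeSystem σ κ lam e de) (p : ℕ) {t : ℝ} (ht : 0 < t) (n : ℕ) :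
    lam n ^ p * Real.exp (-(lam n / 2) * t) ≤ (p + 1).factorial * (2 / t) ^ (p + 1) * (lam n)⁻¹ := by
  have hl := S.lam_pos n
  have h := Real.pow_div_factorial_le_exp (lam n / 2 * t) (by positivity) (p + 1)
  have h2 : Real.exp (-(lam n / 2) * t) = (Real.exp (lam n / 2 * t))⁻¹ := by
    rw [← Real.exp_neg]; ring_nf
  have h3 : (0 : ℝ) < (lam n / 2 * t) ^ (p + 1) / (p + 1).factorial := by positivity
  rw [h2]
  calc _ ≤ lam n ^ p * ((lam n / 2 * t) ^ (p + 1) / (p + 1).factorial)⁻¹ := by gcongr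
    _ = _ := by
      have : (lam n / 2 * t) ^ (p + 1) * (2 / t) ^ (p + 1) = lam n ^ p * lam n := by
        rw [← mul_pow, ← pow_succ]; congr 1; field_simp
      field_simp at this ⊢
      linarith

theorem summable_pow_mul_exp (S : ModeSystem σ κ lam e de) (p : ℕ) {t : ℝ} (ht : 0 < t) :
    Summable fun n => lam n ^ p * Real.exp (-(lam n / 2) * t) :=
  Summable.of_nonneg_of_le (fun n => mul_nonneg (pow_nonneg (S.lam_pos n).le _) (Real.exp_pos _).le)
    (S.exp_neg_le p ht) (S.summable_inv_lam.mul_left _)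

theorem summable_decay (S : ModeSystem σ κ lam e de) {c : ℕ → ℝ} {K : ℝ} (hc : ∀ n, |c n| ≤ K)
    {t : ℝ} (ht : 0 < t) : Summable fun n => |decay lam c t n| * (1 + lam n) := by
  have h := ((S.summable_pow_mul_exp 0 ht).add (S.summable_pow_mul_exp 1 ht)).mul_left K
  refine Summable.of_nonneg_of_le (fun n => ?_) (fun n => ?_) h
  · have := S.lam_pos n; positivity
  · have hl := S.lam_pos n
    rw [decay, abs_mul, abs_of_pos (Real.exp_pos _), pow_zero, pow_one, one_mul]
    calc _ ≤ K * Real.exp (-(lam n / 2) * t) * (1 + lam n) := by gcongr; exact hc n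
      _ = _ := by ring

theorem exists_coeff_bound (S : ModeSystem σ κ lam e de) {f : ℝ → ℝ} (hf : MemLp f 2 unitMeas) :
    ∃ K, 0 ≤ K ∧ ∀ n, |∫ q in (0 : ℝ)..1, f q * e n q| ≤ K := by
  have h := S.summable_coeff_sq hf
  refine ⟨_, Real.sqrt_nonneg _, fun n => Real.abs_le_sqrt (h.le_tsum n fun m _ => sq_nonneg _)⟩

end ModeSystem


namespace ModeSystem

variable {σ κ k : ℝ} {lam : ℕ → ℝ} {e de : ℕ → ℝ → ℝ}

/-! ### Comparison principle by implicit Euler steps -/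

/-- Each application of `resolv` is one implicit Euler step of length `2/k²` for `∂_t = ½ Δ`. It
preserves domination by an affine supersolution and multiplies each coefficient by a fixed factor.
-/
theorem iterate_resolv (S : ModeSystem σ κ lam e de) (hk : 0 < k) {f : ℝ → ℝ} {p r : ℝ}
    (hf : IntervalIntegrable f volume 0 1) (h0 : σ * p ≤ κ * r) (h1 : 0 ≤ κ * (p + r) + σ * p)
    (hle : ∀ q ∈ Icc (0 : ℝ) 1, f q ≤ p * q + r) (j : ℕ) :
    IntervalIntegrable ((resolv σ κ k)^[j] f) volume 0 1 ∧
      (∀ q ∈ Icc (0 : ℝ) 1, (resolv σ κ k)^[j] f q ≤ p * q + r) ∧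
      ∀ n, ∫ q in (0 : ℝ)..1, (resolv σ κ k)^[j] f q * e n q
        = ((1 + lam n / k ^ 2)⁻¹) ^ j * ∫ q in (0 : ℝ)..1, f q * e n q := by
  induction j with
  | zero => simpa using ⟨hf, fun q hq hq1 => hle q ⟨hq, hq1⟩⟩
  | succ j ih =>
    obtain ⟨i1, i2, i3⟩ := ih
    simp only [Function.iterate_succ_apply']
    refine ⟨(continuousOn_resolv i1).memLp_unitMeas.intervalIntegrable_unit, fun q hq => ?_,
      fun n => ?_⟩
    · exact (resolv_mono S.hσ S.hκ hk i1 (Continuous.intervalIntegrable (by fun_prop) _ _) i2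
        hq).trans (resolv_affine_le S.hσ S.hκ hk h0 h1 hq)
    · rw [S.integral_resolv_mul hk i1, i3, pow_succ]
      ring

/-- The bound holds after `N` Euler steps of length `t/N`. As `N` grows, the damping factors `θ N n`
converge to the exponentials, dominated uniformly in `N`, so the bound passes to the limit at each
point. -/
theorem modeSeries_decay_le (S : ModeSystem σ κ lam e de) {f : ℝ → ℝ} {p r : ℝ}
    (hf : MemLp f 2 unitMeas) (h0 : σ * p ≤ κ * r) (h1 : 0 ≤ κ * (p + r) + σ * p)
    (hle : ∀ q ∈ Icc (0 : ℝ) 1, f q ≤ p * q + r) {c : ℕ → ℝ}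
    (hc : ∀ n, ∫ q in (0 : ℝ)..1, f q * e n q = c n) {t : ℝ} (ht : 0 < t) {x : ℝ}
    (hx : x ∈ Icc (0 : ℝ) 1) : modeSeries e (decay lam c t) x ≤ p * x + r := by
  obtain ⟨K, hK0, hK⟩ := S.exists_coeff_bound hf
  simp only [hc] at hK
  obtain ⟨M, hM0, hM⟩ := S.bound
  set θ : ℕ → ℕ → ℝ := fun N n => ((1 + lam n * t / 2 / N) ^ N)⁻¹ with hθ
  have hθ0 : ∀ N n, 0 ≤ θ N n := fun N n => by
    have := S.lam_pos n; positivity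
  have hθ1 : ∀ N : ℕ, N ≠ 0 → ∀ n, θ N n ≤ 2 / t * (lam n)⁻¹ := fun N hN n => by
    have hl := S.lam_pos n
    have hN' : (0 : ℝ) < N := by positivity
    have hp : 0 ≤ lam n * t / 2 / N := by positivity
    -- Bernoulli: `(1 + x/N)^N ≥ 1 + x` with `x = lam n * t / 2`, which gives a bound free of `N`
    -- and summable in `n`.
    have := one_add_mul_le_pow (a := lam n * t / 2 / N) (by linarith) N
    rw [mul_div_cancel₀ _ hN'.ne'] at this
    have h2 : θ N n ≤ (lam n * t / 2)⁻¹ := inv_anti₀ (by positivity) (by linarith)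
    refine h2.trans_eq ?_
    field_simp
  have hev : ∀ᶠ N : ℕ in atTop, N ≠ 0 := eventually_ne_atTop 0
  have hval : ∀ N : ℕ, N ≠ 0 → ∑' n, θ N n * c n * e n x ≤ p * x + r := fun N hN => by
    have hN' : (0 : ℝ) < N := by positivity
    have hk : 0 < √(2 * N / t) := Real.sqrt_pos.2 (by positivity)
    obtain ⟨_, i2, i3⟩ := S.iterate_resolv hk hf.intervalIntegrable_unit h0 h1 hle N
    refine le_of_eq_of_le (Eq.symm ?_) (i2 x hx)
    refine S.eq_modeSeries (a := fun n => θ N n * c n) ?_ ?_ (fun n => ?_) hx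
    -- At least one Euler step has been made, and the last one makes the iterate continuous; hence
    -- it equals its series at every point.
    · obtain ⟨j, rfl⟩ := Nat.exists_eq_succ_of_ne_zero hN
      rw [Nat.succ_eq_add_one, Function.iterate_succ']
      exact continuousOn_resolv (S.iterate_resolv hk hf.intervalIntegrable_unit h0 h1 hle j).1
    · refine Summable.of_nonneg_of_le (fun n => abs_nonneg _) (fun n => ?_)
        ((S.summable_inv_lam.mul_left (2 / t)).mul_right K)
      rw [abs_mul, abs_of_nonneg (hθ0 N n)]
      exact mul_le_mul (hθ1 N hN n) (hK n) (abs_nonneg _) ((hθ0 N n).trans (hθ1 N hN n))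
    · rw [i3, hc, hθ, Real.sq_sqrt (by positivity), inv_pow]
      congr 4
      field_simp
  refine le_of_tendsto ?_ (hev.mono hval)
  unfold modeSeries
  refine tendsto_tsum_of_dominated_convergence
    (bound := fun n => 2 / t * (lam n)⁻¹ * K * M) ?_ (fun n => ?_) (hev.mono fun N hN n => ?_)
  · exact ((S.summable_inv_lam.mul_left (2 / t)).mul_right K).mul_right M
  · have h := (Real.tendsto_one_add_div_pow_exp (lam n * t / 2)).inv₀ (Real.exp_pos _).ne'
    have h2 : (Real.exp (lam n * t / 2))⁻¹ = Real.exp (-(lam n / 2) * t) := by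
      rw [← Real.exp_neg]; ring_nf
    rw [h2] at h
    rw [decay, mul_comm (c n)]
    exact (h.mul_const (c n)).mul_const (e n x)
  · rw [norm_mul, norm_mul, Real.norm_of_nonneg (hθ0 N n)]
    have := hθ1 N hN n
    have h3 := (hθ0 N n).trans this
    exact mul_le_mul (mul_le_mul this (hK n) (abs_nonneg _) h3) (hM n x) (abs_nonneg _)
      (mul_nonneg h3 hK0)

theorem modeSeries_neg {a : ℕ → ℝ} (x : ℝ) :
    modeSeries e (fun n => -a n) x = -modeSeries e a x := by
  unfold modeSeries
  rw [← tsum_neg]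
  exact tsum_congr fun n => by ring

theorem le_modeSeries_decay (S : ModeSystem σ κ lam e de) {f : ℝ → ℝ} {p r : ℝ}
    (hf : MemLp f 2 unitMeas) (h0 : κ * r ≤ σ * p) (h1 : κ * (p + r) + σ * p ≤ 0)
    (hle : ∀ q ∈ Icc (0 : ℝ) 1, p * q + r ≤ f q) {c : ℕ → ℝ}
    (hc : ∀ n, ∫ q in (0 : ℝ)..1, f q * e n q = c n) {t : ℝ} (ht : 0 < t) {x : ℝ}
    (hx : x ∈ Icc (0 : ℝ) 1) : p * x + r ≤ modeSeries e (decay lam c t) x := by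
  have := S.modeSeries_decay_le (f := fun q => -f q) (p := -p) (r := -r) hf.neg (by linarith)
    (by linarith) (fun q hq => by linarith [hle q hq]) (c := fun n => -c n) (fun n => by
      simp only [neg_mul, intervalIntegral.integral_neg, hc]) ht hx
  have h2 : decay lam (fun n => -c n) t = fun n => -decay lam c t n := by
    funext n; simp [decay]
  rw [h2, modeSeries_neg] at this
  linarith

end ModeSystem


/-! ### Term by term integration -/

/-- Integrability of the limit is part of the conclusion: it is measurable as an a.e. limit of
partial sums, and its L¹ norm is at most the sum of the L¹ norms. -/
theorem integrable_and_hasSum_integral {α : Type*} [MeasurableSpace α] {μ : Measure α}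
    {F : ℕ → α → ℝ} {f : α → ℝ} (hF : ∀ i, Integrable (F i) μ)
    (hs : Summable fun i => ∫ x, ‖F i x‖ ∂μ) (h : ∀ᵐ x ∂μ, HasSum (fun i => F i x) (f x)) :
    Integrable f μ ∧ HasSum (fun i => ∫ x, F i x ∂μ) (∫ x, f x ∂μ) := by
  refine ⟨⟨?_, ?_⟩, ?_⟩
  · refine aestronglyMeasurable_of_tendsto_ae atTop
      (f := fun N x => ∑ i ∈ Finset.range N, F i x) (fun N => ?_)
      (h.mono fun x hx => hx.tendsto_sum_nat)
    exact (integrable_finsetSum _ fun i _ => hF i).aestronglyMeasurable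
  · calc ∫⁻ x, ‖f x‖ₑ ∂μ ≤ ∫⁻ x, ∑' i, ‖F i x‖ₑ ∂μ := by
          refine lintegral_mono_ae (h.mono fun x hx => ?_)
          rw [← hx.tsum_eq]
          exact enorm_tsum_le_tsum_enorm
      _ = ∑' i, ∫⁻ x, ‖F i x‖ₑ ∂μ := lintegral_tsum fun i => (hF i).aestronglyMeasurable.enorm
      _ = ∑' i, ENNReal.ofReal (∫ x, ‖F i x‖ ∂μ) :=
          tsum_congr fun i => (ofReal_integral_norm_eq_lintegral_enorm (hF i)).symm
      _ = ENNReal.ofReal (∑' i, ∫ x, ‖F i x‖ ∂μ) :=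
          (ENNReal.ofReal_tsum_of_nonneg (fun i => integral_nonneg fun x => norm_nonneg _) hs).symm
      _ < ⊤ := ENNReal.ofReal_lt_top
  · rw [integral_congr_ae (h.mono fun x hx => hx.tsum_eq.symm)]
    exact hasSum_integral_of_summable_integral_norm hF hs

theorem integral_exp_neg_le {l t : ℝ} (hl : 0 < l) (ht : 0 ≤ t) :
    ∫ s in Ioc 0 t, Real.exp (-l * s) ≤ l⁻¹ := by
  rw [← intervalIntegral.integral_of_le ht]
  have hd : ∀ s ∈ uIcc 0 t, HasDerivAt (fun s => -(l⁻¹ * Real.exp (-l * s)))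
      (Real.exp (-l * s)) s := fun s _ => by
    have h1 : HasDerivAt (fun x : ℝ => -l * x) (-l) s := by
      simpa using (hasDerivAt_id s).const_mul (-l)
    refine ((h1.exp.const_mul l⁻¹).neg).congr_deriv ?_
    field_simp
  rw [intervalIntegral.integral_eq_sub_of_hasDerivAt hd
    (Continuous.intervalIntegrable (by fun_prop) _ _)]
  have := Real.exp_pos (-l * t)
  have : 0 < l⁻¹ * Real.exp (-l * t) := by positivity
  simp only [mul_zero, Real.exp_zero, mul_one]
  linarith

namespace ModeSystem

variable {σ κ : ℝ} {lam : ℕ → ℝ} {e de : ℕ → ℝ → ℝ} {c : ℕ → ℝ}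

/-- The coefficients need not be absolutely summable as `s` tends to 0, but the integral of `exp
(-(lam n / 2) s)` over time is at most `2 / lam n`, which is summable. Bounded `c` therefore
suffices. -/
theorem hasSum_integral_decay (S : ModeSystem σ κ lam e de) {K : ℝ} (hc : ∀ n, |c n| ≤ K)
    {b : ℕ → ℝ → ℝ} {B t : ℝ} (ht : 0 ≤ t) (hb : ∀ n, ContinuousOn (b n) (Icc 0 t))
    (hB : ∀ n, ∀ s ∈ Icc 0 t, |b n s| ≤ B) {β : ℝ → ℝ}
    (hβ : ∀ s ∈ Ioc 0 t, HasSum (fun n => decay lam c s n * b n s) (β s)) :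
    IntervalIntegrable β volume 0 t ∧
      HasSum (fun n => ∫ s in (0 : ℝ)..t, decay lam c s n * b n s) (∫ s in (0 : ℝ)..t, β s) := by
  have hK0 : 0 ≤ K := (abs_nonneg _).trans (hc 0)
  have hdc : ∀ n, Continuous fun s => decay lam c s n := fun n => by unfold decay; fun_prop
  have hint : ∀ n, Integrable (fun s => decay lam c s n * b n s) (volume.restrict (Ioc 0 t)) :=
    fun n => (((hdc n).continuousOn.mul (hb n)).integrableOn_compact isCompact_Icc).mono_set
      Ioc_subset_Icc_self
  have := integrable_and_hasSum_integral hint ?_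
    ((ae_restrict_mem measurableSet_Ioc).mono fun s hs => hβ s hs)
  · rw [intervalIntegrable_iff_integrableOn_Ioc_of_le ht]
    simp only [intervalIntegral.integral_of_le ht]
    exact this
  · refine Summable.of_nonneg_of_le (fun n => integral_nonneg fun _ => norm_nonneg _) (fun n => ?_)
      (S.summable_inv_lam.mul_left (K * B * 2))
    have hl := S.lam_pos n
    calc _ ≤ ∫ s in Ioc 0 t, K * B * Real.exp (-(lam n / 2) * s) := by
          refine integral_mono_ae (hint n).norm ?_ ?_
          · exact (Continuous.integrableOn_Icc (by fun_prop)).mono_set Ioc_subset_Icc_self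
          · filter_upwards [ae_restrict_mem measurableSet_Ioc] with s hs
            rw [decay, norm_mul, norm_mul, Real.norm_of_nonneg (Real.exp_pos _).le, mul_right_comm]
            exact mul_le_mul_of_nonneg_right (mul_le_mul (hc n) (hB n s (Ioc_subset_Icc_self hs))
              (abs_nonneg _) hK0) (Real.exp_pos _).le
      _ ≤ K * B * (lam n / 2)⁻¹ := by
          rw [integral_const_mul]
          have hB0 : 0 ≤ B := (abs_nonneg _).trans (hB 0 0 ⟨le_rfl, ht⟩)
          gcongr
          exact integral_exp_neg_le (by positivity) ht
      _ = _ := by rw [inv_div]; ring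

end ModeSystem

/-! ### Weak formulation for one mode -/

/-- Clamping both variables to the rectangle; Fubini and continuity of parametric integrals are then
applied to globally continuous integrands. -/
theorem exists_continuous_ext {T : ℝ} (hT : 0 ≤ T) {F : ℝ → ℝ → ℝ}
    (hF : ContinuousOn (fun p : ℝ × ℝ => F p.1 p.2) (Icc (0 : ℝ) T ×ˢ Icc (0 : ℝ) 1)) :
    ∃ F' : ℝ → ℝ → ℝ, Continuous (fun p : ℝ × ℝ => F' p.1 p.2) ∧
      ∀ s ∈ Icc (0 : ℝ) T, ∀ q ∈ Icc (0 : ℝ) 1, F' s q = F s q := by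
  refine ⟨fun s q => F (projIcc 0 T hT s) (projIcc 0 1 zero_le_one q), ?_, fun s hs q hq => ?_⟩
  · refine hF.comp_continuous (f := fun p : ℝ × ℝ =>
      ((projIcc 0 T hT p.1 : ℝ), (projIcc 0 1 zero_le_one p.2 : ℝ))) ?_ fun p => ⟨?_, ?_⟩
    · exact (continuous_subtype_val.comp (continuous_projIcc.comp continuous_fst)).prodMk
        (continuous_subtype_val.comp (continuous_projIcc.comp continuous_snd))
    · exact Subtype.coe_prop _
    · exact Subtype.coe_prop _
  · simp only [projIcc_of_mem _ hs, projIcc_of_mem _ hq]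

theorem integral_integral_swap_of_continuous {F : ℝ → ℝ → ℝ}
    (hF : Continuous (fun p : ℝ × ℝ => F p.1 p.2)) {a b c d : ℝ} :
    ∫ x in a..b, ∫ y in c..d, F x y = ∫ y in c..d, ∫ x in a..b, F x y := by
  refine intervalIntegral_intervalIntegral_swap ?_
  exact (hF.continuousOn.integrableOn_compact (isCompact_uIcc.prod isCompact_uIcc)).mono_set
    (prod_mono uIoc_subset_uIcc uIoc_subset_uIcc)

/-- The boundary terms from two integrations by parts. -/
def bdTerm (h dh : ℝ → ℝ) (G Gq : ℝ → ℝ → ℝ) (s : ℝ) : ℝ :=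
  dh 1 * G s 1 - h 1 * Gq s 1 - (dh 0 * G s 0 - h 0 * Gq s 0)

section Mode

variable {T : ℝ} {G Gs Gq Gqq : ℝ → ℝ → ℝ} {l : ℝ} {h dh : ℝ → ℝ}

theorem IsC12.continuousOn_integral (hG : IsC12 T G Gs Gq Gqq) (hT : 0 ≤ T) (hh : Continuous h) :
    ContinuousOn (fun s => ∫ q in (0 : ℝ)..1, h q * (1 / 2 * Gqq s q + Gs s q)) (Icc 0 T) := by
  obtain ⟨F, hF, hFe⟩ := exists_continuous_ext hT
    (F := fun s q => 1 / 2 * Gqq s q + Gs s q) ((hG.cont_qq.const_smul (1 / 2 : ℝ)).add hG.cont_s)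
  refine ContinuousOn.congr (f := fun s => ∫ q in (0 : ℝ)..1, h q * F s q) ?_ fun s hs => ?_
  · have : Continuous (Function.uncurry F) := hF
    exact (intervalIntegral.continuous_parametric_intervalIntegral_of_continuous'
      (f := fun s q => h q * F s q) ((hh.comp continuous_snd).mul this) 0 1).continuousOn
  · refine intervalIntegral.integral_congr fun q hq => ?_
    rw [uIcc_of_le zero_le_one] at hq
    simp only [hFe s hs q hq]

theorem IsC12.continuousOn_slice (hG : IsC12 T G Gs Gq Gqq) {q : ℝ} (hq : q ∈ Icc (0 : ℝ) 1) :
    ContinuousOn (fun s => G s q) (Icc 0 T) ∧ ContinuousOn (fun s => Gq s q) (Icc 0 T) := by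
  have hc : ContinuousOn (fun s : ℝ => (s, q)) (Icc 0 T) := by fun_prop
  have hm : MapsTo (fun s : ℝ => (s, q)) (Icc 0 T) (Icc (0 : ℝ) T ×ˢ Icc (0 : ℝ) 1) :=
    fun s hs => ⟨hs, hq⟩
  exact ⟨hG.cont.comp hc hm, hG.cont_q.comp hc hm⟩

theorem IsC12.continuousOn_space (hG : IsC12 T G Gs Gq Gqq) {s : ℝ} (hs : s ∈ Icc (0 : ℝ) T) :
    ContinuousOn (G s) (Icc 0 1) ∧ ContinuousOn (Gq s) (Icc 0 1) ∧ ContinuousOn (Gs s) (Icc 0 1) ∧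
      ContinuousOn (Gqq s) (Icc 0 1) := by
  have hc : ContinuousOn (fun q : ℝ => (s, q)) (Icc 0 1) := by fun_prop
  have hm : MapsTo (fun q : ℝ => (s, q)) (Icc 0 1) (Icc (0 : ℝ) T ×ˢ Icc (0 : ℝ) 1) :=
    fun q hq => ⟨hs, hq⟩
  exact ⟨hG.cont.comp hc hm, hG.cont_q.comp hc hm, hG.cont_s.comp hc hm, hG.cont_qq.comp hc hm⟩

theorem IsC12.continuousOn_bdTerm (hG : IsC12 T G Gs Gq Gqq) :
    ContinuousOn (bdTerm h dh G Gq) (Icc 0 T) := by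
  obtain ⟨a, b⟩ := hG.continuousOn_slice (right_mem_Icc.2 zero_le_one)
  obtain ⟨a', b'⟩ := hG.continuousOn_slice (left_mem_Icc.2 zero_le_one)
  unfold bdTerm
  fun_prop

/-- Integration by parts in space. -/
theorem IsC12.integral_space (hG : IsC12 T G Gs Gq Gqq)
    (h1 : ∀ q, HasDerivAt h (dh q) q) (h2 : ∀ q, HasDerivAt dh (-l * h q) q) {s : ℝ}
    (hs : s ∈ Icc (0 : ℝ) T) :
    ∫ q in (0 : ℝ)..1, h q * (Gs s q - l / 2 * G s q)
      = (∫ q in (0 : ℝ)..1, h q * (1 / 2 * Gqq s q + Gs s q)) + 1 / 2 * bdTerm h dh G Gq s := by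
  have ch : Continuous h := continuous_iff_continuousAt.2 fun q => (h1 q).continuousAt
  have cdh : Continuous dh := continuous_iff_continuousAt.2 fun q => (h2 q).continuousAt
  obtain ⟨c0, c1, c2, c3⟩ := hG.continuousOn_space hs
  have hu : uIcc (0 : ℝ) 1 = Icc 0 1 := uIcc_of_le zero_le_one
  -- The integrand is the derivative of `h' G - h G_q`, as `h'' = -l h`.
  have key : ∫ q in (0 : ℝ)..1, (-l * (h q * G s q) - h q * Gqq s q) = bdTerm h dh G Gq s := by
    refine intervalIntegral.integral_eq_sub_of_hasDeriv_right_of_le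
      (f := fun q => dh q * G s q - h q * Gq s q) zero_le_one (by fun_prop) (fun q hq => ?_)
      (ContinuousOn.intervalIntegrable (by rw [hu]; fun_prop))
    have hn : Icc (0 : ℝ) 1 ∈ 𝓝 q := Icc_mem_nhds hq.1 hq.2
    have a := (hG.deriv_q s hs q (Ioo_subset_Icc_self hq)).hasDerivAt hn
    have b := (hG.deriv_qq s hs q (Ioo_subset_Icc_self hq)).hasDerivAt hn
    refine ((((h2 q).mul a).sub ((h1 q).mul b)).congr_deriv ?_).hasDerivWithinAt
    ring
  rw [← key, ← intervalIntegral.integral_const_mul, ← intervalIntegral.integral_add]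
  · refine intervalIntegral.integral_congr fun q _ => ?_
    ring
  · exact ContinuousOn.intervalIntegrable (by rw [hu]; fun_prop)
  · exact ContinuousOn.intervalIntegrable (by rw [hu]; fun_prop)

/-- The weak formulation for `exp (-(l/2) t) h(q)`, where `h'' = -l h`. -/
theorem IsC12.weak_mode (hG : IsC12 T G Gs Gq Gqq)
    (h1 : ∀ q, HasDerivAt h (dh q) q) (h2 : ∀ q, HasDerivAt dh (-l * h q) q) {t : ℝ}
    (ht : t ∈ Icc (0 : ℝ) T) :
    Real.exp (-(l / 2) * t) * (∫ q in (0 : ℝ)..1, h q * G t q) - (∫ q in (0 : ℝ)..1, h q * G 0 q)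
      - (∫ s in (0 : ℝ)..t, Real.exp (-(l / 2) * s)
          * ∫ q in (0 : ℝ)..1, h q * (1 / 2 * Gqq s q + Gs s q))
      = 1 / 2 * ∫ s in (0 : ℝ)..t, Real.exp (-(l / 2) * s) * bdTerm h dh G Gq s := by
  have hT : 0 ≤ T := ht.1.trans ht.2
  have ch : Continuous h := continuous_iff_continuousAt.2 fun q => (h1 q).continuousAt
  obtain ⟨F, hF, hFe⟩ := exists_continuous_ext hT (F := fun s q => Gs s q - l / 2 * G s q)
    (hG.cont_s.sub (continuousOn_const.mul hG.cont))
  have hu : uIcc (0 : ℝ) 1 = Icc 0 1 := uIcc_of_le zero_le_one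
  have hut : uIcc (0 : ℝ) t = Icc 0 t := uIcc_of_le ht.1
  have hsub : Icc 0 t ⊆ Icc 0 T := Icc_subset_Icc_right ht.2
  have hE : Continuous fun s => Real.exp (-(l / 2) * s) := by fun_prop
  -- The time derivative of `exp (-(l/2) s) G` is `exp (-(l/2) s) (G_s - (l/2) G)`. Integrating it
  -- against `h` in both orders gives the two sides of the claim.
  have ftc : ∀ q ∈ Icc (0 : ℝ) 1, ∫ s in (0 : ℝ)..t, Real.exp (-(l / 2) * s) * F s q
      = Real.exp (-(l / 2) * t) * G t q - G 0 q := fun q hq => by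
    have := intervalIntegral.integral_eq_sub_of_hasDeriv_right_of_le
      (f := fun s => Real.exp (-(l / 2) * s) * G s q)
      (f' := fun s => Real.exp (-(l / 2) * s) * F s q) ht.1
      (hE.continuousOn.mul ((hG.continuousOn_slice hq).1.mono hsub)) (fun s hs => ?_)
      (Continuous.intervalIntegrable (hE.mul (hF.comp (Continuous.prodMk_left q))) _ _)
    · simpa using this
    · have hn : Icc (0 : ℝ) T ∈ 𝓝 s := Icc_mem_nhds hs.1 (hs.2.trans_le ht.2)
      have a := (hG.deriv_s s (hsub (Ioo_subset_Icc_self hs)) q hq).hasDerivAt hn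
      have b : HasDerivAt (fun x : ℝ => -(l / 2) * x) (-(l / 2)) s := by
        simpa using (hasDerivAt_id s).const_mul (-(l / 2))
      refine ((b.exp.mul a).congr_deriv ?_).hasDerivWithinAt
      rw [hFe s (hsub (Ioo_subset_Icc_self hs)) q hq]
      ring
  have swap := integral_integral_swap_of_continuous
    (F := fun q s => h q * (Real.exp (-(l / 2) * s) * F s q))
    ((ch.comp continuous_fst).mul ((hE.comp continuous_snd).mul
      (hF.comp (continuous_snd.prodMk continuous_fst)))) (a := 0) (b := 1) (c := 0) (d := t)
  have lhs : (∫ q in (0 : ℝ)..1, ∫ s in (0 : ℝ)..t, h q * (Real.exp (-(l / 2) * s) * F s q))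
      = Real.exp (-(l / 2) * t) * (∫ q in (0 : ℝ)..1, h q * G t q)
        - ∫ q in (0 : ℝ)..1, h q * G 0 q := by
    have c0 := (hG.continuousOn_space ht).1
    have c0' := (hG.continuousOn_space (s := 0) ⟨le_rfl, hT⟩).1
    rw [← intervalIntegral.integral_const_mul, ← intervalIntegral.integral_sub]
    · refine intervalIntegral.integral_congr fun q hq => ?_
      simp only [intervalIntegral.integral_const_mul]
      rw [ftc q (hu ▸ hq)]
      ring
    · exact ContinuousOn.intervalIntegrable (by rw [hu]; fun_prop)
    · exact ContinuousOn.intervalIntegrable (by rw [hu]; fun_prop)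
  have rhs : (∫ s in (0 : ℝ)..t, ∫ q in (0 : ℝ)..1, h q * (Real.exp (-(l / 2) * s) * F s q))
      = (∫ s in (0 : ℝ)..t, Real.exp (-(l / 2) * s)
          * ∫ q in (0 : ℝ)..1, h q * (1 / 2 * Gqq s q + Gs s q))
        + 1 / 2 * ∫ s in (0 : ℝ)..t, Real.exp (-(l / 2) * s) * bdTerm h dh G Gq s := by
    have c1 := (hG.continuousOn_integral hT ch).mono hsub
    have c2 := (hG.continuousOn_bdTerm (h := h) (dh := dh)).mono hsub
    rw [← intervalIntegral.integral_const_mul, ← intervalIntegral.integral_add]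
    · refine intervalIntegral.integral_congr fun s hs => ?_
      have hs' := hsub (hut ▸ hs)
      have e1 := hG.integral_space h1 h2 hs'
      have e2 : ∫ q in (0 : ℝ)..1, h q * (Gs s q - l / 2 * G s q)
          = ∫ q in (0 : ℝ)..1, h q * F s q :=
        intervalIntegral.integral_congr fun q hq => by simp only [hFe s hs' q (hu ▸ hq)]
      simp only [mul_left_comm (h _), intervalIntegral.integral_const_mul]
      rw [← e2, e1]
      ring
    · exact ContinuousOn.intervalIntegrable (by rw [hut]; exact hE.continuousOn.mul c1)
    · refine ContinuousOn.intervalIntegrable ?_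
      rw [hut]; exact continuousOn_const.mul (hE.continuousOn.mul c2)
  linarith

end Mode


/-! ### The series solution -/

/-- The sum of the affine function `p q + r` and of a decaying series of modes. -/
noncomputable def heatSol (lam : ℕ → ℝ) (e : ℕ → ℝ → ℝ) (c : ℕ → ℝ) (p r t q : ℝ) : ℝ :=
  p * q + r + modeSeries e (decay lam c t) q

theorem ae_Icc_of_forall_Ioc {T : ℝ} {P : ℝ → Prop} (h : ∀ s ∈ Ioc 0 T, P s) :
    ∀ᵐ s ∂volume.restrict (Icc (0 : ℝ) T), P s := by
  rw [← restrict_Ioc_eq_restrict_Icc]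
  exact ae_restrict_of_forall_mem measurableSet_Ioc h

theorem spaceTime_eq (T : ℝ) : spaceTime T = (volume.restrict (Ioc (0 : ℝ) T)).prod unitMeas := by
  rw [spaceTime, restrict_Ioc_eq_restrict_Icc]

theorem ae_spaceTime {T : ℝ} {P : ℝ × ℝ → Prop}
    (h : ∀ s ∈ Ioc 0 T, ∀ q ∈ Icc (0 : ℝ) 1, P (s, q)) : ∀ᵐ p ∂spaceTime T, P p := by
  rw [spaceTime_eq, unitMeas, Measure.prod_restrict]
  exact ae_restrict_of_forall_mem (measurableSet_Ioc.prod measurableSet_Icc)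
    fun p hp => h p.1 hp.1 p.2 hp.2

theorem hasWeakDeriv_of_hasDerivAt {f df : ℝ → ℝ} (h : ∀ q, HasDerivAt f (df q) q)
    (hc : Continuous df) : HasWeakDeriv f df := by
  intro φ hφ _ hs
  have h0 : ∀ x, x ∉ Ioo (0 : ℝ) 1 → φ x = 0 := fun x hx =>
    image_eq_zero_of_notMem_tsupport fun h => hx (hs h)
  have hne : (∞ : WithTop ℕ∞) ≠ 0 := by simp
  have dφ : Continuous (deriv φ) := (((contDiff_infty_iff_deriv (𝕜 := ℝ)).1 hφ).2).continuous
  rw [intervalIntegral.integral_mul_deriv_eq_deriv_mul (fun x _ => h x)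
    (fun x _ => (hφ.differentiable hne x).hasDerivAt) (hc.intervalIntegrable _ _)
    (dφ.intervalIntegrable _ _), h0 0 (by simp), h0 1 (by simp)]
  ring

namespace ModeSystem

variable {σ κ : ℝ} {lam : ℕ → ℝ} {e de : ℕ → ℝ → ℝ} {c : ℕ → ℝ}

theorem summable_abs_decay (S : ModeSystem σ κ lam e de) {K : ℝ} (hc : ∀ n, |c n| ≤ K)
    {t : ℝ} (ht : 0 < t) : Summable fun n => |decay lam c t n| :=
  (S.summable_of_weighted (S.summable_decay hc ht)).1

theorem aestronglyMeasurable_modeSeries {T : ℝ} {ε : ℕ → ℝ → ℝ} (hε : ∀ n, Continuous (ε n))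
    (hs : ∀ s ∈ Ioc 0 T, ∀ q, Summable fun n => decay lam c s n * ε n q) :
    AEStronglyMeasurable (fun p : ℝ × ℝ => modeSeries ε (decay lam c p.1) p.2) (spaceTime T) := by
  have hl : ∀ᵐ p ∂spaceTime T,
      Tendsto (fun N => ∑ n ∈ Finset.range N, decay lam c p.1 n * ε n p.2) atTop
        (𝓝 (modeSeries ε (decay lam c p.1) p.2)) := by
    refine ae_spaceTime fun s hs' q _ => ?_
    have := (hs s hs' q).hasSum.tendsto_sum_nat
    exact this
  refine aestronglyMeasurable_of_tendsto_ae atTop (fun N => ?_) hl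
  have h1 : ∀ n, Continuous fun p : ℝ × ℝ => decay lam c p.1 n := fun n => by
    unfold decay; fun_prop
  have h2 : Continuous fun p : ℝ × ℝ => ∑ n ∈ Finset.range N, decay lam c p.1 n * ε n p.2 :=
    continuous_finsetSum _ fun n _ => (h1 n).mul ((hε n).comp continuous_snd)
  exact h2.aestronglyMeasurable

/-- The derivative of the series is square integrable in space-time. -/
theorem memLp_modeSeries_deriv (S : ModeSystem σ κ lam e de) {T : ℝ} (hT : 0 ≤ T)
    (hc2 : Summable fun n => c n ^ 2) :
    MemLp (fun p : ℝ × ℝ => modeSeries de (decay lam c p.1) p.2) 2 (spaceTime T) := by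
  have hK : ∀ n, |c n| ≤ √(∑' n, c n ^ 2) := fun n =>
    Real.abs_le_sqrt (hc2.le_tsum n fun m _ => sq_nonneg _)
  have hm : AEStronglyMeasurable (fun p : ℝ × ℝ => modeSeries de (decay lam c p.1) p.2)
      (spaceTime T) := aestronglyMeasurable_modeSeries S.continuous_deriv
    fun s hs q => S.summable_modeSeries_deriv (S.summable_decay hK hs.1) q
  rw [memLp_two_iff_integrable_sq hm, spaceTime_eq, integrable_prod_iff (by
    rw [← spaceTime_eq]; exact hm.pow 2)]
  have hcont : ∀ s ∈ Ioc 0 T, Continuous (modeSeries de (decay lam c s)) := fun s hs =>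
    continuous_iff_continuousAt.2 fun q =>
      (S.hasDerivAt_modeSeries_deriv (S.summable_decay hK hs.1) q).continuousAt
  constructor
  · refine ae_restrict_of_forall_mem measurableSet_Ioc fun s hs => ?_
    exact ((hcont s hs).pow 2).integrableOn_Icc
  · have hE := integrable_and_hasSum_integral (μ := volume.restrict (Ioc 0 T))
      (F := fun n s => c n ^ 2 * (lam n * Real.exp (-lam n * s)))
      (f := fun s => ∑' n, lam n * decay lam c s n ^ 2) (fun n =>
        (Continuous.integrableOn_Icc (by fun_prop)).mono_set Ioc_subset_Icc_self) ?_ ?_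
    · refine hE.1.mono' ?_ (ae_restrict_of_forall_mem measurableSet_Ioc fun s hs => ?_)
      · rw [spaceTime_eq] at hm
        exact (hm.pow 2).norm.integral_prod_right'
      · have := (S.integral_deriv_sq_le (S.summable_decay hK hs.1)).2
        rw [Real.norm_of_nonneg (integral_nonneg fun _ => norm_nonneg _)]
        refine le_of_eq_of_le ?_ this
        rw [← integral_unitMeas]
        exact integral_congr_ae (Eventually.of_forall fun q => by simp)
    · refine Summable.of_nonneg_of_le (fun n => integral_nonneg fun _ => norm_nonneg _)
        (fun n => ?_) hc2
      have hl := S.lam_pos n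
      calc _ = c n ^ 2 * (lam n * ∫ s in Ioc 0 T, Real.exp (-lam n * s)) := by
            rw [← integral_const_mul, ← integral_const_mul]
            refine integral_congr_ae (Eventually.of_forall fun s => ?_)
            exact Real.norm_of_nonneg (by positivity)
        _ ≤ c n ^ 2 * (lam n * (lam n)⁻¹) := by
            gcongr
            exact integral_exp_neg_le hl hT
        _ = c n ^ 2 := by field_simp
    · refine ae_restrict_of_forall_mem measurableSet_Ioc fun s hs => ?_
      refine (S.integral_deriv_sq_le (S.summable_decay hK hs.1)).1.hasSum.congr_fun fun n => ?_
      rw [decay, mul_pow, ← Real.exp_nat_mul]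
      ring_nf

theorem isL2H1_heatSol (S : ModeSystem σ κ lam e de) {T p r : ℝ} (hT : 0 ≤ T)
    (hc2 : Summable fun n => c n ^ 2) {ρ : ℝ → ℝ → ℝ}
    (hρ : ∀ s ∈ Ioc 0 T, ∀ q ∈ Icc (0 : ℝ) 1, ρ s q = heatSol lam e c p r s q)
    (h01 : ∀ s ∈ Ioc 0 T, ∀ q ∈ Icc (0 : ℝ) 1, ρ s q ∈ Icc (0 : ℝ) 1) :
    IsL2H1 T ρ (heatSol lam e c p r) := by
  have hK : ∀ n, |c n| ≤ √(∑' n, c n ^ 2) := fun n =>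
    Real.abs_le_sqrt (hc2.le_tsum n fun m _ => sq_nonneg _)
  have haff : Continuous fun x : ℝ × ℝ => p * x.2 + r := by fun_prop
  have hd : ∀ s ∈ Ioc 0 T, ∀ q, HasDerivAt (heatSol lam e c p r s)
      (p + modeSeries de (decay lam c s) q) q := fun s hs q => by
    refine HasDerivAt.add ?_ (S.hasDerivAt_modeSeries (S.summable_decay hK hs.1) q)
    simpa using ((hasDerivAt_id q).const_mul p).add_const r
  refine ⟨?_, ?_, ?_, fun s q => p + modeSeries de (decay lam c s) q, ?_, ?_⟩
  · exact ae_Icc_of_forall_Ioc fun s hs =>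
      ae_restrict_of_forall_mem measurableSet_Icc fun q hq => hρ s hs q hq
  · exact ae_Icc_of_forall_Ioc fun s hs q _ => (hd s hs q).continuousAt.continuousWithinAt
  · have : IsFiniteMeasure (spaceTime T) := by unfold spaceTime; infer_instance
    refine MemLp.of_bound (haff.aestronglyMeasurable.add
      (aestronglyMeasurable_modeSeries S.continuous fun s hs q =>
        S.summable_modeSeries (S.summable_abs_decay hK hs.1) q)) 1 (ae_spaceTime fun s hs q hq => ?_)
    have := h01 s hs q hq
    rw [hρ s hs q hq] at this
    exact abs_le.2 ⟨by linarith [this.1], this.2⟩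
  · have : IsFiniteMeasure (spaceTime T) := by unfold spaceTime; infer_instance
    exact (memLp_const p).add (S.memLp_modeSeries_deriv hT hc2)
  · refine ae_Icc_of_forall_Ioc fun s hs => hasWeakDeriv_of_hasDerivAt (hd s hs) ?_
    exact continuous_const.add (continuous_iff_continuousAt.2 fun q =>
      (S.hasDerivAt_modeSeries_deriv (S.summable_decay hK hs.1) q).continuousAt)

/-- Weak formulation for the series. -/
theorem weak_modeSeries (S : ModeSystem σ κ lam e de) {f : ℝ → ℝ} (hf : MemLp f 2 unitMeas)
    (hc : ∀ n, ∫ q in (0 : ℝ)..1, f q * e n q = c n) {T : ℝ} {G Gs Gq Gqq : ℝ → ℝ → ℝ}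
    (hG : IsC12 T G Gs Gq Gqq) {t : ℝ} (ht : t ∈ Ioc 0 T) {B : ℝ}
    (hB : ∀ n, ∀ s ∈ Icc 0 t, |bdTerm (e n) (de n) G Gq s| ≤ B) {b : ℝ → ℝ}
    (hb : ∀ s ∈ Ioc 0 t, HasSum (fun n => decay lam c s n * bdTerm (e n) (de n) G Gq s) (b s)) :
    IntervalIntegrable (fun s => ∫ q in (0 : ℝ)..1,
        modeSeries e (decay lam c s) q * (1 / 2 * Gqq s q + Gs s q)) volume 0 t ∧
      IntervalIntegrable b volume 0 t ∧
      (∫ q in (0 : ℝ)..1, modeSeries e (decay lam c t) q * G t q) - (∫ q in (0 : ℝ)..1, f q * G 0 q)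
        - (∫ s in (0 : ℝ)..t, ∫ q in (0 : ℝ)..1,
            modeSeries e (decay lam c s) q * (1 / 2 * Gqq s q + Gs s q))
        = 1 / 2 * ∫ s in (0 : ℝ)..t, b s := by
  obtain ⟨K, hK0, hK⟩ := S.exists_coeff_bound hf
  simp only [hc] at hK
  obtain ⟨M, hM0, hM⟩ := S.bound
  have ht' := Ioc_subset_Icc_self ht
  have hT : 0 ≤ T := ht'.1.trans ht'.2
  have hsub : Icc 0 t ⊆ Icc 0 T := Icc_subset_Icc_right ht.2
  have hu : uIcc (0 : ℝ) 1 = Icc 0 1 := uIcc_of_le zero_le_one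
  have cΨ : ∀ s ∈ Icc 0 T, ContinuousOn (fun q => 1 / 2 * Gqq s q + Gs s q) (uIcc 0 1) :=
    fun s hs => by
      obtain ⟨_, _, c2, c3⟩ := hG.continuousOn_space hs
      rw [hu]; fun_prop
  obtain ⟨D, hD⟩ := (isCompact_Icc.prod isCompact_Icc).exists_bound_of_continuousOn
    (((hG.cont_qq.const_smul (1 / 2 : ℝ)).add hG.cont_s))
  have s1 := S.hasSum_integral_modeSeries (S.summable_abs_decay hK ht.1)
    (φ := G t) (ContinuousOn.intervalIntegrable (by rw [hu]; exact (hG.continuousOn_space ht').1))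
  -- At time 0 the coefficients are only square summable, so Parseval replaces absolute convergence.
  have s2 := S.hasSum_coeff_mul_coeff hf
    (hG.continuousOn_space (s := 0) ⟨le_rfl, hT⟩).1.memLp_unitMeas
  have s3 := S.hasSum_integral_decay hK ht.1.le
    (b := fun n s => ∫ q in (0 : ℝ)..1, e n q * (1 / 2 * Gqq s q + Gs s q)) (B := M * D)
    (β := fun s => ∫ q in (0 : ℝ)..1, modeSeries e (decay lam c s) q * (1 / 2 * Gqq s q + Gs s q))
    (fun n => (hG.continuousOn_integral hT (S.continuous n)).mono hsub) (fun n s hs => ?_)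
    (fun s hs => S.hasSum_integral_modeSeries (S.summable_abs_decay hK hs.1)
      (cΨ s (hsub (Ioc_subset_Icc_self hs))).intervalIntegrable)
  · have s4 := S.hasSum_integral_decay hK ht.1.le (fun n => hG.continuousOn_bdTerm.mono hsub) hB hb
    refine ⟨s3.1, s4.1, ?_⟩
    refine ((s1.sub s2).sub s3.2).unique ((s4.2.mul_left (1 / 2)).congr_fun fun n => ?_)
    have := hG.weak_mode (S.deriv n) (S.deriv2 n) ht'
    rw [hc]
    simp only [decay, mul_assoc, intervalIntegral.integral_const_mul]
    linear_combination c n * this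
  · have := intervalIntegral.norm_integral_le_of_norm_le_const (a := (0 : ℝ)) (b := 1)
      (f := fun q => e n q * (1 / 2 * Gqq s q + Gs s q)) (C := M * D) fun q hq => ?_
    · simpa using this
    · rw [uIoc_of_le zero_le_one] at hq
      rw [norm_mul]
      exact mul_le_mul (hM n q) (hD (s, q) ⟨hsub hs, Ioc_subset_Icc_self hq⟩) (norm_nonneg _) hM0

/-- Weak formulation for `heatSol`. -/
theorem bulkTerm_heatSol (S : ModeSystem σ κ lam e de) {g : ℝ → ℝ} (hg : MemLp g 2 unitMeas)
    {p r : ℝ} (hc : ∀ n, ∫ q in (0 : ℝ)..1, (g q - (p * q + r)) * e n q = c n) {T : ℝ}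
    {G Gs Gq Gqq : ℝ → ℝ → ℝ} (hG : IsC12 T G Gs Gq Gqq) {t : ℝ} (ht : t ∈ Ioc 0 T) {B : ℝ}
    (hB : ∀ n, ∀ s ∈ Icc 0 t, |bdTerm (e n) (de n) G Gq s| ≤ B) {b : ℝ → ℝ}
    (hb : ∀ s ∈ Ioc 0 t, HasSum (fun n => decay lam c s n * bdTerm (e n) (de n) G Gq s) (b s))
    {ρ : ℝ → ℝ → ℝ}
    (hρ : ∀ s ∈ Ioc 0 T, ∀ q ∈ Icc (0 : ℝ) 1, ρ s q = heatSol lam e c p r s q) :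
    bulkTerm g ρ G Gs Gqq t
      = 1 / 2 * ∫ s in (0 : ℝ)..t, (bdTerm (fun q => p * q + r) (fun _ => p) G Gq s + b s) := by
  have haff : Continuous fun q : ℝ => p * q + r := by fun_prop
  have hd : ∀ q, HasDerivAt (fun q : ℝ => p * q + r) p q := fun q => by
    simpa using ((hasDerivAt_id q).const_mul p).add_const r
  have hf : MemLp (fun q => g q - (p * q + r)) 2 unitMeas :=
    hg.sub haff.continuousOn.memLp_unitMeas
  obtain ⟨K, hK0, hK⟩ := S.exists_coeff_bound hf
  simp only [hc] at hK
  have ht' := Ioc_subset_Icc_self ht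
  have hT : 0 ≤ T := ht'.1.trans ht'.2
  have hsub : Icc 0 t ⊆ Icc 0 T := Icc_subset_Icc_right ht.2
  have hu : uIcc (0 : ℝ) 1 = Icc 0 1 := uIcc_of_le zero_le_one
  have hut : uIcc (0 : ℝ) t = Icc 0 t := uIcc_of_le ht.1.le
  have h0 : (0 : ℝ) ∈ Icc 0 T := ⟨le_rfl, hT⟩
  obtain ⟨i1, i2, w⟩ := S.weak_modeSeries hf hc hG ht hB hb
  -- The affine profile is a stationary mode with eigenvalue 0.
  have w0 := hG.weak_mode (l := 0) hd (fun q => by simpa using hasDerivAt_const q p) ht'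
  simp only [zero_div, neg_zero, zero_mul, Real.exp_zero, one_mul] at w0
  have split : ∀ s ∈ Ioc 0 T, ∀ φ : ℝ → ℝ, ContinuousOn φ (Icc 0 1) →
      ∫ q in (0 : ℝ)..1, ρ s q * φ q = (∫ q in (0 : ℝ)..1, (p * q + r) * φ q)
        + ∫ q in (0 : ℝ)..1, modeSeries e (decay lam c s) q * φ q := fun s hs φ hφ => by
    have cm := S.continuous_modeSeries (S.summable_abs_decay hK hs.1)
    rw [← intervalIntegral.integral_add]
    · refine intervalIntegral.integral_congr fun q hq => ?_
      simp only [hρ s hs q (hu ▸ hq), heatSol]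
      ring
    · exact ContinuousOn.intervalIntegrable (by rw [hu]; fun_prop)
    · exact ContinuousOn.intervalIntegrable (by rw [hu]; fun_prop)
  have e1 := split t ht (G t) (hG.continuousOn_space ht').1
  have e2 : ∫ q in (0 : ℝ)..1, g q * G 0 q = (∫ q in (0 : ℝ)..1, (p * q + r) * G 0 q)
      + ∫ q in (0 : ℝ)..1, (g q - (p * q + r)) * G 0 q := by
    have c0 := (hG.continuousOn_space h0).1
    rw [← intervalIntegral.integral_add]
    · refine intervalIntegral.integral_congr fun q hq => ?_
      ring
    · exact ContinuousOn.intervalIntegrable (by rw [hu]; fun_prop)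
    · exact hf.intervalIntegrable_unit.mul_continuousOn (by rw [hu]; exact c0)
  have e3 : (∫ s in (0 : ℝ)..t, ∫ q in (0 : ℝ)..1, ρ s q * (1 / 2 * Gqq s q + Gs s q))
      = (∫ s in (0 : ℝ)..t, ∫ q in (0 : ℝ)..1, (p * q + r) * (1 / 2 * Gqq s q + Gs s q))
        + ∫ s in (0 : ℝ)..t, ∫ q in (0 : ℝ)..1,
            modeSeries e (decay lam c s) q * (1 / 2 * Gqq s q + Gs s q) := by
    rw [← intervalIntegral.integral_add _ i1]
    · refine intervalIntegral.integral_congr_ae (Eventually.of_forall fun s hs => ?_)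
      rw [uIoc_of_le ht.1.le] at hs
      obtain ⟨_, _, c2, c3⟩ := hG.continuousOn_space (hsub (Ioc_subset_Icc_self hs))
      exact split s ⟨hs.1, hs.2.trans ht.2⟩ _ (by fun_prop)
    · refine ContinuousOn.intervalIntegrable ?_
      rw [hut]
      exact (hG.continuousOn_integral hT haff).mono hsub
  have e4 : (∫ s in (0 : ℝ)..t, (bdTerm (fun q => p * q + r) (fun _ => p) G Gq s + b s))
      = (∫ s in (0 : ℝ)..t, bdTerm (fun q => p * q + r) (fun _ => p) G Gq s)
        + ∫ s in (0 : ℝ)..t, b s := by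
    refine intervalIntegral.integral_add (ContinuousOn.intervalIntegrable ?_) i2
    rw [hut]
    exact hG.continuousOn_bdTerm.mono hsub
  unfold bulkTerm
  rw [e1, e2, e3, e4]
  linarith

end ModeSystem


/-! ### Profiles, traces and test functions -/

section Trace

variable {T : ℝ} {ρ u : ℝ → ℝ → ℝ}

theorem memLp_of_mem_Icc {f : ℝ → ℝ} (hf : AEMeasurable f unitMeas)
    (h : ∀ q ∈ Icc (0 : ℝ) 1, f q ∈ Icc (0 : ℝ) 1) : MemLp f 2 unitMeas :=
  MemLp.of_bound hf.aestronglyMeasurable 1 (ae_restrict_of_forall_mem measurableSet_Icc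
    fun q hq => abs_le.2 ⟨by linarith [(h q hq).1], (h q hq).2⟩)

theorem IsProfile.memLp (hp : IsProfile T ρ) {t : ℝ} (ht : t ∈ Icc 0 T) :
    MemLp (ρ t) 2 unitMeas :=
  memLp_of_mem_Icc (hp.meas t ht) (hp.mem t ht)

/-- The continuous version of a profile takes values in `[0,1]`. -/
theorem IsL2H1.mem_Icc (h : IsL2H1 T ρ u) (hp : IsProfile T ρ) :
    ∀ᵐ s ∂volume.restrict (Icc (0 : ℝ) T), ∀ q ∈ Icc (0 : ℝ) 1, u s q ∈ Icc (0 : ℝ) 1 := by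
  filter_upwards [h.ae_eq, h.cont, ae_restrict_mem measurableSet_Icc] with s h1 h2 hs
  -- The truncation of `u s` to `[0,1]` equals `u s` almost everywhere; both being continuous, they
  -- agree everywhere, endpoints included.
  have hc : ContinuousOn (fun q => max 0 (min 1 (u s q))) (Icc 0 1) :=
    continuousOn_const.sup (continuousOn_const.inf h2)
  have he : u s =ᵐ[volume.restrict (Icc (0 : ℝ) 1)] fun q => max 0 (min 1 (u s q)) := by
    filter_upwards [h1, ae_restrict_mem measurableSet_Icc] with q hq hq1
    have := hp.mem s hs q hq1
    rw [hq] at this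
    rw [min_eq_right this.2, max_eq_right this.1]
  intro q hq
  have := Measure.eqOn_Icc_of_ae_eq volume zero_ne_one he h2 hc hq
  rw [this]
  exact ⟨le_max_left _ _, max_le zero_le_one (min_le_left _ _)⟩

/-- Joint measurability up to null sets says nothing about the single line `q = x`. The trace is
instead the limit of weighted averages in `q`, measurable in `s` by Fubini, with weights `(1 - |q -
x|/2)^n` that peak only at `x`. -/
theorem IsL2H1.aestronglyMeasurable_trace (h : IsL2H1 T ρ u) {x : ℝ} (hx : x ∈ Icc (0 : ℝ) 1) :
    AEStronglyMeasurable (fun s => u s x) (volume.restrict (Icc (0 : ℝ) T)) := by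
  have hw : Continuous fun q : ℝ => 1 - |q - x| / 2 := by fun_prop
  refine aestronglyMeasurable_of_tendsto_ae atTop
    (f := fun (n : ℕ) s => (∫ q in Icc (0 : ℝ) 1, (1 - |q - x| / 2) ^ n)⁻¹ •
      ∫ q in Icc (0 : ℝ) 1, (1 - |q - x| / 2) ^ n • u s q) (fun n => ?_) ?_
  · have hm : AEStronglyMeasurable (fun p : ℝ × ℝ => (1 - |p.2 - x| / 2) ^ n • u p.1 p.2)
        (spaceTime T) :=
      ((hw.comp continuous_snd).pow n).aestronglyMeasurable.smul h.memLp.1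
    have hm' : AEStronglyMeasurable (fun s => ∫ q in Icc (0 : ℝ) 1, (1 - |q - x| / 2) ^ n • u s q)
        (volume.restrict (Icc (0 : ℝ) T)) := hm.integral_prod_right'
    exact hm'.const_mul _
  · filter_upwards [h.cont] with s hs
    refine tendsto_setIntegral_pow_smul_of_unique_maximum_of_isCompact_of_continuousOn
      isCompact_Icc hw.continuousOn (fun y _ hne => ?_) (fun y hy => ?_) (by simp) ?_ hs
    · have := abs_pos.2 (sub_ne_zero.2 hne)
      simp only [sub_self, abs_zero, zero_div, sub_zero]
      linarith
    · have : |y - x| ≤ 1 := abs_le.2 ⟨by linarith [hy.1, hx.2], by linarith [hy.2, hx.1]⟩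
      linarith
    · rwa [interior_Icc, closure_Ioo zero_ne_one]

theorem IsL2H1.intervalIntegrable_trace (h : IsL2H1 T ρ u) (hp : IsProfile T ρ) {x : ℝ}
    (hx : x ∈ Icc (0 : ℝ) 1) {t : ℝ} (ht : t ∈ Icc 0 T) :
    IntervalIntegrable (fun s => u s x) volume 0 t := by
  rw [intervalIntegrable_iff_integrableOn_Icc_of_le ht.1]
  have hi : IntegrableOn (fun s => u s x) (Icc 0 T) := by
    refine (memLp_top_of_bound (h.aestronglyMeasurable_trace hx) 1 ?_).integrable le_top
    filter_upwards [h.mem_Icc hp] with s hs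
    exact abs_le.2 ⟨by linarith [(hs x hx).1], (hs x hx).2⟩
  exact hi.mono_set (Icc_subset_Icc_right ht.2)

end Trace

section Test

variable {T l : ℝ} {h dh ddh : ℝ → ℝ}

theorem isC12_exp_mul (h1 : ∀ q, HasDerivAt h (dh q) q) (h2 : ∀ q, HasDerivAt dh (ddh q) q)
    (h3 : Continuous ddh) :
    IsC12 T (fun s q => Real.exp (l / 2 * s) * h q)
      (fun s q => l / 2 * (Real.exp (l / 2 * s) * h q))
      (fun s q => Real.exp (l / 2 * s) * dh q) (fun s q => Real.exp (l / 2 * s) * ddh q) := by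
  have ch : Continuous h := continuous_iff_continuousAt.2 fun q => (h1 q).continuousAt
  have cdh : Continuous dh := continuous_iff_continuousAt.2 fun q => (h2 q).continuousAt
  refine ⟨fun s _ q _ => ?_, fun s _ q _ => ?_, fun s _ q _ => ?_, ?_, ?_, ?_, ?_⟩
  · have h1 : HasDerivAt (fun x : ℝ => l / 2 * x) (l / 2) s := by
      simpa using (hasDerivAt_id s).const_mul (l / 2)
    refine ((h1.exp.mul_const (h q)).congr_deriv ?_).hasDerivWithinAt
    ring
  · exact ((h1 q).const_mul _).hasDerivWithinAt
  · exact ((h2 q).const_mul _).hasDerivWithinAt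
  all_goals exact Continuous.continuousOn (by fun_prop)

theorem bulkTerm_exp_mul {g : ℝ → ℝ} {ρ : ℝ → ℝ → ℝ} (t : ℝ) :
    bulkTerm g ρ (fun s q => Real.exp (l / 2 * s) * h q)
      (fun s q => l / 2 * (Real.exp (l / 2 * s) * h q)) (fun s q => Real.exp (l / 2 * s) * ddh q) t
      = Real.exp (l / 2 * t) * (∫ q in (0 : ℝ)..1, ρ t q * h q) - (∫ q in (0 : ℝ)..1, g q * h q)
        - ∫ s in (0 : ℝ)..t, Real.exp (l / 2 * s)
            * ∫ q in (0 : ℝ)..1, ρ s q * (1 / 2 * ddh q + l / 2 * h q) := by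
  unfold bulkTerm
  simp only [← intervalIntegral.integral_const_mul, mul_zero, Real.exp_zero, one_mul]
  congr 1
  · congr 1
    exact intervalIntegral.integral_congr fun q _ => by ring
  · refine intervalIntegral.integral_congr fun s _ => ?_
    exact intervalIntegral.integral_congr fun q _ => by ring

end Test

/-! ### Coefficients forced by the weak formulations -/

namespace ModeSystem

variable {σ κ : ℝ} {lam : ℕ → ℝ} {e de : ℕ → ℝ → ℝ} {T : ℝ}

theorem isC12_test (S : ModeSystem σ κ lam e de) (n : ℕ) :
    IsC12 T (fun s q => Real.exp (lam n / 2 * s) * e n q)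
      (fun s q => lam n / 2 * (Real.exp (lam n / 2 * s) * e n q))
      (fun s q => Real.exp (lam n / 2 * s) * de n q)
      (fun s q => Real.exp (lam n / 2 * s) * (-lam n * e n q)) :=
  isC12_exp_mul (S.deriv n) (S.deriv2 n) (continuous_const.mul (S.continuous n))

/-- The test function solves the backward equation `∂_s G + ½ ΔG = 0`, so the space-time integral
disappears. -/
theorem bulkTerm_test {g : ℝ → ℝ} {ρ : ℝ → ℝ → ℝ} (n : ℕ) (t : ℝ) :
    bulkTerm g ρ (fun s q => Real.exp (lam n / 2 * s) * e n q)
      (fun s q => lam n / 2 * (Real.exp (lam n / 2 * s) * e n q))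
      (fun s q => Real.exp (lam n / 2 * s) * (-lam n * e n q)) t
      = Real.exp (lam n / 2 * t) * (∫ q in (0 : ℝ)..1, ρ t q * e n q)
        - ∫ q in (0 : ℝ)..1, g q * e n q := by
  rw [bulkTerm_exp_mul]
  have : ∀ q, 1 / 2 * (-lam n * e n q) + lam n / 2 * e n q = 0 := fun q => by ring
  simp only [this, mul_zero, intervalIntegral.integral_zero, sub_zero]

/-- Here `d` stands for the value that a weak formulation forces on the coefficients; it may come
from different formulations for the two profiles. -/
theorem agreeAE (S : ModeSystem σ κ lam e de) {ρ ρ' : ℝ → ℝ → ℝ} (hp : IsProfile T ρ)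
    (hp' : IsProfile T ρ') {d : ℝ → ℕ → ℝ}
    (h : ∀ t ∈ Icc 0 T, ∀ n, Real.exp (lam n / 2 * t) * (∫ q in (0 : ℝ)..1, ρ t q * e n q) = d t n)
    (h' : ∀ t ∈ Icc 0 T, ∀ n,
      Real.exp (lam n / 2 * t) * (∫ q in (0 : ℝ)..1, ρ' t q * e n q) = d t n) :
    AgreeAE T ρ' ρ := fun t ht =>
  S.ae_eq_of_coeff_eq (hp'.memLp ht) (hp.memLp ht) fun n =>
    mul_left_cancel₀ (Real.exp_pos _).ne' ((h' t ht n).trans (h t ht n).symm)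

/-- For `σ = 0` the modes vanish at both ends, hence are admissible tests. -/
theorem coeff_of_isWeakDirichlet (S : ModeSystem 0 κ lam e de) {α β : ℝ} {g : ℝ → ℝ}
    {ρ : ℝ → ℝ → ℝ} (hρ : IsWeakDirichlet T α β g ρ) {t : ℝ} (ht : t ∈ Icc 0 T) (n : ℕ) :
    Real.exp (lam n / 2 * t) * (∫ q in (0 : ℝ)..1, ρ t q * e n q)
      = (∫ q in (0 : ℝ)..1, g q * e n q) - ∫ s in (0 : ℝ)..t,
        (β / 2 * (Real.exp (lam n / 2 * s) * de n 1) - α / 2 * (Real.exp (lam n / 2 * s) * de n 0))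
      := by
  obtain ⟨b0, b1⟩ := S.bc n
  have e0 : e n 0 = 0 := by simpa [S.hκ.ne'] using b0.symm
  have e1 : e n 1 = 0 := by simpa [S.hκ.ne'] using b1.symm
  have := hρ.2.2 t ht _ _ _ _ (S.isC12_test n) fun s _ => ⟨by simp [e0], by simp [e1]⟩
  rw [bulkTerm_test] at this
  linarith

/-- With `e' = ± κ e` at the ends, the unknown traces of `u` in the two boundary integrals cancel.
The integrability of the traces is what allows the integrals to be separated. -/
theorem coeff_of_isWeakRobin (S : ModeSystem 1 κ lam e de) {α β : ℝ} {g : ℝ → ℝ}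
    {ρ : ℝ → ℝ → ℝ} (hρ : IsWeakRobin T κ α β g ρ) {t : ℝ} (ht : t ∈ Icc 0 T) (n : ℕ) :
    Real.exp (lam n / 2 * t) * (∫ q in (0 : ℝ)..1, ρ t q * e n q)
      = (∫ q in (0 : ℝ)..1, g q * e n q) + κ / 2 * ∫ s in (0 : ℝ)..t,
        Real.exp (lam n / 2 * s) * (α * e n 0 + β * e n 1) := by
  obtain ⟨hp, u, hu, hw⟩ := hρ
  obtain ⟨b0, b1⟩ := S.bc n
  rw [one_mul] at b0 b1
  have := hw t ht _ _ _ _ (S.isC12_test n)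
  rw [bulkTerm_test] at this
  have i0 := hu.intervalIntegrable_trace hp (left_mem_Icc.2 zero_le_one) ht
  have i1 := hu.intervalIntegrable_trace hp (right_mem_Icc.2 zero_le_one) ht
  have hE : Continuous fun s => Real.exp (lam n / 2 * s) := by fun_prop
  have j0 := i0.mul_continuousOn (g := fun s => Real.exp (lam n / 2 * s) * e n 0)
    (hE.mul continuous_const).continuousOn
  have j1 := i1.mul_continuousOn (g := fun s => Real.exp (lam n / 2 * s) * e n 1)
    (hE.mul continuous_const).continuousOn
  have k1 : (∫ s in (0 : ℝ)..t, (u s 1 * (Real.exp (lam n / 2 * s) * de n 1)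
      - u s 0 * (Real.exp (lam n / 2 * s) * de n 0)))
      = -κ * ∫ s in (0 : ℝ)..t, (u s 1 * (Real.exp (lam n / 2 * s) * e n 1)
        + u s 0 * (Real.exp (lam n / 2 * s) * e n 0)) := by
    rw [← intervalIntegral.integral_const_mul]
    refine intervalIntegral.integral_congr fun s _ => ?_
    simp only [b0, b1]
    ring
  have k2 : (∫ s in (0 : ℝ)..t, (Real.exp (lam n / 2 * s) * e n 0 * (α - u s 0)
      + Real.exp (lam n / 2 * s) * e n 1 * (β - u s 1)))
      = (∫ s in (0 : ℝ)..t, Real.exp (lam n / 2 * s) * (α * e n 0 + β * e n 1))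
        - ∫ s in (0 : ℝ)..t, (u s 1 * (Real.exp (lam n / 2 * s) * e n 1)
          + u s 0 * (Real.exp (lam n / 2 * s) * e n 0)) := by
    have j2 : IntervalIntegrable (fun s => Real.exp (lam n / 2 * s) * (α * e n 0 + β * e n 1))
      volume 0 t := (hE.mul continuous_const).intervalIntegrable _ _
    rw [← intervalIntegral.integral_sub j2 (j1.add j0)]
    exact intervalIntegral.integral_congr fun s _ => by ring
  rw [k1, k2] at this
  linear_combination this

end ModeSystem

/-! ### Existence -/

/-- Used to pass from the normalised modes `√2 sin` to sine coefficients paired with `2 sin`. -/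
theorem HasExpansion.congr {T : ℝ} {g ρbar : ℝ → ℝ} {c c' μ : ℕ → ℝ} {e e' : ℕ → ℝ → ℝ}
    {ρ : ℝ → ℝ → ℝ} (h : HasExpansion T g ρbar c μ e ρ) (hce : ∀ n q, c n * e n q = c' n * e' n q) :
    HasExpansion T g ρbar c' μ e' ρ := by
  refine ⟨fun t ht q hq => ?_, h.2.1, ?_⟩
  · refine (h.1 t ht q hq).congr_fun fun n => ?_
    rw [mul_right_comm, ← hce, mul_right_comm]
  · simpa only [hce] using h.2.2

namespace ModeSystem

variable {σ κ : ℝ} {lam : ℕ → ℝ} {e de : ℕ → ℝ → ℝ} {c : ℕ → ℝ} {T p r : ℝ} {g : ℝ → ℝ}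

/-- `heatSol` at positive times, the initial condition at time `0`. -/
noncomputable def solution (_ : ModeSystem σ κ lam e de) (c : ℕ → ℝ) (p r : ℝ) (g : ℝ → ℝ)
    (t q : ℝ) : ℝ :=
  if t ≤ 0 then g q else heatSol lam e c p r t q

theorem solution_of_pos (S : ModeSystem σ κ lam e de) :
    ∀ s ∈ Ioc 0 T, ∀ q ∈ Icc (0 : ℝ) 1, S.solution c p r g s q = heatSol lam e c p r s q :=
  fun _ hs _ _ => if_neg (not_le.2 hs.1)

theorem solution_zero (S : ModeSystem σ κ lam e de) : S.solution c p r g 0 = g :=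
  funext fun _ => if_pos le_rfl

/-- Comparison of `g - (p q + r)` with the affine functions `-(p q + r)` and `1 - (p q + r)`. The
four inequalities say that these are a subsolution and a supersolution for the homogeneous boundary
conditions. -/
theorem solution_mem_Icc (S : ModeSystem σ κ lam e de) (hg : MemLp g 2 unitMeas)
    (hg01 : ∀ q ∈ Icc (0 : ℝ) 1, g q ∈ Icc (0 : ℝ) 1)
    (hc : ∀ n, ∫ q in (0 : ℝ)..1, (g q - (p * q + r)) * e n q = c n)
    (h0 : σ * p ≤ κ * r) (h1 : 0 ≤ κ * (p + r) + σ * p)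
    (h2 : -(σ * p) ≤ κ * (1 - r)) (h3 : σ * p ≤ κ * (1 - (p + r))) :
    ∀ s ∈ Ioc 0 T, ∀ q ∈ Icc (0 : ℝ) 1, S.solution c p r g s q ∈ Icc (0 : ℝ) 1 := by
  intro s hs q hq
  have hf : MemLp (fun q => g q - (p * q + r)) 2 unitMeas :=
    hg.sub (ContinuousOn.memLp_unitMeas (by fun_prop))
  rw [S.solution_of_pos s hs q hq, heatSol]
  have a := S.le_modeSeries_decay (p := -p) (r := -r) hf (by linarith) (by linarith)
    (fun q hq => by linarith [(hg01 q hq).1]) hc hs.1 hq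
  have b := S.modeSeries_decay_le (p := -p) (r := 1 - r) hf (by linarith) (by linarith)
    (fun q hq => by linarith [(hg01 q hq).2]) hc hs.1 hq
  exact ⟨by linarith, by linarith⟩

theorem summable_coeff_solution (S : ModeSystem σ κ lam e de) (hg : MemLp g 2 unitMeas)
    (hc : ∀ n, ∫ q in (0 : ℝ)..1, (g q - (p * q + r)) * e n q = c n) :
    Summable fun n => c n ^ 2 := by
  have hf : MemLp (fun q => g q - (p * q + r)) 2 unitMeas :=
    hg.sub (ContinuousOn.memLp_unitMeas (by fun_prop))
  simpa only [hc] using S.summable_coeff_sq hf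

theorem abs_coeff_le {c : ℕ → ℝ} (h : Summable fun n => c n ^ 2) (n : ℕ) :
    |c n| ≤ √(∑' n, c n ^ 2) :=
  Real.abs_le_sqrt (h.le_tsum n fun _ _ => sq_nonneg _)

theorem hasExpansion_solution (S : ModeSystem σ κ lam e de) (hg : MemLp g 2 unitMeas)
    (hc : ∀ n, ∫ q in (0 : ℝ)..1, (g q - (p * q + r)) * e n q = c n) :
    HasExpansion T g (fun q => p * q + r) c lam e (S.solution c p r g) := by
  have hf : MemLp (fun q => g q - (p * q + r)) 2 unitMeas :=
    hg.sub (ContinuousOn.memLp_unitMeas (by fun_prop))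
  have hK := abs_coeff_le (S.summable_coeff_solution hg hc)
  refine ⟨fun t ht q hq => ?_, fun q _ => by rw [S.solution_zero], ?_⟩
  · rw [S.solution_of_pos t ht q hq, heatSol, add_sub_cancel_left]
    exact (S.summable_modeSeries (S.summable_abs_decay hK ht.1) q).hasSum
  · rw [S.solution_zero]
    simpa only [hc] using S.tendsto_partialSum hf

theorem isProfile_solution (S : ModeSystem σ κ lam e de)
    (hg : AEMeasurable g unitMeas) (hg01 : ∀ q ∈ Icc (0 : ℝ) 1, g q ∈ Icc (0 : ℝ) 1)
    (hc2 : Summable fun n => c n ^ 2)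
    (h : ∀ s ∈ Ioc 0 T, ∀ q ∈ Icc (0 : ℝ) 1, S.solution c p r g s q ∈ Icc (0 : ℝ) 1) :
    IsProfile T (S.solution c p r g) := by
  constructor
  · intro t ht
    rcases ht.1.eq_or_lt with rfl | h0
    · rwa [S.solution_zero]
    · exact h t ⟨h0, ht.2⟩
  · intro t ht
    rcases ht.1.eq_or_lt with rfl | h0
    · rwa [S.solution_zero]
    · have hs := S.continuous_modeSeries (S.summable_abs_decay (abs_coeff_le hc2) h0)
      have : Continuous (heatSol lam e c p r t) := by unfold heatSol; fun_prop
      refine this.aemeasurable.congr (ae_restrict_of_forall_mem measurableSet_Icc fun q hq => ?_)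
      exact (S.solution_of_pos t ⟨h0, ht.2⟩ q hq).symm

theorem bulkTerm_zero {g : ℝ → ℝ} {ρ G Gs Gqq : ℝ → ℝ → ℝ} (h : ρ 0 = g) :
    bulkTerm g ρ G Gs Gqq 0 = 0 := by
  simp [bulkTerm, h]

end ModeSystem


/-! ### Test functions with compact support -/

/-- A `C²` cutoff: `1` on `(-∞, 1/2]`, `0` on `[1, ∞)`. -/
structure IsCutoff (a da dda : ℝ → ℝ) (D : ℝ) : Prop where
  deriv : ∀ x, HasDerivAt a (da x) x
  deriv2 : ∀ x, HasDerivAt da (dda x) x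
  cont : Continuous dda
  one : ∀ x ≤ 1 / 2, a x = 1
  zero : ∀ x, 1 ≤ x → a x = 0 ∧ da x = 0 ∧ dda x = 0
  abs_le : ∀ x, |a x| ≤ 1
  bound : ∀ x ∈ Icc (0 : ℝ) 1, |da x| ≤ D ∧ |dda x| ≤ D

theorem exists_isCutoff : ∃ a da dda D, IsCutoff a da dda D := by
  set a : ℝ → ℝ := fun x => Real.smoothTransition (2 - 2 * x) with ha
  have hs : ContDiff ℝ ∞ a :=
    Real.smoothTransition.contDiff.comp (contDiff_const.sub (contDiff_const.mul contDiff_id))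
  have hd : ContDiff ℝ ∞ (_root_.deriv a) := ((contDiff_infty_iff_deriv (𝕜 := ℝ)).1 hs).2
  have hdd : ContDiff ℝ ∞ (_root_.deriv (_root_.deriv a)) :=
    ((contDiff_infty_iff_deriv (𝕜 := ℝ)).1 hd).2
  have hne : (∞ : WithTop ℕ∞) ≠ 0 := by simp
  obtain ⟨D1, h1⟩ := isCompact_Icc.exists_bound_of_continuousOn
    (hd.continuous.continuousOn (s := Icc (0 : ℝ) 1))
  obtain ⟨D2, h2⟩ := isCompact_Icc.exists_bound_of_continuousOn
    (hdd.continuous.continuousOn (s := Icc (0 : ℝ) 1))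
  have hz : ∀ x, 1 ≤ x → a x = 0 := fun x hx =>
    Real.smoothTransition.zero_of_nonpos (by linarith)
  -- The point `x = 1` is included: there the derivative is determined from the right, where `f`
  -- vanishes.
  have z : ∀ f : ℝ → ℝ, Differentiable ℝ f → Continuous (_root_.deriv f) →
      (∀ x, 1 ≤ x → f x = 0) → ∀ x, 1 ≤ x → _root_.deriv f x = 0 := by
    intro f hf hc h0 x hx
    have hx1 : UniqueDiffWithinAt ℝ (Ici (1 : ℝ)) x := uniqueDiffOn_Ici 1 x hx
    have a1 := (hf x).hasDerivAt.hasDerivWithinAt (s := Ici (1 : ℝ))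
    have a2 : HasDerivWithinAt f 0 (Ici (1 : ℝ)) x :=
      (hasDerivWithinAt_const x (Ici (1 : ℝ)) (0 : ℝ)).congr (fun y hy => h0 y hy) (h0 x hx)
    exact hx1.eq_deriv _ a1 a2
  have dz := z a (hs.differentiable hne) hd.continuous hz
  have ddz := z _ (hd.differentiable hne) hdd.continuous dz
  refine ⟨a, _, _, max D1 D2, fun x => (hs.differentiable hne x).hasDerivAt,
    fun x => (hd.differentiable hne x).hasDerivAt, hdd.continuous,
    fun x hx => Real.smoothTransition.one_of_one_le (by linarith),
    fun x hx => ⟨hz x hx, dz x hx, ddz x hx⟩, fun x => ?_,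
    fun x hx => ⟨(h1 x hx).trans (le_max_left _ _), (h2 x hx).trans (le_max_right _ _)⟩⟩
  rw [abs_of_nonneg (Real.smoothTransition.nonneg _)]
  exact Real.smoothTransition.le_one _

section Layer

variable {a da dda φ dφ ddφ : ℝ → ℝ} {D P Q k : ℝ}

/-- The second derivative of `q ↦ φ q * a (k q)`. -/
def layer (a da dda φ dφ ddφ : ℝ → ℝ) (k q : ℝ) : ℝ :=
  ddφ q * a (k * q) + 2 * k * (dφ q * da (k * q)) + k ^ 2 * (φ q * dda (k * q))

/-- The first derivative of `q ↦ φ q * a (k q)`. -/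
def layerPrim (a da φ dφ : ℝ → ℝ) (k q : ℝ) : ℝ :=
  dφ q * a (k * q) + k * (φ q * da (k * q))

theorem IsCutoff.hasDerivAt_mul (ha : IsCutoff a da dda D) (h1 : ∀ q, HasDerivAt φ (dφ q) q)
    (q : ℝ) : HasDerivAt (fun q => φ q * a (k * q)) (layerPrim a da φ dφ k q) q := by
  have hl : HasDerivAt (fun x : ℝ => k * x) k q := by simpa using (hasDerivAt_id q).const_mul k
  refine ((h1 q).mul ((ha.deriv (k * q)).comp q hl)).congr_deriv ?_
  simp only [layerPrim, Function.comp]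
  ring

theorem IsCutoff.hasDerivAt_layerPrim (ha : IsCutoff a da dda D)
    (h1 : ∀ q, HasDerivAt φ (dφ q) q) (h2 : ∀ q, HasDerivAt dφ (ddφ q) q) (q : ℝ) :
    HasDerivAt (layerPrim a da φ dφ k) (layer a da dda φ dφ ddφ k q) q := by
  have hl : HasDerivAt (fun x : ℝ => k * x) k q := by simpa using (hasDerivAt_id q).const_mul k
  refine (((h2 q).mul ((ha.deriv (k * q)).comp q hl)).add
    (((h1 q).mul ((ha.deriv2 (k * q)).comp q hl)).const_mul k)).congr_deriv ?_
  simp only [layer, Function.comp]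
  ring

theorem IsCutoff.continuous_layer (ha : IsCutoff a da dda D)
    (h1 : ∀ q, HasDerivAt φ (dφ q) q) (h2 : ∀ q, HasDerivAt dφ (ddφ q) q) (h3 : Continuous ddφ) :
    Continuous (layer a da dda φ dφ ddφ k) := by
  have c1 : Continuous φ := continuous_iff_continuousAt.2 fun q => (h1 q).continuousAt
  have c2 : Continuous dφ := continuous_iff_continuousAt.2 fun q => (h2 q).continuousAt
  have c3 : Continuous a := continuous_iff_continuousAt.2 fun q => (ha.deriv q).continuousAt
  have c4 : Continuous da := continuous_iff_continuousAt.2 fun q => (ha.deriv2 q).continuousAt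
  have c5 := ha.cont
  unfold layer
  fun_prop

/-- Because `φ 0 = 0`, one has `|φ| ≤ P/k` on the layer, so even the term with `k²` is of order `k`.
On a layer of width `1/k` this leaves a bounded integral. -/
theorem IsCutoff.abs_layer_le (ha : IsCutoff a da dda D) (h1 : ∀ q, HasDerivAt φ (dφ q) q)
    (h0 : φ 0 = 0) (hP : ∀ q, |dφ q| ≤ P) (hQ : ∀ q, |ddφ q| ≤ Q) (hk : 1 ≤ k) {q : ℝ}
    (hq : q ∈ Icc 0 (1 / k)) : |layer a da dda φ dφ ddφ k q| ≤ (Q + 3 * (P * D)) * k := by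
  have hk0 : 0 < k := by linarith
  have hP0 : 0 ≤ P := (abs_nonneg _).trans (hP 0)
  have hQ0 : 0 ≤ Q := (abs_nonneg _).trans (hQ 0)
  have hkq : k * q ∈ Icc (0 : ℝ) 1 :=
    ⟨mul_nonneg hk0.le hq.1, by have := hq.2; rwa [le_div_iff₀ hk0, mul_comm] at this⟩
  obtain ⟨b1, b2⟩ := ha.bound _ hkq
  have hφ : |φ q| ≤ P * (1 / k) := by
    have := Convex.norm_image_sub_le_of_norm_hasDerivWithin_le (f := φ) (f' := dφ) (s := univ)
      (C := P) (x := 0) (y := q) (fun x _ => (h1 x).hasDerivWithinAt) (fun x _ => hP x) convex_univ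
      trivial trivial
    rw [h0, sub_zero, sub_zero, Real.norm_eq_abs, Real.norm_eq_abs, abs_of_nonneg hq.1] at this
    exact this.trans (mul_le_mul_of_nonneg_left hq.2 hP0)
  have t1 : |ddφ q * a (k * q)| ≤ Q * 1 := by
    rw [abs_mul]; exact mul_le_mul (hQ q) (ha.abs_le _) (abs_nonneg _) hQ0
  have t2 : |2 * k * (dφ q * da (k * q))| ≤ 2 * k * (P * D) := by
    rw [abs_mul, abs_mul (dφ q), abs_of_pos (by positivity : 0 < 2 * k)]
    gcongr
    exact hP q
  have t3 : |k ^ 2 * (φ q * dda (k * q))| ≤ k ^ 2 * (P * (1 / k) * D) := by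
    rw [abs_mul, abs_mul (φ q), abs_of_pos (by positivity : 0 < k ^ 2)]
    gcongr
  have e3 : k ^ 2 * (P * (1 / k) * D) = k * (P * D) := by field_simp
  rw [e3] at t3
  have := abs_add_three (ddφ q * a (k * q)) (2 * k * (dφ q * da (k * q)))
    (k ^ 2 * (φ q * dda (k * q)))
  unfold layer
  nlinarith

theorem IsCutoff.abs_integral_layer_le (ha : IsCutoff a da dda D)
    (h1 : ∀ q, HasDerivAt φ (dφ q) q) (h2 : ∀ q, HasDerivAt dφ (ddφ q) q) (h3 : Continuous ddφ)
    (h0 : φ 0 = 0) (hP : ∀ q, |dφ q| ≤ P) (hQ : ∀ q, |ddφ q| ≤ Q) (hk : 1 ≤ k) {f : ℝ → ℝ}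
    (hf : ContinuousOn f (Icc 0 1)) {δ : ℝ} (hδ : ∀ q ∈ Icc 0 (1 / k), |f q| ≤ δ) :
    |∫ q in (0 : ℝ)..1, f q * layer a da dda φ dφ ddφ k q| ≤ δ * (Q + 3 * (P * D)) := by
  have hk0 : 0 < k := by linarith
  have hk1 : 1 / k ≤ 1 := by rw [div_le_one hk0]; exact hk
  have hk2 : 0 ≤ 1 / k := by positivity
  have hi : IntervalIntegrable (fun q => f q * layer a da dda φ dφ ddφ k q) volume 0 1 := by
    refine ContinuousOn.intervalIntegrable ?_
    rw [uIcc_of_le zero_le_one]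
    exact hf.mul (ha.continuous_layer h1 h2 h3).continuousOn
  have hm : 1 / k ∈ uIcc (0 : ℝ) 1 := by rw [uIcc_of_le zero_le_one]; exact ⟨hk2, hk1⟩
  rw [← intervalIntegral.integral_add_adjacent_intervals
    (hi.mono_set (uIcc_subset_uIcc left_mem_uIcc hm))
    (hi.mono_set (uIcc_subset_uIcc hm right_mem_uIcc))]
  have z : ∫ q in (1 / k)..1, f q * layer a da dda φ dφ ddφ k q = 0 := by
    refine (intervalIntegral.integral_congr (g := fun _ => 0) fun q hq => ?_).trans (by simp)
    rw [uIcc_of_le hk1] at hq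
    have : 1 ≤ k * q := by have := hq.1; rwa [div_le_iff₀ hk0, mul_comm] at this
    obtain ⟨z1, z2, z3⟩ := ha.zero _ this
    simp [layer, z1, z2, z3]
  rw [z, add_zero]
  have := intervalIntegral.norm_integral_le_of_norm_le_const (a := (0 : ℝ)) (b := 1 / k)
    (f := fun q => f q * layer a da dda φ dφ ddφ k q) (C := δ * ((Q + 3 * (P * D)) * k))
    fun q hq => by
      rw [uIoc_of_le hk2] at hq
      have hq' := Ioc_subset_Icc_self hq
      rw [norm_mul]
      exact mul_le_mul (hδ q hq') (ha.abs_layer_le h1 h0 hP hQ hk hq') (abs_nonneg _)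
        ((abs_nonneg _).trans (hδ q hq'))
  rw [sub_zero, abs_of_nonneg hk2] at this
  refine this.trans_eq ?_
  field_simp

/-- An exact derivative: the primitive vanishes at 1, beyond the cutoff, and is `φ'(0)` at 0. The
mass does not depend on `k`. -/
theorem IsCutoff.integral_layer (ha : IsCutoff a da dda D)
    (h1 : ∀ q, HasDerivAt φ (dφ q) q) (h2 : ∀ q, HasDerivAt dφ (ddφ q) q) (h3 : Continuous ddφ)
    (h0 : φ 0 = 0) (hk : 1 ≤ k) :
    ∫ q in (0 : ℝ)..1, layer a da dda φ dφ ddφ k q = -dφ 0 := by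
  rw [intervalIntegral.integral_eq_sub_of_hasDerivAt
    (fun q _ => ha.hasDerivAt_layerPrim h1 h2 q)
    ((ha.continuous_layer h1 h2 h3).intervalIntegrable _ _)]
  obtain ⟨z1, z2, _⟩ := ha.zero k hk
  simp [layerPrim, z1, z2, h0, ha.one 0 (by norm_num)]

/-- The boundary layer picks out the boundary value of a continuous function. -/
theorem IsCutoff.tendsto_integral_layer (ha : IsCutoff a da dda D)
    (h1 : ∀ q, HasDerivAt φ (dφ q) q) (h2 : ∀ q, HasDerivAt dφ (ddφ q) q) (h3 : Continuous ddφ)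
    (h0 : φ 0 = 0) (hP : ∀ q, |dφ q| ≤ P) (hQ : ∀ q, |ddφ q| ≤ Q) {w : ℝ → ℝ}
    (hw : ContinuousOn w (Icc 0 1)) :
    Tendsto (fun k => ∫ q in (0 : ℝ)..1, w q * layer a da dda φ dφ ddφ k q) atTop
      (𝓝 (-(w 0 * dφ 0))) := by
  have hD0 : 0 ≤ D := (abs_nonneg _).trans (ha.bound 0 ⟨le_rfl, zero_le_one⟩).1
  have hP0 : 0 ≤ P := (abs_nonneg _).trans (hP 0)
  have hQ0 : 0 ≤ Q := (abs_nonneg _).trans (hQ 0)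
  set C := Q + 3 * (P * D) + 1
  have hC : 0 < C := by positivity
  rw [Metric.tendsto_atTop]
  intro ε hε
  have hw0 := hw 0 ⟨le_rfl, zero_le_one⟩
  rw [Metric.continuousWithinAt_iff] at hw0
  obtain ⟨η, hη, hw0⟩ := hw0 (ε / C) (by positivity)
  refine ⟨max 1 (2 / η), fun k hk => ?_⟩
  have hk1 : 1 ≤ k := (le_max_left _ _).trans hk
  have hk0 : 0 < k := by linarith
  have hk2 : 2 / η ≤ k := (le_max_right _ _).trans hk
  have hk3 : 1 / k < η := by
    rw [div_le_iff₀ hη] at hk2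
    rw [div_lt_iff₀ hk0]
    linarith
  have hk4 : 1 / k ≤ 1 := by rw [div_le_one hk0]; exact hk1
  have cl := ha.continuous_layer (k := k) h1 h2 h3
  -- As the layer has mass exactly `-φ'(0)`, the error involves only `w - w 0`, which is small on
  -- the layer by continuity.
  have e : (∫ q in (0 : ℝ)..1, w q * layer a da dda φ dφ ddφ k q) - -(w 0 * dφ 0)
      = ∫ q in (0 : ℝ)..1, (w q - w 0) * layer a da dda φ dφ ddφ k q := by
    have := ha.integral_layer h1 h2 h3 h0 hk1
    rw [← mul_neg, ← this, ← intervalIntegral.integral_const_mul, ← intervalIntegral.integral_sub]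
    · exact intervalIntegral.integral_congr fun q _ => by ring
    · refine ContinuousOn.intervalIntegrable ?_
      rw [uIcc_of_le zero_le_one]
      exact hw.mul cl.continuousOn
    · exact (continuous_const.mul cl).intervalIntegrable _ _
  rw [Real.dist_eq, e]
  refine (ha.abs_integral_layer_le h1 h2 h3 h0 hP hQ hk1 (hw.sub continuousOn_const)
    (δ := ε / C) fun q hq => ?_).trans_lt ?_
  · refine (hw0 ⟨hq.1, hq.2.trans hk4⟩ ?_).le
    rw [Real.dist_eq, sub_zero, abs_of_nonneg hq.1]
    exact hq.2.trans_lt hk3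
  · rw [div_mul_eq_mul_div, div_lt_iff₀ hC]
    exact mul_lt_mul_of_pos_left (by simp [C]) hε

end Layer


/-! ### Cutting off at both ends -/

section CutMode

variable {a da dda φ dφ ddφ : ℝ → ℝ} {D P Q M k : ℝ}

/-- `φ` cut off near both ends of `[0,1]`. -/
def cutBoth (a φ : ℝ → ℝ) (k q : ℝ) : ℝ :=
  φ q - φ q * a (k * q) - φ q * a (k * (1 - q))

/-- The second derivative of `cutBoth`. -/
def cutBothDD (a da dda φ dφ ddφ : ℝ → ℝ) (k q : ℝ) : ℝ :=
  ddφ q - layer a da dda φ dφ ddφ k q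
    - layer a da dda (fun x => φ (1 - x)) (fun x => -dφ (1 - x)) (fun x => ddφ (1 - x)) k (1 - q)

theorem hasDerivAt_reflect {f df : ℝ → ℝ} (h : ∀ q, HasDerivAt f (df q) q) (q : ℝ) :
    HasDerivAt (fun x => f (1 - x)) (-df (1 - q)) q := by
  have hr : HasDerivAt (fun x : ℝ => 1 - x) (-1) q := by simpa using (hasDerivAt_id q).const_sub 1
  exact ((h (1 - q)).comp q hr).congr_deriv (by ring)

theorem hasDerivAt_reflect_neg {f df : ℝ → ℝ} (h : ∀ q, HasDerivAt f (df q) q) (q : ℝ) :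
    HasDerivAt (fun x => -f (1 - x)) (df (1 - q)) q :=
  (hasDerivAt_reflect h q).neg.congr_deriv (by ring)

theorem IsCutoff.hasDerivAt_cutBoth (ha : IsCutoff a da dda D)
    (h1 : ∀ q, HasDerivAt φ (dφ q) q) (h2 : ∀ q, HasDerivAt dφ (ddφ q) q) :
    ∃ dχ : ℝ → ℝ, (∀ q, HasDerivAt (cutBoth a φ k) (dχ q) q) ∧
      ∀ q, HasDerivAt dχ (cutBothDD a da dda φ dφ ddφ k q) q := by
  refine ⟨fun q => dφ q - layerPrim a da φ dφ k q
    - -layerPrim a da (fun x => φ (1 - x)) (fun x => -dφ (1 - x)) k (1 - q), fun q => ?_,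
    fun q => ?_⟩
  · have := hasDerivAt_reflect (ha.hasDerivAt_mul (k := k) (hasDerivAt_reflect h1)) q
    simp only [sub_sub_cancel] at this
    exact ((h1 q).sub (ha.hasDerivAt_mul h1 q)).sub this
  · have := hasDerivAt_reflect_neg (ha.hasDerivAt_layerPrim (k := k) (hasDerivAt_reflect h1)
      (hasDerivAt_reflect_neg h2)) q
    exact ((h2 q).sub (ha.hasDerivAt_layerPrim h1 h2 q)).sub this

theorem IsCutoff.continuous_cutBothDD (ha : IsCutoff a da dda D)
    (h1 : ∀ q, HasDerivAt φ (dφ q) q) (h2 : ∀ q, HasDerivAt dφ (ddφ q) q) (h3 : Continuous ddφ) :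
    Continuous (cutBothDD a da dda φ dφ ddφ k) := by
  have c1 := ha.continuous_layer (k := k) h1 h2 h3
  have c2 := ha.continuous_layer (k := k) (hasDerivAt_reflect h1) (hasDerivAt_reflect_neg h2)
    (h3.comp (continuous_const.sub continuous_id))
  exact (h3.sub c1).sub (c2.comp (continuous_const.sub continuous_id))

/-- For `k ≥ 2` the two layers do not interact: near one end its own cutoff is 1 and the other is 0,
so `φ` is removed exactly once. -/
theorem IsCutoff.cutBoth_eq_zero (ha : IsCutoff a da dda D) (hk : 2 ≤ k) {q : ℝ}
    (hq : q ∉ Icc (1 / (2 * k)) (1 - 1 / (2 * k))) : cutBoth a φ k q = 0 := by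
  have hk0 : 0 < k := by linarith
  have e : k * (1 / (2 * k)) = 1 / 2 := by field_simp
  rw [mem_Icc, not_and_or, not_le, not_le] at hq
  unfold cutBoth
  rcases hq with hq | hq
  · have h1 : k * q < 1 / 2 := by rw [← e]; exact mul_lt_mul_of_pos_left hq hk0
    rw [ha.one _ h1.le, (ha.zero (k * (1 - q)) (by linarith)).1]
    ring
  · have h1 : k * (1 - q) < 1 / 2 := by rw [← e]; exact mul_lt_mul_of_pos_left (by linarith) hk0
    rw [ha.one _ h1.le, (ha.zero (k * q) (by linarith)).1]
    ring

theorem IsCutoff.abs_cutBoth_le (ha : IsCutoff a da dda D) (hM : ∀ q, |φ q| ≤ M) (q : ℝ) :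
    |cutBoth a φ k q| ≤ 3 * M := by
  have h1 := ha.abs_le (k * q)
  have h2 := ha.abs_le (k * (1 - q))
  have hM0 : 0 ≤ M := (abs_nonneg _).trans (hM 0)
  have e1 : |φ q * a (k * q)| ≤ M * 1 := by
    rw [abs_mul]; exact mul_le_mul (hM q) h1 (abs_nonneg _) hM0
  have e2 : |φ q * a (k * (1 - q))| ≤ M * 1 := by
    rw [abs_mul]; exact mul_le_mul (hM q) h2 (abs_nonneg _) hM0
  unfold cutBoth
  have := abs_sub (φ q - φ q * a (k * q)) (φ q * a (k * (1 - q)))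
  have := abs_sub (φ q) (φ q * a (k * q))
  linarith [hM q]

theorem IsCutoff.tendsto_cutBoth (ha : IsCutoff a da dda D) {q : ℝ} (hq : q ∈ Ioo (0 : ℝ) 1) :
    Tendsto (fun k => cutBoth a φ k q) atTop (𝓝 (φ q)) := by
  refine tendsto_const_nhds.congr' ?_
  filter_upwards [eventually_ge_atTop (1 / q), eventually_ge_atTop (1 / (1 - q))] with k h1 h2
  have hq1 : 0 < 1 - q := by linarith [hq.2]
  rw [div_le_iff₀ hq.1] at h1
  rw [div_le_iff₀ hq1] at h2
  simp [cutBoth, (ha.zero _ h1).1, (ha.zero _ h2).1]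

theorem IsCutoff.continuous_cutBoth (ha : IsCutoff a da dda D)
    (h1 : ∀ q, HasDerivAt φ (dφ q) q) : Continuous (cutBoth a φ k) := by
  have c1 : Continuous φ := continuous_iff_continuousAt.2 fun q => (h1 q).continuousAt
  have c3 : Continuous a := continuous_iff_continuousAt.2 fun q => (ha.deriv q).continuousAt
  unfold cutBoth
  fun_prop

theorem IsCutoff.tendsto_integral_cutBoth (ha : IsCutoff a da dda D)
    (h1 : ∀ q, HasDerivAt φ (dφ q) q) (hM : ∀ q, |φ q| ≤ M) {f : ℝ → ℝ}
    (hf : IntervalIntegrable f volume 0 1) :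
    Tendsto (fun k => ∫ q in (0 : ℝ)..1, f q * cutBoth a φ k q) atTop
      (𝓝 (∫ q in (0 : ℝ)..1, f q * φ q)) := by
  simp only [intervalIntegral.integral_of_le zero_le_one, integral_Ioc_eq_integral_Ioo]
  have hf' : IntegrableOn f (Ioo 0 1) :=
    ((intervalIntegrable_iff_integrableOn_Icc_of_le zero_le_one).1 hf).mono_set Ioo_subset_Icc_self
  refine tendsto_integral_filter_of_dominated_convergence (fun q => ‖f q‖ * (3 * M))
    (Eventually.of_forall fun k => ?_) (Eventually.of_forall fun k => Eventually.of_forall fun q => ?_)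
    (hf'.norm.mul_const _) ?_
  · exact hf'.aestronglyMeasurable.mul (ha.continuous_cutBoth h1).aestronglyMeasurable
  · rw [norm_mul]
    exact mul_le_mul_of_nonneg_left (ha.abs_cutBoth_le hM q) (norm_nonneg _)
  · exact ae_restrict_of_forall_mem measurableSet_Ioo fun q hq =>
      tendsto_const_nhds.mul (ha.tendsto_cutBoth hq)

theorem integral_cutBothDD (ha : IsCutoff a da dda D)
    (h1 : ∀ q, HasDerivAt φ (dφ q) q) (h2 : ∀ q, HasDerivAt dφ (ddφ q) q) (h3 : Continuous ddφ)
    {w : ℝ → ℝ} (hw : ContinuousOn w (Icc 0 1)) :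
    ∫ q in (0 : ℝ)..1, w q * cutBothDD a da dda φ dφ ddφ k q
      = (∫ q in (0 : ℝ)..1, w q * ddφ q)
        - (∫ q in (0 : ℝ)..1, w q * layer a da dda φ dφ ddφ k q)
        - ∫ q in (0 : ℝ)..1, w (1 - q) * layer a da dda (fun x => φ (1 - x))
            (fun x => -dφ (1 - x)) (fun x => ddφ (1 - x)) k q := by
  have c1 := ha.continuous_layer (k := k) h1 h2 h3
  have c2 := ha.continuous_layer (k := k) (hasDerivAt_reflect h1) (hasDerivAt_reflect_neg h2)
    (h3.comp (continuous_const.sub continuous_id))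
  have hi : ∀ g : ℝ → ℝ, Continuous g → IntervalIntegrable (fun q => w q * g q) volume 0 1 :=
    fun g hg => ContinuousOn.intervalIntegrable (by
      rw [uIcc_of_le zero_le_one]; exact hw.mul hg.continuousOn)
  have c3 : Continuous fun q => layer a da dda (fun x => φ (1 - x)) (fun x => -dφ (1 - x))
      (fun x => ddφ (1 - x)) k (1 - q) := c2.comp (continuous_const.sub continuous_id)
  have r := intervalIntegral.integral_comp_sub_left (a := (0 : ℝ)) (b := 1)
    (fun q => w q * layer a da dda (fun x => φ (1 - x))
      (fun x => -dφ (1 - x)) (fun x => ddφ (1 - x)) k (1 - q)) 1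
  simp only [sub_sub_cancel, sub_self, sub_zero] at r
  rw [r, ← intervalIntegral.integral_sub (hi _ h3) (hi _ c1), ← intervalIntegral.integral_sub
    ((hi _ h3).sub (hi _ c1)) (hi _ c3)]
  refine intervalIntegral.integral_congr fun q _ => ?_
  simp only [cutBothDD]
  ring

/-- In the limit the two layers restore the boundary terms of an integration by parts; the right one
is the left one for the reflected functions, which gives the opposite sign. -/
theorem IsCutoff.tendsto_integral_cutBothDD (ha : IsCutoff a da dda D)
    (h1 : ∀ q, HasDerivAt φ (dφ q) q) (h2 : ∀ q, HasDerivAt dφ (ddφ q) q) (h3 : Continuous ddφ)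
    (h0 : φ 0 = 0) (h0' : φ 1 = 0) (hP : ∀ q, |dφ q| ≤ P) (hQ : ∀ q, |ddφ q| ≤ Q) {w : ℝ → ℝ}
    (hw : ContinuousOn w (Icc 0 1)) :
    Tendsto (fun k => ∫ q in (0 : ℝ)..1, w q * cutBothDD a da dda φ dφ ddφ k q) atTop
      (𝓝 ((∫ q in (0 : ℝ)..1, w q * ddφ q) + w 0 * dφ 0 - w 1 * dφ 1)) := by
  have hw' : ContinuousOn (fun q => w (1 - q)) (Icc 0 1) :=
    hw.comp (by fun_prop) fun q hq => ⟨by linarith [hq.2], by linarith [hq.1]⟩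
  have t1 := ha.tendsto_integral_layer h1 h2 h3 h0 hP hQ hw
  have t2 := ha.tendsto_integral_layer (hasDerivAt_reflect h1) (hasDerivAt_reflect_neg h2)
    (h3.comp (continuous_const.sub continuous_id)) (by simpa using h0')
    (fun q => by rw [abs_neg]; exact hP _) (fun q => hQ _) hw'
  simp only [integral_cutBothDD ha h1 h2 h3 hw]
  convert (tendsto_const_nhds.sub t1).sub t2 using 2
  simp only [sub_zero]
  ring

theorem IsCutoff.abs_integral_cutBothDD_le (ha : IsCutoff a da dda D)
    (h1 : ∀ q, HasDerivAt φ (dφ q) q) (h2 : ∀ q, HasDerivAt dφ (ddφ q) q) (h3 : Continuous ddφ)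
    (h0 : φ 0 = 0) (h0' : φ 1 = 0) (hP : ∀ q, |dφ q| ≤ P) (hQ : ∀ q, |ddφ q| ≤ Q) (hk : 1 ≤ k)
    {w : ℝ → ℝ} (hw : ContinuousOn w (Icc 0 1)) (hw1 : ∀ q ∈ Icc (0 : ℝ) 1, |w q| ≤ 1) :
    |∫ q in (0 : ℝ)..1, w q * cutBothDD a da dda φ dφ ddφ k q| ≤ Q + 2 * (Q + 3 * (P * D)) := by
  have hk1 : 1 / k ≤ 1 := by rw [div_le_one (by linarith)]; exact hk
  have hw' : ContinuousOn (fun q => w (1 - q)) (Icc 0 1) :=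
    hw.comp (by fun_prop) fun q hq => ⟨by linarith [hq.2], by linarith [hq.1]⟩
  have t1 := ha.abs_integral_layer_le h1 h2 h3 h0 hP hQ hk hw (δ := 1)
    fun q hq => hw1 q ⟨hq.1, hq.2.trans hk1⟩
  have t2 := ha.abs_integral_layer_le (hasDerivAt_reflect h1) (hasDerivAt_reflect_neg h2)
    (h3.comp (continuous_const.sub continuous_id)) (by simpa using h0')
    (fun q => by rw [abs_neg]; exact hP _) (fun q => hQ _) hk hw' (δ := 1)
    fun q hq => hw1 _ ⟨by linarith [hq.2], by linarith [hq.1]⟩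
  have t3 : |∫ q in (0 : ℝ)..1, w q * ddφ q| ≤ Q := by
    have := intervalIntegral.norm_integral_le_of_norm_le_const (a := (0 : ℝ)) (b := 1)
      (f := fun q => w q * ddφ q) (C := 1 * Q) fun q hq => by
        rw [uIoc_of_le zero_le_one] at hq
        rw [norm_mul]
        exact mul_le_mul (hw1 q (Ioc_subset_Icc_self hq)) (hQ q) (norm_nonneg _) zero_le_one
    simpa using this
  rw [integral_cutBothDD ha h1 h2 h3 hw]
  refine (abs_sub _ _).trans ?_
  refine (add_le_add (abs_sub _ _) le_rfl).trans ?_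
  linarith

end CutMode

theorem IsL2H1.aestronglyMeasurable_integral {T : ℝ} {ρ u : ℝ → ℝ → ℝ} (h : IsL2H1 T ρ u)
    {χ : ℝ → ℝ} (hχ : Continuous χ) :
    AEStronglyMeasurable (fun s => ∫ q in (0 : ℝ)..1, ρ s q * χ q)
      (volume.restrict (Icc (0 : ℝ) T)) := by
  have hm : AEStronglyMeasurable (fun p : ℝ × ℝ => u p.1 p.2 * χ p.2) (spaceTime T) :=
    h.memLp.1.mul (hχ.comp continuous_snd).aestronglyMeasurable
  have hm' : AEStronglyMeasurable (fun s => ∫ q, u s q * χ q ∂unitMeas)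
      (volume.restrict (Icc (0 : ℝ) T)) := hm.integral_prod_right'
  refine hm'.congr ?_
  filter_upwards [h.ae_eq] with s hs
  rw [← integral_unitMeas]
  refine integral_congr_ae ?_
  filter_upwards [hs] with q hq
  rw [hq]

/-! ### Coefficients from compactly supported tests -/

namespace ModeSystem

variable {κ : ℝ} {lam : ℕ → ℝ} {e de : ℕ → ℝ → ℝ} {T : ℝ}

theorem mode_zero_one (S : ModeSystem 0 κ lam e de) (n : ℕ) : e n 0 = 0 ∧ e n 1 = 0 := by
  obtain ⟨b0, b1⟩ := S.bc n
  exact ⟨by simpa [S.hκ.ne'] using b0.symm, by simpa [S.hκ.ne'] using b1.symm⟩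

/-- A mode is not compactly supported in `(0,1)`, so cut-off modes are tested and `k` tends to
infinity. The layers produce `α e'(0) - β e'(1)` because the traces of `u` are `α` and `β`. The
result is the identity of `coeff_of_isWeakDirichlet`, so both notions share one solution. -/
theorem coeff_of_isWeakDirichletCompact (S : ModeSystem 0 κ lam e de) {α β : ℝ} {g : ℝ → ℝ}
    (hg : MemLp g 2 unitMeas) {ρ : ℝ → ℝ → ℝ} (hρ : IsWeakDirichletCompact T α β g ρ) {t : ℝ}
    (ht : t ∈ Icc (0 : ℝ) T) (n : ℕ) :
    Real.exp (lam n / 2 * t) * (∫ q in (0 : ℝ)..1, ρ t q * e n q)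
      = (∫ q in (0 : ℝ)..1, g q * e n q) - ∫ s in (0 : ℝ)..t,
        (β / 2 * (Real.exp (lam n / 2 * s) * de n 1) - α / 2 * (Real.exp (lam n / 2 * s) * de n 0))
      := by
  obtain ⟨hp, ⟨u, hu, hub⟩, -, hw⟩ := hρ
  obtain ⟨e0, e1⟩ := S.mode_zero_one n
  obtain ⟨a, da, dda, D, ha⟩ := exists_isCutoff
  obtain ⟨M, hM0, hM⟩ := S.bound
  obtain ⟨M', hM0', hM'⟩ := S.deriv_bound
  have hl := S.lam_pos n
  have h1 := S.deriv n
  have h2 := S.deriv2 n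
  have h3 : Continuous fun q => -lam n * e n q := continuous_const.mul (S.continuous n)
  have hQ : ∀ q, |-lam n * e n q| ≤ lam n * M := fun q => by
    rw [abs_mul, abs_neg, abs_of_pos hl]
    exact mul_le_mul_of_nonneg_left (hM n q) hl.le
  have hsub : Ioc 0 t ⊆ Icc 0 T := fun s hs => ⟨hs.1.le, hs.2.trans ht.2⟩
  set DD : ℝ → ℝ → ℝ := cutBothDD a da dda (e n) (de n) (fun q => -lam n * e n q)
  set χ : ℝ → ℝ → ℝ := cutBoth a (e n)
  have cDD : ∀ k, Continuous (DD k) := fun k => ha.continuous_cutBothDD h1 h2 h3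
  have cχ : ∀ k, Continuous (χ k) := fun k => ha.continuous_cutBoth h1
  have id_k : ∀ k : ℝ, 2 ≤ k → Real.exp (lam n / 2 * t) * (∫ q in (0 : ℝ)..1, ρ t q * χ k q)
      - (∫ q in (0 : ℝ)..1, g q * χ k q) - (∫ s in (0 : ℝ)..t, Real.exp (lam n / 2 * s)
            * ∫ q in (0 : ℝ)..1, ρ s q * (1 / 2 * DD k q + lam n / 2 * χ k q)) = 0 := by
    intro k hk
    obtain ⟨dχ, d1, d2⟩ := ha.hasDerivAt_cutBoth (k := k) h1 h2
    rw [← bulkTerm_exp_mul]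
    refine hw t ht _ _ _ _ (isC12_exp_mul d1 d2 (cDD k)) fun s _ =>
      ⟨Icc (1 / (2 * k)) (1 - 1 / (2 * k)), isCompact_Icc, fun q hq => ?_, fun q _ hq => ?_⟩
    · have : 0 < 1 / (2 * k) := by positivity
      exact ⟨by linarith [hq.1], by linarith [hq.2]⟩
    · have hz : χ k q = 0 := ha.cutBoth_eq_zero hk hq
      rw [hz, mul_zero]
  have l1 := (ha.tendsto_integral_cutBoth h1 (hM n) (hp.memLp ht).intervalIntegrable_unit).const_mul
    (Real.exp (lam n / 2 * t))
  have l2 := ha.tendsto_integral_cutBoth h1 (hM n) hg.intervalIntegrable_unit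
  have good : ∀ᵐ s ∂volume.restrict (Ioc 0 t), ContinuousOn (u s) (Icc 0 1) ∧
      (∀ q ∈ Icc (0 : ℝ) 1, |u s q| ≤ 1) ∧ (u s 0 = α ∧ u s 1 = β) ∧
      ∀ k, ∫ q in (0 : ℝ)..1, ρ s q * (1 / 2 * DD k q + lam n / 2 * χ k q)
        = 1 / 2 * (∫ q in (0 : ℝ)..1, u s q * DD k q)
          + lam n / 2 * ∫ q in (0 : ℝ)..1, u s q * χ k q := by
    refine ae_restrict_of_ae_restrict_of_subset hsub ?_
    filter_upwards [hu.ae_eq, hu.cont, hu.mem_Icc hp, hub] with s a1 a2 a3 a4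
    refine ⟨a2, fun q hq => abs_le.2 ⟨by linarith [(a3 q hq).1], (a3 q hq).2⟩, a4, fun k => ?_⟩
    have hi : ∀ g : ℝ → ℝ, Continuous g → IntervalIntegrable (fun q => u s q * g q) volume 0 1 :=
      fun g hg => ContinuousOn.intervalIntegrable (by
        rw [uIcc_of_le zero_le_one]; exact a2.mul hg.continuousOn)
    rw [← intervalIntegral.integral_const_mul, ← intervalIntegral.integral_const_mul,
      ← intervalIntegral.integral_add ((hi _ (cDD k)).const_mul _) ((hi _ (cχ k)).const_mul _),
      ← integral_unitMeas, ← integral_unitMeas]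
    refine integral_congr_ae ?_
    filter_upwards [a1] with q hq
    rw [hq]
    ring
  -- Dominated convergence in time: the inner integrals are bounded uniformly in `k`, and in their
  -- limit `½ e'' + (lam/2) e = 0` leaves only the boundary contributions.
  have l3 : Tendsto (fun k => ∫ s in (0 : ℝ)..t, Real.exp (lam n / 2 * s)
        * ∫ q in (0 : ℝ)..1, ρ s q * (1 / 2 * DD k q + lam n / 2 * χ k q)) atTop
      (𝓝 (∫ s in (0 : ℝ)..t, Real.exp (lam n / 2 * s)
        * (1 / 2 * (α * de n 0 - β * de n 1)))) := by
    simp only [intervalIntegral.integral_of_le ht.1]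
    refine tendsto_integral_filter_of_dominated_convergence
      (fun s => Real.exp (lam n / 2 * s) * (1 / 2 * (lam n * M
        + 2 * (lam n * M + 3 * (M' * (1 + lam n) * D))) + lam n / 2 * (3 * M)))
      (Eventually.of_forall fun k => ?_) ((eventually_ge_atTop 1).mono fun k hk => ?_) ?_ ?_
    · exact ((by fun_prop : Continuous fun s => Real.exp (lam n / 2 * s)).aestronglyMeasurable).mul
        ((hu.aestronglyMeasurable_integral (((cDD k).const_mul _).add
          ((cχ k).const_mul _))).mono_measure (Measure.restrict_mono hsub le_rfl))
    · filter_upwards [good] with s hs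
      obtain ⟨a2, a3, a4, a5⟩ := hs
      rw [a5, norm_mul, Real.norm_of_nonneg (Real.exp_pos _).le]
      refine mul_le_mul_of_nonneg_left ?_ (Real.exp_pos _).le
      refine (abs_add_le _ _).trans (add_le_add ?_ ?_)
      · rw [abs_mul, abs_of_pos (by norm_num : (0 : ℝ) < 1 / 2)]
        exact mul_le_mul_of_nonneg_left (ha.abs_integral_cutBothDD_le h1 h2 h3 e0 e1 (hM' n) hQ hk
          a2 a3) (by norm_num)
      · rw [abs_mul, abs_of_pos (by positivity : 0 < lam n / 2)]
        refine mul_le_mul_of_nonneg_left ?_ (by positivity)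
        have := intervalIntegral.norm_integral_le_of_norm_le_const (a := (0 : ℝ)) (b := 1)
          (f := fun q => u s q * χ k q) (C := 1 * (3 * M)) fun q hq => by
            rw [uIoc_of_le zero_le_one] at hq
            rw [norm_mul]
            exact mul_le_mul (a3 q (Ioc_subset_Icc_self hq)) (ha.abs_cutBoth_le (hM n) q)
              (norm_nonneg _) zero_le_one
        simpa using this
    · exact (Continuous.integrableOn_Icc (by fun_prop)).mono_set Ioc_subset_Icc_self
    · filter_upwards [good] with s hs
      obtain ⟨a2, a3, a4, a5⟩ := hs
      simp only [a5]
      refine tendsto_const_nhds.mul ?_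
      have m1 := ha.tendsto_integral_cutBothDD h1 h2 h3 e0 e1 (hM' n) hQ a2
      have m2 := ha.tendsto_integral_cutBoth h1 (hM n) (f := u s)
        (ContinuousOn.intervalIntegrable (by rwa [uIcc_of_le zero_le_one]))
      have m3 := (m1.const_mul (1 / 2)).add (m2.const_mul (lam n / 2))
      convert m3 using 2
      rw [a4.1, a4.2]
      simp only [mul_left_comm (u s _) (-lam n), intervalIntegral.integral_const_mul]
      ring
  have hlim := (l1.sub l2).sub l3
  have hzero := tendsto_nhds_unique hlim (tendsto_const_nhds.congr'
    ((eventually_ge_atTop 2).mono fun k hk => (id_k k hk).symm))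
  have : (∫ s in (0 : ℝ)..t, (β / 2 * (Real.exp (lam n / 2 * s) * de n 1)
      - α / 2 * (Real.exp (lam n / 2 * s) * de n 0)))
      = -∫ s in (0 : ℝ)..t, Real.exp (lam n / 2 * s) * (1 / 2 * (α * de n 0 - β * de n 1)) := by
    rw [← intervalIntegral.integral_neg]
    exact intervalIntegral.integral_congr fun s _ => by ring
  rw [this]
  linarith

end ModeSystem


theorem IsC12.deriv_eq_zero {T : ℝ} {G Gs Gq Gqq : ℝ → ℝ → ℝ} (hG : IsC12 T G Gs Gq Gqq) {s x : ℝ}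
    (hs : s ∈ Icc (0 : ℝ) T) (hx : x ∈ Icc (0 : ℝ) 1) {K : Set ℝ} (hK : IsCompact K) (hxK : x ∉ K)
    (h0 : ∀ q ∈ Icc (0 : ℝ) 1, q ∉ K → G s q = 0) : G s x = 0 ∧ Gq s x = 0 := by
  refine ⟨h0 x hx hxK, ?_⟩
  have h1 : HasDerivWithinAt (G s) 0 (Icc 0 1) x := by
    refine (hasDerivWithinAt_const x (Icc (0 : ℝ) 1) (0 : ℝ)).congr_of_eventuallyEq ?_ (h0 x hx hxK)
    filter_upwards [self_mem_nhdsWithin,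
      mem_nhdsWithin_of_mem_nhds (hK.isClosed.isOpen_compl.mem_nhds hxK)] with q hq hqK
    exact h0 q hq hqK
  exact (uniqueDiffOn_Icc zero_lt_one x hx).eq_deriv _ (hG.deriv_q s hs x hx) h1

/-! ### Well-posedness of the Dirichlet and Robin problems -/

namespace ModeSystem

variable {κ : ℝ} {lam : ℕ → ℝ} {e de : ℕ → ℝ → ℝ} {T α β : ℝ} {g : ℝ → ℝ} {c : ℕ → ℝ}

theorem heatSol_boundary (S : ModeSystem 0 κ lam e de) (s : ℝ) :
    heatSol lam e c (β - α) α s 0 = α ∧ heatSol lam e c (β - α) α s 1 = β := by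
  simp [heatSol, modeSeries, (S.mode_zero_one _).1, (S.mode_zero_one _).2]

theorem isWeakDirichlet_solution (S : ModeSystem 0 κ lam e de) (hT : 0 ≤ T)
    (hα : α ∈ Icc (0 : ℝ) 1) (hβ : β ∈ Icc (0 : ℝ) 1) (hg : AEMeasurable g unitMeas)
    (hg01 : ∀ q ∈ Icc (0 : ℝ) 1, g q ∈ Icc (0 : ℝ) 1)
    (hc : ∀ n, ∫ q in (0 : ℝ)..1, (g q - ((β - α) * q + α)) * e n q = c n) :
    IsWeakDirichlet T α β g (S.solution c (β - α) α g) ∧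
      IsL2H1 T (S.solution c (β - α) α g) (heatSol lam e c (β - α) α) := by
  have hg2 := memLp_of_mem_Icc hg hg01
  have hκ := S.hκ
  have h01 := S.solution_mem_Icc (T := T) hg2 hg01 hc (by nlinarith [hα.1]) (by nlinarith [hβ.1])
    (by nlinarith [hα.2]) (by nlinarith [hβ.2])
  have hc2 := S.summable_coeff_solution hg2 hc
  have hL := S.isL2H1_heatSol (p := β - α) (r := α) hT hc2 S.solution_of_pos h01
  refine ⟨⟨S.isProfile_solution hg hg01 hc2 h01, ⟨_, hL⟩, fun t ht G Gs Gq Gqq hG hG0 => ?_⟩, hL⟩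
  rcases ht.1.eq_or_lt with rfl | h0
  · rw [bulkTerm_zero S.solution_zero, intervalIntegral.integral_same, add_zero]
  -- Modes and test function both vanish at the ends, so only the affine profile contributes to the
  -- boundary term.
  · have hz : ∀ n, ∀ s ∈ Icc 0 t, bdTerm (e n) (de n) G Gq s = 0 := fun n s hs => by
      obtain ⟨g0, g1⟩ := hG0 s ⟨hs.1, hs.2.trans ht.2⟩
      simp [bdTerm, g0, g1, (S.mode_zero_one n).1, (S.mode_zero_one n).2]
    rw [S.bulkTerm_heatSol hg2 hc hG ⟨h0, ht.2⟩ (B := 0) (fun n s hs => by rw [hz n s hs, abs_zero])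
      (b := fun _ => 0) (fun s hs => by
        simp only [hz _ s (Ioc_subset_Icc_self hs), mul_zero]; exact hasSum_zero)
      S.solution_of_pos, ← intervalIntegral.integral_const_mul]
    have : (∫ s in (0 : ℝ)..t, (β / 2 * Gq s 1 - α / 2 * Gq s 0))
        = -∫ s in (0 : ℝ)..t, 1 / 2 * (bdTerm (fun q => (β - α) * q + α) (fun _ => β - α) G Gq s
          + 0) := by
      rw [← intervalIntegral.integral_neg]
      refine intervalIntegral.integral_congr fun s hs => ?_
      rw [uIcc_of_le h0.le] at hs
      obtain ⟨g0, g1⟩ := hG0 s ⟨hs.1, hs.2.trans ht.2⟩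
      simp only [bdTerm, g0, g1]
      ring
    rw [this]
    ring

theorem isWeakDirichletCompact_solution (S : ModeSystem 0 κ lam e de) (hT : 0 ≤ T)
    (hα : α ∈ Icc (0 : ℝ) 1) (hβ : β ∈ Icc (0 : ℝ) 1) (hg : AEMeasurable g unitMeas)
    (hg01 : ∀ q ∈ Icc (0 : ℝ) 1, g q ∈ Icc (0 : ℝ) 1)
    (hc : ∀ n, ∫ q in (0 : ℝ)..1, (g q - ((β - α) * q + α)) * e n q = c n) :
    IsWeakDirichletCompact T α β g (S.solution c (β - α) α g) := by
  obtain ⟨⟨hp, -, hw⟩, hL⟩ := S.isWeakDirichlet_solution hT hα hβ hg hg01 hc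
  have m0 : (0 : ℝ) ∈ Icc (0 : ℝ) 1 := left_mem_Icc.2 zero_le_one
  have m1 : (1 : ℝ) ∈ Icc (0 : ℝ) 1 := right_mem_Icc.2 zero_le_one
  refine ⟨hp, ⟨_, hL, Eventually.of_forall S.heatSol_boundary⟩, fun t ht => ?_,
    fun t ht G Gs Gq Gqq hG hK => ?_⟩
  · rw [S.solution_of_pos t ht 0 m0, S.solution_of_pos t ht 1 m1]
    exact S.heatSol_boundary t
  · have hz : ∀ s ∈ Icc 0 T, (G s 0 = 0 ∧ Gq s 0 = 0) ∧ G s 1 = 0 ∧ Gq s 1 = 0 := fun s hs => by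
      obtain ⟨K, hKc, hK1, hK0⟩ := hK s hs
      exact ⟨hG.deriv_eq_zero hs m0 hKc (fun h => lt_irrefl _ (hK1 h).1) hK0,
        hG.deriv_eq_zero hs m1 hKc (fun h => lt_irrefl _ (hK1 h).2) hK0⟩
    have := hw t ht G Gs Gq Gqq hG fun s hs => ⟨(hz s hs).1.1, (hz s hs).2.1⟩
    rwa [intervalIntegral.integral_congr (g := fun _ => 0), intervalIntegral.integral_zero,
      add_zero] at this
    intro s hs
    rw [uIcc_of_le ht.1] at hs
    have := hz s ⟨hs.1, hs.2.trans ht.2⟩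
    simp [this.1.2, this.2.2]

/-- The Dirichlet problem. -/
theorem dirichlet_wellPosed (S : ModeSystem 0 κ lam e de) (hT : 0 ≤ T)
    (hα : α ∈ Icc (0 : ℝ) 1) (hβ : β ∈ Icc (0 : ℝ) 1) (hg : AEMeasurable g unitMeas)
    (hg01 : ∀ q ∈ Icc (0 : ℝ) 1, g q ∈ Icc (0 : ℝ) 1) :
    ∃ ρ, IsWeakDirichlet T α β g ρ ∧ IsWeakDirichletCompact T α β g ρ ∧
      HasExpansion T g (statDir α β)
        (fun n => ∫ q in (0 : ℝ)..1, (g q - statDir α β q) * e n q) lam e ρ ∧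
      (∀ ρ', IsWeakDirichlet T α β g ρ' → AgreeAE T ρ' ρ) ∧
      (∀ ρ', IsWeakDirichletCompact T α β g ρ' → AgreeAE T ρ' ρ) := by
  have hg2 := memLp_of_mem_Icc hg hg01
  have hc : ∀ n, ∫ q in (0 : ℝ)..1, (g q - ((β - α) * q + α)) * e n q
      = ∫ q in (0 : ℝ)..1, (g q - statDir α β q) * e n q := fun n => rfl
  have h1 := (S.isWeakDirichlet_solution hT hα hβ hg hg01 hc).1
  refine ⟨_, h1, S.isWeakDirichletCompact_solution hT hα hβ hg hg01 hc,
    S.hasExpansion_solution hg2 hc, fun ρ' h => ?_, fun ρ' h => ?_⟩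
  · exact S.agreeAE h1.1 h.1 (fun t ht n => S.coeff_of_isWeakDirichlet h1 ht n)
      fun t ht n => S.coeff_of_isWeakDirichlet h ht n
  · exact S.agreeAE h1.1 h.1 (fun t ht n => S.coeff_of_isWeakDirichlet h1 ht n)
      fun t ht n => S.coeff_of_isWeakDirichletCompact hg2 h ht n

/-- `hp0` and `hp1` say that the affine profile carries the inhomogeneous Robin data; the modes
carry homogeneous data. -/
theorem isWeakRobin_solution (S : ModeSystem 1 κ lam e de) (hT : 0 ≤ T)
    (hα : α ∈ Icc (0 : ℝ) 1) (hβ : β ∈ Icc (0 : ℝ) 1) (hg : AEMeasurable g unitMeas)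
    (hg01 : ∀ q ∈ Icc (0 : ℝ) 1, g q ∈ Icc (0 : ℝ) 1) {p r : ℝ} (hp0 : p = κ * (r - α))
    (hp1 : p = κ * (β - (p + r)))
    (hc : ∀ n, ∫ q in (0 : ℝ)..1, (g q - (p * q + r)) * e n q = c n) :
    IsWeakRobin T κ α β g (S.solution c p r g) := by
  have hg2 := memLp_of_mem_Icc hg hg01
  have hκ := S.hκ
  have h01 := S.solution_mem_Icc (T := T) hg2 hg01 hc (by nlinarith [hα.1]) (by nlinarith [hβ.1])
    (by nlinarith [hα.2]) (by nlinarith [hβ.2])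
  have hc2 := S.summable_coeff_solution hg2 hc
  have hK := abs_coeff_le hc2
  refine ⟨S.isProfile_solution hg hg01 hc2 h01, heatSol lam e c p r,
    S.isL2H1_heatSol hT hc2 S.solution_of_pos h01, fun t ht G Gs Gq Gqq hG => ?_⟩
  rcases ht.1.eq_or_lt with rfl | h0
  · rw [bulkTerm_zero S.solution_zero]
    simp
  have hsub : Icc 0 t ⊆ Icc 0 T := Icc_subset_Icc_right ht.2
  have m0 : (0 : ℝ) ∈ Icc (0 : ℝ) 1 := left_mem_Icc.2 zero_le_one
  have m1 : (1 : ℝ) ∈ Icc (0 : ℝ) 1 := right_mem_Icc.2 zero_le_one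
  obtain ⟨M, hM0, hM⟩ := S.bound
  obtain ⟨cG0, cG0'⟩ := hG.continuousOn_slice m0
  obtain ⟨cG1, cG1'⟩ := hG.continuousOn_slice m1
  -- The boundary condition eliminates `e'`, so the boundary terms are bounded uniformly in `n` and
  -- sum to boundary values of the series itself.
  have hbd : ∀ n s, bdTerm (e n) (de n) G Gq s
      = e n 1 * (-(κ * G s 1) - Gq s 1) + e n 0 * (-(κ * G s 0) + Gq s 0) := fun n s => by
    obtain ⟨b0, b1⟩ := S.bc n
    rw [one_mul] at b0 b1
    rw [bdTerm, b0, b1]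
    ring
  set w1 : ℝ → ℝ := fun s => -(κ * G s 1) - Gq s 1
  set w0 : ℝ → ℝ := fun s => -(κ * G s 0) + Gq s 0
  have cw1 : ContinuousOn w1 (Icc 0 t) := ContinuousOn.mono (by fun_prop) hsub
  have cw0 : ContinuousOn w0 (Icc 0 t) := ContinuousOn.mono (by fun_prop) hsub
  obtain ⟨B1, hB1⟩ := isCompact_Icc.exists_bound_of_continuousOn cw1
  obtain ⟨B0, hB0⟩ := isCompact_Icc.exists_bound_of_continuousOn cw0
  have hb : ∀ s ∈ Ioc 0 t, HasSum (fun n => decay lam c s n * bdTerm (e n) (de n) G Gq s)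
      (modeSeries e (decay lam c s) 1 * w1 s + modeSeries e (decay lam c s) 0 * w0 s) :=
    fun s hs => by
      have s1 := (S.summable_modeSeries (S.summable_abs_decay hK hs.1) 1).hasSum.mul_right (w1 s)
      have s0 := (S.summable_modeSeries (S.summable_abs_decay hK hs.1) 0).hasSum.mul_right (w0 s)
      refine (s1.add s0).congr_fun fun n => ?_
      rw [hbd]
      ring
  rw [S.bulkTerm_heatSol hg2 hc hG ⟨h0, ht.2⟩ (B := M * B1 + M * B0) (fun n s hs => ?_) hb
    S.solution_of_pos]
  · have trace : ∀ x ∈ Icc (0 : ℝ) 1,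
        IntervalIntegrable (fun s => heatSol lam e c p r s x) volume 0 t := fun x hx =>
      (S.isL2H1_heatSol hT hc2 S.solution_of_pos h01).intervalIntegrable_trace
        (S.isProfile_solution hg hg01 hc2 h01) hx ht
    have hut : uIcc (0 : ℝ) t = Icc 0 t := uIcc_of_le h0.le
    have mulc : ∀ x ∈ Icc (0 : ℝ) 1, ∀ v : ℝ → ℝ, ContinuousOn v (Icc 0 T) →
        IntervalIntegrable (fun s => heatSol lam e c p r s x * v s) volume 0 t := fun x hx v hv =>
      (trace x hx).mul_continuousOn (by rw [hut]; exact hv.mono hsub)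
    have i1 : IntervalIntegrable (fun s => heatSol lam e c p r s 1 * Gq s 1
        - heatSol lam e c p r s 0 * Gq s 0) volume 0 t := (mulc 1 m1 _ cG1').sub (mulc 0 m0 _ cG0')
    have i2 : IntervalIntegrable (fun s => G s 0 * (α - heatSol lam e c p r s 0)
        + G s 1 * (β - heatSol lam e c p r s 1)) volume 0 t := by
      have j0 : IntervalIntegrable (fun s => α * G s 0 + β * G s 1) volume 0 t :=
        ContinuousOn.intervalIntegrable (by rw [hut]; exact ContinuousOn.mono (by fun_prop) hsub)
      refine ((j0.sub (mulc 0 m0 _ cG0)).sub (mulc 1 m1 _ cG1)).congr (fun s _ => ?_)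
      ring
    rw [← intervalIntegral.integral_const_mul, ← intervalIntegral.integral_const_mul,
      ← intervalIntegral.integral_const_mul, sub_eq_zero]
    have e1 : (∫ s in (0 : ℝ)..t, 1 / 2 * (bdTerm (fun q => p * q + r) (fun _ => p) G Gq s
        + (modeSeries e (decay lam c s) 1 * w1 s + modeSeries e (decay lam c s) 0 * w0 s)))
        = ∫ s in (0 : ℝ)..t, (κ / 2 * (G s 0 * (α - heatSol lam e c p r s 0)
          + G s 1 * (β - heatSol lam e c p r s 1))
          - 1 / 2 * (heatSol lam e c p r s 1 * Gq s 1 - heatSol lam e c p r s 0 * Gq s 0)) := by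
      refine intervalIntegral.integral_congr fun s _ => ?_
      simp only [bdTerm, heatSol, w1, w0]
      linear_combination 1 / 2 * G s 1 * hp1 - 1 / 2 * G s 0 * hp0
    rw [e1, intervalIntegral.integral_sub (i2.const_mul _) (i1.const_mul _)]
    ring
  · rw [hbd]
    refine (abs_add_le _ _).trans (add_le_add ?_ ?_)
    · rw [abs_mul]
      exact mul_le_mul (hM n 1) (hB1 s hs) (abs_nonneg _) hM0
    · rw [abs_mul]
      exact mul_le_mul (hM n 0) (hB0 s hs) (abs_nonneg _) hM0

/-- The Robin problem. -/
theorem robin_wellPosed (S : ModeSystem 1 κ lam e de) (hT : 0 ≤ T)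
    (hα : α ∈ Icc (0 : ℝ) 1) (hβ : β ∈ Icc (0 : ℝ) 1) (hg : AEMeasurable g unitMeas)
    (hg01 : ∀ q ∈ Icc (0 : ℝ) 1, g q ∈ Icc (0 : ℝ) 1) :
    ∃ ρ, IsWeakRobin T κ α β g ρ ∧
      HasExpansion T g (statRob κ α β)
        (fun n => ∫ q in (0 : ℝ)..1, (g q - statRob κ α β q) * e n q) lam e ρ ∧
      (∀ ρ', IsWeakRobin T κ α β g ρ' → AgreeAE T ρ' ρ) := by
  have hg2 := memLp_of_mem_Icc hg hg01
  have hκ := S.hκ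
  have hκ2 : 2 + κ ≠ 0 := by positivity
  have hstat : ∀ q, statRob κ α β q
      = κ * (β - α) / (2 + κ) * q + (α + (β - α) / (2 + κ)) := fun q => by rw [statRob, add_assoc]
  have hc : ∀ n, ∫ q in (0 : ℝ)..1,
      (g q - (κ * (β - α) / (2 + κ) * q + (α + (β - α) / (2 + κ)))) * e n q
      = ∫ q in (0 : ℝ)..1, (g q - statRob κ α β q) * e n q := fun n => by simp only [hstat]
  have h1 := S.isWeakRobin_solution hT hα hβ hg hg01 (by field_simp; ring) (by field_simp; ring) hc
  have hx := S.hasExpansion_solution (T := T) hg2 hc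
  have : (fun q => κ * (β - α) / (2 + κ) * q + (α + (β - α) / (2 + κ))) = statRob κ α β :=
    funext fun q => (hstat q).symm
  rw [this] at hx
  refine ⟨_, h1, hx, fun ρ' h => ?_⟩
  exact S.agreeAE h1.1 h.1 (fun t ht n => S.coeff_of_isWeakRobin h1 ht n)
    fun t ht n => S.coeff_of_isWeakRobin h ht n

end ModeSystem


/-! ### Dirichlet modes -/

theorem hasDerivAt_const_mul_sin (A w q : ℝ) :
    HasDerivAt (fun q => A * Real.sin (w * q)) (A * w * Real.cos (w * q)) q := by
  have hl : HasDerivAt (fun x : ℝ => w * x) w q := by simpa using (hasDerivAt_id q).const_mul w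
  exact (hl.sin.const_mul A).congr_deriv (by ring)

theorem hasDerivAt_const_mul_cos (A w q : ℝ) :
    HasDerivAt (fun q => A * Real.cos (w * q)) (-(A * w) * Real.sin (w * q)) q := by
  have hl : HasDerivAt (fun x : ℝ => w * x) w q := by simpa using (hasDerivAt_id q).const_mul w
  exact (hl.cos.const_mul A).congr_deriv (by ring)

/-- With `σ = 0` any positive `κ` gives the same boundary conditions; 1 is a choice. Indices start
at 0, so the frequency is `(n+1)π`. -/
theorem modeSystem_dirichlet : ModeSystem 0 1 (fun n => ((n + 1 : ℝ) * Real.pi) ^ 2)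
    (fun n q => √2 * Real.sin ((n + 1 : ℝ) * Real.pi * q))
    (fun n q => √2 * ((n + 1 : ℝ) * Real.pi) * Real.cos ((n + 1 : ℝ) * Real.pi * q)) := by
  have hw : ∀ n : ℕ, 0 < (n + 1 : ℝ) * Real.pi := fun n => by positivity
  have hs : ∀ n : ℕ, Real.sin ((n + 1 : ℝ) * Real.pi) = 0 := fun n => by
    exact_mod_cast Real.sin_nat_mul_pi (n + 1)
  have h2 : (0 : ℝ) ≤ √2 := Real.sqrt_nonneg _
  refine ⟨le_rfl, one_pos, fun n q => hasDerivAt_const_mul_sin _ _ q, fun n q => ?_, fun n => ?_,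
    fun n => ?_, ⟨√2, h2, fun n q => ?_⟩, ⟨√2, h2, fun n q => ?_⟩, fun n => pow_pos (hw n) 2,
    fun n => ?_, fun n m h => ?_, fun s a b hs0 h1 h3 => ?_⟩
  · exact (hasDerivAt_const_mul_cos _ _ q).congr_deriv (by ring)
  · constructor
    · simp
    · simp [hs]
  · have hd : ∀ q ∈ uIcc (0 : ℝ) 1, HasDerivAt (fun q => q
        - 1 / (2 * ((n + 1 : ℝ) * Real.pi)) * Real.sin (2 * ((n + 1 : ℝ) * Real.pi) * q))
        ((√2 * Real.sin ((n + 1 : ℝ) * Real.pi * q)) ^ 2) q := fun q _ => by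
      refine ((hasDerivAt_id q).sub (hasDerivAt_const_mul_sin _ _ q)).congr_deriv ?_
      rw [one_div_mul_cancel (by have := hw n; positivity), mul_pow, Real.sq_sqrt zero_le_two,
        Real.sin_sq_eq_half_sub, mul_assoc 2]
      ring
    rw [intervalIntegral.integral_eq_sub_of_hasDerivAt hd
      (Continuous.intervalIntegrable (by fun_prop) _ _), mul_one, Real.sin_two_mul, hs]
    simp
  · rw [abs_mul, abs_of_nonneg h2]
    exact mul_le_of_le_one_right h2 (Real.abs_sin_le_one _)
  · rw [abs_mul, abs_mul, abs_of_nonneg h2, abs_of_pos (hw n), mul_assoc]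
    refine mul_le_mul_of_nonneg_left ?_ h2
    refine (mul_le_of_le_one_right (hw n).le (Real.abs_cos_le_one _)).trans ?_
    nlinarith [sq_nonneg ((n + 1 : ℝ) * Real.pi - 1)]
  · have hp := Real.pi_gt_three
    have hn : (0 : ℝ) ≤ n := n.cast_nonneg
    exact pow_le_pow_left₀ hn (by nlinarith) 2
  · have := (pow_left_inj₀ (hw n).le (hw m).le two_ne_zero).1 h
    have := mul_right_cancel₀ Real.pi_ne_zero this
    exact_mod_cast add_right_cancel this
  · have ha : a = 0 := by linarith
    subst ha
    simp only [zero_mul, one_mul, zero_add] at h3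
    have h4 : b * Real.sin s = 0 := by linarith
    rcases mul_eq_zero.1 h4 with hb | hb
    · exact ⟨0, 0, fun q => by simp [hb]⟩
    · obtain ⟨m, hm⟩ := Real.sin_eq_zero_iff.1 hb
      have hm0 : 0 < m := by
        by_contra hneg
        have : (m : ℝ) ≤ 0 := by exact_mod_cast not_lt.1 hneg
        nlinarith [Real.pi_pos]
      obtain ⟨n, rfl⟩ : ∃ n : ℕ, m = n + 1 := ⟨(m - 1).toNat, by omega⟩
      refine ⟨n, b / √2, fun q => ?_⟩
      push_cast at hm
      rw [hm]
      field_simp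
      ring

/-! ### Robin eigenvalues -/

/-- The phase `s + 2 arctan (s/κ)`. -/
noncomputable def robinPhase (κ s : ℝ) : ℝ := s + 2 * Real.arctan (s / κ)

section Roots

variable {κ : ℝ}

theorem robinPhase_strictMono (hκ : 0 < κ) : StrictMono (robinPhase κ) := by
  intro s t h
  have := Real.arctan_strictMono (div_lt_div_of_pos_right h hκ)
  unfold robinPhase
  linarith

theorem robinPhase_bounds (hκ : 0 < κ) {s : ℝ} (hs : 0 < s) :
    s < robinPhase κ s ∧ robinPhase κ s < s + Real.pi := by
  have h1 := Real.arctan_lt_pi_div_two (s / κ)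
  have h2 : 0 < Real.arctan (s / κ) := Real.arctan_pos.2 (by positivity)
  unfold robinPhase
  exact ⟨by linarith, by linarith⟩

/-- Double-angle formulas for the angle with tangent `s/κ`. The right side is minus the defect of
the transcendental equation at `s²`. -/
theorem sin_robinPhase (hκ : 0 < κ) (s : ℝ) :
    (κ ^ 2 + s ^ 2) * Real.sin (robinPhase κ s)
      = -((s ^ 2 - κ ^ 2) * Real.sin s - 2 * κ * s * Real.cos s) := by
  have hc := Real.cos_sq_arctan (s / κ)
  have ht := Real.tan_arctan (s / κ)
  have hc0 := (Real.cos_arctan_pos (s / κ)).ne'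
  rw [Real.tan_eq_sin_div_cos, div_eq_iff hc0] at ht
  have hκ0 := hκ.ne'
  have hsum : κ ^ 2 + s ^ 2 ≠ 0 := by positivity
  have hc' : Real.cos (Real.arctan (s / κ)) ^ 2 = κ ^ 2 / (κ ^ 2 + s ^ 2) := by
    rw [hc]; field_simp
  have e1 : Real.cos (2 * Real.arctan (s / κ)) = (κ ^ 2 - s ^ 2) / (κ ^ 2 + s ^ 2) := by
    rw [Real.cos_two_mul, hc']; field_simp; ring
  have e2 : Real.sin (2 * Real.arctan (s / κ)) = 2 * κ * s / (κ ^ 2 + s ^ 2) := by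
    rw [Real.sin_two_mul, ht]
    have : 2 * (s / κ * Real.cos (Real.arctan (s / κ))) * Real.cos (Real.arctan (s / κ))
      = 2 * (s / κ) * Real.cos (Real.arctan (s / κ)) ^ 2 := by ring
    rw [this, hc']; field_simp
  rw [robinPhase, Real.sin_add, e1, e2]
  field_simp
  ring

theorem solvesTrans_sq_iff (hκ : 0 < κ) {s : ℝ} (hs : 0 < s) :
    SolvesTrans κ (s ^ 2) ↔ Real.sin (robinPhase κ s) = 0 := by
  have h := sin_robinPhase hκ s
  have hsum : κ ^ 2 + s ^ 2 ≠ 0 := by positivity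
  unfold SolvesTrans
  rw [Real.sqrt_sq hs.le]
  constructor
  · rintro ⟨_, h1⟩
    have : (κ ^ 2 + s ^ 2) * Real.sin (robinPhase κ s) = 0 := by rw [h]; linarith
    exact (mul_eq_zero.1 this).resolve_left hsum
  · intro h1
    rw [h1, mul_zero] at h
    exact ⟨by positivity, by linarith⟩

/-- Intermediate values: since `0 < 2 arctan < π` for positive arguments, the phase is below
`(n+1)π` at `nπ` and above it at `(n+1)π`. -/
theorem exists_robinRoot (hκ : 0 < κ) (n : ℕ) :
    ∃ s, 0 < s ∧ (n : ℝ) * Real.pi ≤ s ∧ s ≤ (n + 1 : ℝ) * Real.pi ∧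
      robinPhase κ s = (n + 1 : ℝ) * Real.pi := by
  have hpi := Real.pi_pos
  have hn : (0 : ℝ) ≤ n := n.cast_nonneg
  have hcont : Continuous (robinPhase κ) := by
    unfold robinPhase
    exact continuous_id.add (continuous_const.mul
      (Real.continuous_arctan.comp (continuous_id.div_const κ)))
  have hle : (n : ℝ) * Real.pi ≤ (n + 1 : ℝ) * Real.pi := by nlinarith
  have a1 := Real.arctan_lt_pi_div_two ((n : ℝ) * Real.pi / κ)
  have a2 : 0 < Real.arctan ((n + 1 : ℝ) * Real.pi / κ) := Real.arctan_pos.2 (by positivity)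
  obtain ⟨s, hs, he⟩ := intermediate_value_Icc hle hcont.continuousOn
    (show (n + 1 : ℝ) * Real.pi ∈ _ from ⟨by unfold robinPhase; linarith,
      by unfold robinPhase; linarith⟩)
  refine ⟨s, ?_, hs.1, hs.2, he⟩
  have h0 : robinPhase κ 0 = 0 := by simp [robinPhase]
  refine (robinPhase_strictMono hκ).lt_iff_lt.1 ?_
  rw [h0, he]
  positivity

/-- The square root of the `n`-th Robin eigenvalue. -/
noncomputable def robinRoot (hκ : 0 < κ) (n : ℕ) : ℝ := (exists_robinRoot hκ n).choose

theorem robinRoot_spec (hκ : 0 < κ) (n : ℕ) : 0 < robinRoot hκ n ∧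
    (n : ℝ) * Real.pi ≤ robinRoot hκ n ∧ robinRoot hκ n ≤ (n + 1 : ℝ) * Real.pi ∧
      robinPhase κ (robinRoot hκ n) = (n + 1 : ℝ) * Real.pi :=
  (exists_robinRoot hκ n).choose_spec

theorem solvesTrans_robinRoot (hκ : 0 < κ) (n : ℕ) : SolvesTrans κ (robinRoot hκ n ^ 2) := by
  obtain ⟨h0, _, _, h3⟩ := robinRoot_spec hκ n
  rw [solvesTrans_sq_iff hκ h0, h3]
  exact_mod_cast Real.sin_nat_mul_pi (n + 1)

/-- The phase is an integer multiple `mπ` strictly between `s` and `s + π`, so `n < m < n + 2` even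
when `s` is an endpoint of the closed interval. Injectivity of the phase concludes. -/
theorem eq_robinRoot (hκ : 0 < κ) {n : ℕ} {s : ℝ} (hs : 0 < s) (h : SolvesTrans κ (s ^ 2))
    (h1 : (n : ℝ) * Real.pi ≤ s) (h2 : s ≤ (n + 1 : ℝ) * Real.pi) : s = robinRoot hκ n := by
  rw [solvesTrans_sq_iff hκ hs] at h
  obtain ⟨m, hm⟩ := Real.sin_eq_zero_iff.1 h
  obtain ⟨b1, b2⟩ := robinPhase_bounds hκ hs
  have hpi := Real.pi_pos
  have m1 : (n : ℝ) < m := lt_of_mul_lt_mul_right (h1.trans_lt (by rwa [hm])) hpi.le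
  have m2 : (m : ℝ) < n + 2 := by
    refine lt_of_mul_lt_mul_right (a := Real.pi) ?_ hpi.le
    rw [hm]
    linarith
  have hmn : m = n + 1 := by
    have m1' : (n : ℤ) < m := by exact_mod_cast m1
    have m2' : m < (n : ℤ) + 2 := by exact_mod_cast m2
    omega
  refine (robinPhase_strictMono hκ).injective ?_
  rw [(robinRoot_spec hκ n).2.2.2, ← hm, hmn]
  push_cast
  ring

theorem robinRoot_unique (hκ : 0 < κ) (n : ℕ) (μ : ℝ) :
    (SolvesTrans κ μ ∧ (n : ℝ) * Real.pi ≤ √μ ∧ √μ ≤ (n + 1 : ℝ) * Real.pi)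
      ↔ μ = robinRoot hκ n ^ 2 := by
  constructor
  · rintro ⟨h, h1, h2⟩
    have hs : μ = √μ ^ 2 := (Real.sq_sqrt h.1.le).symm
    rw [hs] at h
    rw [← eq_robinRoot hκ (Real.sqrt_pos.2 (by rw [hs]; exact h.1)) h h1 h2]
    exact hs
  · rintro rfl
    obtain ⟨h0, h1, h2, _⟩ := robinRoot_spec hκ n
    rw [Real.sqrt_sq h0.le]
    exact ⟨solvesTrans_robinRoot hκ n, h1, h2⟩

theorem SolvesTrans.tan_eq {μ : ℝ} (h : SolvesTrans κ μ) (hne : μ ≠ κ ^ 2) :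
    Real.tan √μ = 2 * κ * √μ / (μ - κ ^ 2) := by
  have hsub : μ - κ ^ 2 ≠ 0 := sub_ne_zero.2 hne
  have hc : Real.cos √μ ≠ 0 := fun hc => by
    have h1 := h.2
    rw [hc, mul_zero, mul_eq_zero] at h1
    have := Real.sin_sq_add_cos_sq √μ
    rw [hc, h1.resolve_left hsub] at this
    norm_num at this
  rw [Real.tan_eq_sin_div_cos, div_eq_div_iff hc hsub]
  linarith [h.2]

theorem robinRoot_isEquivalent (hκ : 0 < κ) :
    Asymptotics.IsEquivalent atTop (fun n => robinRoot hκ n ^ 2)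
      (fun n : ℕ => (n + 1 : ℝ) ^ 2 * Real.pi ^ 2) := by
  have hpi := Real.pi_pos
  rw [Asymptotics.isEquivalent_iff_tendsto_one (Eventually.of_forall fun n => by positivity)]
  have h1 : Tendsto (fun n : ℕ => (n : ℝ) / (n + 1)) atTop (𝓝 1) := tendsto_natCast_div_add_atTop 1
  have h2 : Tendsto (fun n : ℕ => robinRoot hκ n / ((n + 1 : ℝ) * Real.pi)) atTop (𝓝 1) := by
    refine tendsto_of_tendsto_of_tendsto_of_le_of_le h1 tendsto_const_nhds (fun n => ?_) fun n => ?_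
    · rw [div_le_div_iff₀ (by positivity) (by positivity)]
      have := (robinRoot_spec hκ n).2.1
      have hn : (0 : ℝ) ≤ n + 1 := by positivity
      nlinarith
    · exact (div_le_one (by positivity)).2 (robinRoot_spec hκ n).2.2.1
  have h3 := h2.pow 2
  rw [one_pow] at h3
  refine h3.congr fun n => ?_
  simp only [Pi.div_apply, div_pow, mul_pow]

end Roots

/-! ### Robin modes -/

section Robin

variable {κ s : ℝ}

/-- The derivative of `robinMode`. -/
noncomputable def robinModeDeriv (κ μ A q : ℝ) : ℝ :=
  A * √μ * Real.cos (√μ * q) - A * (√μ / κ) * √μ * Real.sin (√μ * q)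

theorem hasDerivAt_robinMode (κ μ A q : ℝ) :
    HasDerivAt (robinMode κ μ A) (robinModeDeriv κ μ A q) q :=
  ((hasDerivAt_const_mul_sin A √μ q).add
    (hasDerivAt_const_mul_cos (A * (√μ / κ)) √μ q)).congr_deriv (by rw [robinModeDeriv]; ring)

theorem hasDerivAt_robinModeDeriv {μ : ℝ} (hμ : 0 ≤ μ) (κ A q : ℝ) :
    HasDerivAt (robinModeDeriv κ μ A) (-μ * robinMode κ μ A q) q := by
  refine ((hasDerivAt_const_mul_cos (A * √μ) √μ q).sub
    (hasDerivAt_const_mul_sin (A * (√μ / κ) * √μ) √μ q)).congr_deriv ?_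
  rw [robinMode]
  linear_combination (-(A * Real.sin (√μ * q)) - A * (√μ / κ) * Real.cos (√μ * q)) *
    Real.sq_sqrt hμ

theorem SolvesTrans.robinBC (hκ : 0 < κ) {μ : ℝ} (h : SolvesTrans κ μ) (A : ℝ) :
    RobinBC 1 κ (robinMode κ μ A) (robinModeDeriv κ μ A) := by
  constructor
  · simp only [robinMode, robinModeDeriv, mul_zero, Real.cos_zero, Real.sin_zero]
    field_simp
    ring
  · have h2 := h.2
    simp only [robinMode, robinModeDeriv, mul_one, one_mul]
    have hs := Real.sq_sqrt h.1.le
    field_simp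
    linear_combination -A * h2 - A * Real.sin √μ * hs

theorem integral_robinMode_sq (hs : 0 < s) (A : ℝ) :
    ∫ q in (0 : ℝ)..1, robinMode κ (s ^ 2) A q ^ 2
      = A ^ 2 * ((1 + (s / κ) ^ 2) / 2 + ((s / κ) ^ 2 - 1) * Real.sin (2 * s) / (4 * s)
        + s / κ * (1 - Real.cos (2 * s)) / (2 * s)) := by
  set x := s / κ
  have hd : ∀ q ∈ uIcc (0 : ℝ) 1, HasDerivAt (fun q => A ^ 2 * ((1 + x ^ 2) / 2) * q
      + A ^ 2 * (x ^ 2 - 1) / (4 * s) * Real.sin (2 * s * q)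
      + -(A ^ 2 * x / (2 * s)) * Real.cos (2 * s * q)) (robinMode κ (s ^ 2) A q ^ 2) q :=
    fun q _ => by
      refine ((((hasDerivAt_id q).const_mul _).add (hasDerivAt_const_mul_sin _ _ q)).add
        (hasDerivAt_const_mul_cos _ _ q)).congr_deriv ?_
      have hx : s / κ = x := rfl
      rw [robinMode, Real.sqrt_sq hs.le, hx, mul_assoc 2 s q, Real.sin_two_mul, Real.cos_two_mul]
      clear_value x
      have := Real.sin_sq (s * q)
      field_simp
      ring_nf
      rw [this]
      ring
  rw [intervalIntegral.integral_eq_sub_of_hasDerivAt hd]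
  · simp only [mul_one, mul_zero, Real.sin_zero, Real.cos_zero]
    ring
  · refine Continuous.intervalIntegrable ?_ _ _
    unfold robinMode
    fun_prop

theorem exists_robinMode_norm (hκ : 0 < κ) (hs : 0 < s) :
    ∃ A : ℝ, ∫ q in (0 : ℝ)..1, robinMode κ (s ^ 2) A q ^ 2 = 1 := by
  have hI : 0 < ∫ q in (0 : ℝ)..1, robinMode κ (s ^ 2) 1 q ^ 2 := by
    refine intervalIntegral.integral_pos zero_lt_one ?_ (fun q _ => sq_nonneg _)
      ⟨0, left_mem_Icc.2 zero_le_one, ?_⟩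
    · unfold robinMode; fun_prop
    · simp only [robinMode, Real.sqrt_sq hs.le, mul_zero, Real.sin_zero, Real.cos_zero]
      positivity
  refine ⟨(√(∫ q in (0 : ℝ)..1, robinMode κ (s ^ 2) 1 q ^ 2))⁻¹, ?_⟩
  rw [integral_robinMode_sq hs, inv_pow, Real.sq_sqrt hI.le]
  rw [integral_robinMode_sq hs, one_pow, one_mul] at hI ⊢
  exact inv_mul_cancel₀ hI.ne'

/-- With `x = s/κ` and `s ≥ 1`, the oscillating term of the norm is at least `-(1 + x²)/4`, so
normalisation gives `A² (1 + x²) ≤ 4`. Then `A² (1 + x)² ≤ 8 ≤ 9`. -/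
theorem amplitude_le (hκ : 0 < κ) (hs : 1 ≤ s) {A : ℝ}
    (hA : ∫ q in (0 : ℝ)..1, robinMode κ (s ^ 2) A q ^ 2 = 1) : |A| * (1 + s / κ) ≤ 3 := by
  have hs0 : 0 < s := by linarith
  rw [integral_robinMode_sq hs0] at hA
  set x := s / κ
  have hx : 0 < x := by positivity
  have t3 : 0 ≤ x * (1 - Real.cos (2 * s)) / (2 * s) :=
    div_nonneg (mul_nonneg hx.le (by linarith [Real.cos_le_one (2 * s)])) (by linarith)
  have t2 : -((1 + x ^ 2) / 4) ≤ (x ^ 2 - 1) * Real.sin (2 * s) / (4 * s) := by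
    rw [le_div_iff₀ (by linarith)]
    have h1 : |(x ^ 2 - 1) * Real.sin (2 * s)| ≤ (1 + x ^ 2) * 1 := by
      rw [abs_mul]
      exact mul_le_mul (abs_le.2 ⟨by nlinarith, by nlinarith⟩) (Real.abs_sin_le_one _)
        (abs_nonneg _) (by positivity)
    have := (abs_le.1 h1).1
    nlinarith [sq_nonneg x]
  have h4 : A ^ 2 * (1 + x ^ 2) ≤ 4 := by
    have := mul_le_mul_of_nonneg_left (show (1 + x ^ 2) / 4 ≤ (1 + x ^ 2) / 2
      + (x ^ 2 - 1) * Real.sin (2 * s) / (4 * s) + x * (1 - Real.cos (2 * s)) / (2 * s) by linarith)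
      (sq_nonneg A)
    rw [hA] at this
    linarith
  refine abs_le_of_sq_le_sq' ?_ (by norm_num) |>.2
  rw [mul_pow, sq_abs]
  nlinarith [mul_nonneg (sq_nonneg A) (sq_nonneg (1 - x))]

theorem modeSystem_robin (hκ : 0 < κ) {A : ℕ → ℝ}
    (hA : ∀ n, ∫ q in (0 : ℝ)..1, robinMode κ (robinRoot hκ n ^ 2) (A n) q ^ 2 = 1) :
    ModeSystem 1 κ (fun n => robinRoot hκ n ^ 2) (fun n => robinMode κ (robinRoot hκ n ^ 2) (A n))
      (fun n => robinModeDeriv κ (robinRoot hκ n ^ 2) (A n)) := by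
  have hpos : ∀ n, 0 < robinRoot hκ n := fun n => (robinRoot_spec hκ n).1
  -- The root with index 0 may be smaller than 1 and is treated apart; all others are at least `π`.
  set M := max 3 (|A 0| * (1 + robinRoot hκ 0 / κ))
  have hM0 : 0 ≤ M := le_max_of_le_left (by norm_num)
  have hM : ∀ n, |A n| * (1 + robinRoot hκ n / κ) ≤ M := fun n => by
    rcases Nat.eq_zero_or_pos n with rfl | hn
    · exact le_max_right _ _
    · refine (amplitude_le hκ ?_ (hA n)).trans (le_max_left _ _)
      have h1 := (robinRoot_spec hκ n).2.1
      have h2 : (1 : ℝ) ≤ n := by exact_mod_cast hn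
      nlinarith [Real.pi_gt_three]
  have key : ∀ (n : ℕ) (y z : ℝ), |y| ≤ 1 → |z| ≤ 1 →
      |A n * y + A n * (robinRoot hκ n / κ) * z| ≤ M := fun n y z hy hz => by
    have hx : 0 < robinRoot hκ n / κ := div_pos (hpos n) hκ
    refine le_trans ?_ (hM n)
    refine (abs_add_le _ _).trans ?_
    rw [abs_mul, abs_mul, abs_mul, abs_of_pos hx, mul_add, mul_one]
    exact add_le_add (mul_le_of_le_one_right (abs_nonneg _) hy)
      (mul_le_of_le_one_right (by positivity) hz)
  refine ⟨zero_le_one, hκ, fun n q => hasDerivAt_robinMode _ _ _ q,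
    fun n q => hasDerivAt_robinModeDeriv (sq_nonneg _) _ _ q,
    fun n => (solvesTrans_robinRoot hκ n).robinBC hκ _, hA, ⟨M, hM0, fun n q => ?_⟩,
    ⟨M, hM0, fun n q => ?_⟩, fun n => pow_pos (hpos n) 2, fun n => ?_, fun n m h => ?_,
    fun s a b hs h1 h2 => ?_⟩
  · rw [robinMode, Real.sqrt_sq (hpos n).le]
    exact key n _ _ (Real.abs_sin_le_one _) (Real.abs_cos_le_one _)
  · rw [robinModeDeriv, Real.sqrt_sq (hpos n).le]
    have := key n (Real.cos (robinRoot hκ n * q)) (-Real.sin (robinRoot hκ n * q))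
      (Real.abs_cos_le_one _) (by rw [abs_neg]; exact Real.abs_sin_le_one _)
    calc _ = |robinRoot hκ n * (A n * Real.cos (robinRoot hκ n * q)
          + A n * (robinRoot hκ n / κ) * -Real.sin (robinRoot hκ n * q))| := by congr 1; ring
      _ ≤ robinRoot hκ n * M := by
          rw [abs_mul, abs_of_pos (hpos n)]
          exact mul_le_mul_of_nonneg_left this (hpos n).le
      _ ≤ _ := by
          rw [mul_comm]
          exact mul_le_mul_of_nonneg_left (by nlinarith [sq_nonneg (robinRoot hκ n - 1)]) hM0
  · have h1 := (robinRoot_spec hκ n).2.1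
    have hn : (0 : ℝ) ≤ n := n.cast_nonneg
    exact pow_le_pow_left₀ hn (by nlinarith [Real.pi_gt_three]) 2
  · have := (pow_left_inj₀ (hpos n).le (hpos m).le two_ne_zero).1 h
    have e := congrArg (robinPhase κ) this
    rw [(robinRoot_spec hκ n).2.2.2, (robinRoot_spec hκ m).2.2.2] at e
    have := mul_right_cancel₀ Real.pi_ne_zero e
    exact_mod_cast add_right_cancel this
  · rw [one_mul] at h1 h2
    rcases eq_or_ne b 0 with rfl | hb
    · have ha : a = 0 := by simpa [hκ.ne'] using h1.symm
      exact ⟨0, 0, fun q => by simp [ha]⟩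
    · have ha : a = s / κ * b := by field_simp; linarith
      have htr : SolvesTrans κ (s ^ 2) := by
        refine ⟨by positivity, ?_⟩
        rw [Real.sqrt_sq hs.le]
        refine mul_left_cancel₀ hb ?_
        rw [ha] at h2
        field_simp at h2
        linear_combination -b * h2
      have hpi := Real.pi_pos
      -- The floor selects the interval `[nπ, (n+1)π]` containing `s`.
      have e := eq_robinRoot hκ (n := ⌊s / Real.pi⌋₊) hs htr
        ((le_div_iff₀ hpi).1 (Nat.floor_le (by positivity)))
        ((div_le_iff₀ hpi).1 (Nat.lt_floor_add_one _).le)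
      set n := ⌊s / Real.pi⌋₊
      have hAn : A n ≠ 0 := fun h => by
        have := hA n
        simp [h, robinMode] at this
      refine ⟨n, b / A n, fun q => ?_⟩
      rw [robinMode, Real.sqrt_sq (hpos n).le, ← e, ha]
      field_simp
      ring

end Robin

end HeatSeries

/-! ### The concrete Dirichlet and Robin expansions -/

theorem mainTheorem6 (T α β κ : ℝ) (hT : 0 < T) (hα : α ∈ Set.Icc (0 : ℝ) 1)
    (hβ : β ∈ Set.Icc (0 : ℝ) 1) (hκ : 0 < κ) (g : ℝ → ℝ)
    (hg : AEMeasurable g (MeasureTheory.volume.restrict (Set.Icc (0 : ℝ) 1)))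
    (hg01 : ∀ q ∈ Set.Icc (0 : ℝ) 1, g q ∈ Set.Icc (0 : ℝ) 1) :
    -- Dirichlet boundary conditions (for both notions of weak solution)
    (∃ ρ : ℝ → ℝ → ℝ,
      HeatSeries.IsWeakDirichlet T α β g ρ ∧
      HeatSeries.IsWeakDirichletCompact T α β g ρ ∧
      HeatSeries.HasExpansion T g (HeatSeries.statDir α β)
        (fun n => ∫ q in (0 : ℝ)..1,
          (g q - HeatSeries.statDir α β q) * Real.sin ((n + 1 : ℝ) * Real.pi * q))
        (fun n => ((n + 1 : ℝ) * Real.pi) ^ 2)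
        (fun n q => 2 * Real.sin ((n + 1 : ℝ) * Real.pi * q)) ρ ∧
      (∀ ρ', HeatSeries.IsWeakDirichlet T α β g ρ' → HeatSeries.AgreeAE T ρ' ρ) ∧
      (∀ ρ', HeatSeries.IsWeakDirichletCompact T α β g ρ' → HeatSeries.AgreeAE T ρ' ρ)) ∧
    -- Robin boundary conditions
    (∃ lam : ℕ → ℝ,
      -- `lam n` is the unique positive root with `nπ ≤ √(lam n) ≤ (n + 1)π`, for `n = 0, 1, …`
      (∀ n : ℕ, ∀ μ : ℝ,
        (HeatSeries.SolvesTrans κ μ ∧ (n : ℝ) * Real.pi ≤ √μ ∧ √μ ≤ (n + 1 : ℝ) * Real.pi)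
          ↔ μ = lam n) ∧
      (∀ n : ℕ, lam n ≠ κ ^ 2 →
        Real.tan √(lam n) = 2 * κ * √(lam n) / (lam n - κ ^ 2)) ∧
      Asymptotics.IsEquivalent Filter.atTop lam (fun n => (n + 1 : ℝ) ^ 2 * Real.pi ^ 2) ∧
      (∀ n : ℕ, ∃ A : ℝ, ∫ q in (0 : ℝ)..1, HeatSeries.robinMode κ (lam n) A q ^ 2 = 1) ∧
      ∀ A : ℕ → ℝ,
        (∀ n, ∫ q in (0 : ℝ)..1, HeatSeries.robinMode κ (lam n) (A n) q ^ 2 = 1) →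
        (∀ n,
          (∀ q, deriv (deriv (HeatSeries.robinMode κ (lam n) (A n))) q
            = -(lam n) * HeatSeries.robinMode κ (lam n) (A n) q) ∧
          deriv (HeatSeries.robinMode κ (lam n) (A n)) 0
            = κ * HeatSeries.robinMode κ (lam n) (A n) 0 ∧
          deriv (HeatSeries.robinMode κ (lam n) (A n)) 1
            = -κ * HeatSeries.robinMode κ (lam n) (A n) 1) ∧
        ∃ ρ : ℝ → ℝ → ℝ,
          HeatSeries.IsWeakRobin T κ α β g ρ ∧
          HeatSeries.HasExpansion T g (HeatSeries.statRob κ α β)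
            (fun n => ∫ q in (0 : ℝ)..1,
              (g q - HeatSeries.statRob κ α β q) * HeatSeries.robinMode κ (lam n) (A n) q)
            lam
            (fun n q => HeatSeries.robinMode κ (lam n) (A n) q) ρ ∧
          (∀ ρ', HeatSeries.IsWeakRobin T κ α β g ρ' → HeatSeries.AgreeAE T ρ' ρ)) := by
  refine ⟨?_, fun n => HeatSeries.robinRoot hκ n ^ 2, HeatSeries.robinRoot_unique hκ,
    fun n => (HeatSeries.solvesTrans_robinRoot hκ n).tan_eq,
    HeatSeries.robinRoot_isEquivalent hκ,
    fun n => HeatSeries.exists_robinMode_norm hκ (HeatSeries.robinRoot_spec hκ n).1,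
    fun A hA => ⟨fun n => ?_, (HeatSeries.modeSystem_robin hκ hA).robin_wellPosed hT.le hα hβ hg hg01⟩⟩
  · obtain ⟨ρ, h1, h2, h3, h4⟩ :=
      HeatSeries.modeSystem_dirichlet.dirichlet_wellPosed hT.le hα hβ hg hg01
    refine ⟨ρ, h1, h2, h3.congr fun n q => ?_, h4⟩
    -- One factor `√2` comes from the normalised mode inside the coefficient, the other from the
    -- mode itself.
    have h2 : √2 * √2 = (2 : ℝ) := Real.mul_self_sqrt zero_le_two
    simp only [mul_left_comm _ (√2), intervalIntegral.integral_const_mul]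
    linear_combination (∫ q in (0 : ℝ)..1, (g q - HeatSeries.statDir α β q)
      * Real.sin ((n + 1 : ℝ) * Real.pi * q)) * Real.sin ((n + 1 : ℝ) * Real.pi * q) * h2
  · have hs := (HeatSeries.solvesTrans_robinRoot hκ n)
    have hd : deriv (HeatSeries.robinMode κ (HeatSeries.robinRoot hκ n ^ 2) (A n))
        = HeatSeries.robinModeDeriv κ (HeatSeries.robinRoot hκ n ^ 2) (A n) :=
      funext fun q => (HeatSeries.hasDerivAt_robinMode _ _ _ q).deriv
    obtain ⟨b0, b1⟩ := hs.robinBC hκ (A n)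
    rw [one_mul] at b0 b1
    rw [hd]
    exact ⟨fun q => (HeatSeries.hasDerivAt_robinModeDeriv hs.1.le _ _ q).deriv, b0,
      by rw [b1, neg_mul]⟩
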